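/- Let $\mathbf k$ be an algebraically closed field, $Q$ a finite quiver and $I$ an ideal of $\mathbf kQ$ generated by paths of length two such that $\Lambda=\mathbf kQ/I$ is finite-dimensional and gentle: at most two arrows start and at most two end at each vertex; for each arrow $a$ there is at most one arrow $b$ such that $ba$ is a path not in $I$, at most one arrow $c$ such that $ac$ is a path not in $I$, at most one arrow $b$ such that $ba$ is a path in $I$, and at most one arrow $c$ such that $ac$ is a path in $I$. Modules are left modules, paths are written from right to left, $s(p)$ and $e(p)$ are the start and the end of $p$, maps are composed from left to right, and $P(x)=\Lambda e_x$. *Words.* A path in $(Q,I)$ is a path in $Q$ without subpath in $I$. A (nontrivial) homotopy letter is a nontrivial path $p$ in $(Q,I)$ (direct letter) or a formal inverse $\bar p$ of such a path, with $s(\bar p)=e(p)$, $e(\bar p)=s(p)$ (inverse letter). A *band word* is a nonempty word $\sigma=\sigma_m\cdots\sigma_1$ in homotopy letters, with as many direct as inverse letters, such that, with indices read cyclically, $s(\sigma_{i+1})=e(\sigma_i)$ and the product $\sigma_{i+1}\sigma_i$ involves no cancellation of an arrow with its inverse and, when both letters are direct (or both inverse), it (or its inverse) contains a relation from $I$ at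 the junction. A *homotopy band* is a band word that is not a proper power of a word. *Complexes.* Let $\sigma$ be a band word, put $x_i=e(\sigma_i)$ ($i$ modulo $m$) and $\lambda\in\mathbf k^*$. The complex $B_{\sigma,\lambda}$ is $\bigoplus_{i} P(x_i)$, with differential given by right multiplication by $\sigma_i\colon P(x_i)\to P(x_{i-1})$ for each direct letter $\sigma_i$ and by $p\colon P(x_{i-1})\to P(x_i)$ for each inverse letter $\sigma_i=\bar p$, where the map of one chosen direct letter is multiplied by $\lambda$ (the scalar is *placed* on it). The cohomological degrees of the summands are determined by the differential up to one overall shift, which is part of the data. The band complexes are the $B_{\sigma,\lambda}$ with $\sigma$ a homotopy band. *Double maps.* Let $\sigma=\beta\sigma_L\sigma_C\sigma_R\alpha$ and $\tau=\delta\tau_L\tau_C\tau_R\gamma$ be homotopy bands, where $\sigma_C,\tau_C$ are direct letters, $\sigma_L,\sigma_R$ (resp. $\tau_L,\tau_R$) are their neighbours, and $\alpha,\beta,\gamma,\delta$ are words, possibly empty. (More generally, $\beta\sigma_L$ and $\sigma_R\alpha$ may be any words $\beta',\alpha'$, possibly empty, with $\sigma=\beta'\sigma_C\alpha'$, the neighbours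 $\sigma_L,\sigma_R$ of $\sigma_C$ being read cyclically; likewise for $\tau$. This includes bands with two letters, where $\sigma_L=\sigma_R$.) Let $f_L,f_R$ be nontrivial paths in $(Q,I)$ such that $f_L\tau_C=\sigma_Cf_R$ is a path without subpath in $I$, and such that: $\sigma_L$ is inverse or $\sigma_Lf_L$ has a subpath in $I$; $\tau_L$ is direct or $f_L\bar\tau_L$ has a subpath in $I$; $\sigma_R$ is direct or $\bar\sigma_Rf_R$ has a subpath in $I$; $\tau_R$ is inverse or $f_R\tau_R$ has a subpath in $I$. Place $\lambda$ and $\mu$ on direct letters of $\sigma$ and $\tau$. A double map with components $(f_L,f_R)$ is a chain map $f^\bullet\colon B_{\sigma,\lambda}\to B_{\tau,\mu}$ with exactly two nonzero components: $f_L\colon P(e(\sigma_C))\to P(e(\tau_C))$ and $f_R\colon P(s(\sigma_C))\to P(s(\tau_C))$ (between summands of equal degrees). The components may be multiplied by scalars in $\mathbf k^*$ for which the square formed with the differentials at $\sigma_C$ and $\tau_C$ commutes; this is needed when $\lambda$ is placed on $\sigma_C$ or $\mu$ on $\tau_C$. **Proposition.** Let $f^\bullet\colon B_{\sigma,\lambda}\to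 B_{\tau,\mu}$ be a double map with components $(f_L,f_R)$ that is not null-homotopic. Then $$c=\beta\sigma_L\,f_L\,\bar\tau_L\bar\delta\,\bar\gamma\bar\tau_R\,\bar f_R\,\sigma_R\alpha$$ is a band word (hence a homotopy band unless it is a proper power), and the mapping cone of $f^\bullet$ is isomorphic, as a complex of $\Lambda$-modules, to $B_{c,-\lambda\mu^{-1}}$. Here the scalar $-\lambda\mu^{-1}$ may be placed on any direct letter of $c$, and the left endpoint of $c$ is in degree one less than the left endpoint of $\sigma$. -/

import Mathlib

open CategoryTheory

universe u v w

namespace Gentle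

noncomputable section

/-! ### Quivers with quadratic monomial relations and their algebras

A relation `R b a` means that the length two path `b a` (first `a`, then `b`) belongs to the
ideal `I`.  Paths are written from right to left, as lists of arrows. -/

/-- The type of arrows of a quiver: `a.left` is the source `s(a)` and `a.right` the end `e(a)`. -/
abbrev Arrow (V : Type v) [Quiver.{w} V] := Quiver.Total V

section Algebra

variable (k : Type u) [Field k] {V : Type v} [Fintype V] [Quiver.{w} V]
  (R : Arrow V → Arrow V → Prop)

/-- The free algebra on the vertices and the arrows. -/
abbrev FreeAlg (k : Type u) [Field k] (V : Type v) [Quiver.{w} V] :=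
  FreeAlgebra k (V ⊕ Arrow V)

/-- The defining relations of `k Q / I`: the trivial paths are orthogonal idempotents with sum
one, `e_{e(a)} a = a = a e_{s(a)}` for every arrow, and `b a = 0` if `b a ∈ I`. -/
inductive Rel : FreeAlg k V → FreeAlg k V → Prop
  | idem (x : V) : Rel (FreeAlgebra.ι k (Sum.inl x) * FreeAlgebra.ι k (Sum.inl x))
      (FreeAlgebra.ι k (Sum.inl x))
  | orth (x y : V) (h : x ≠ y) :
      Rel (FreeAlgebra.ι k (Sum.inl x) * FreeAlgebra.ι k (Sum.inl y)) 0
  | unit : Rel (∑ x : V, FreeAlgebra.ι k (Sum.inl x)) 1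
  | tgt (a : Arrow V) : Rel (FreeAlgebra.ι k (Sum.inl a.right) * FreeAlgebra.ι k (Sum.inr a))
      (FreeAlgebra.ι k (Sum.inr a))
  | src (a : Arrow V) : Rel (FreeAlgebra.ι k (Sum.inr a) * FreeAlgebra.ι k (Sum.inl a.left))
      (FreeAlgebra.ι k (Sum.inr a))
  | zero (b a : Arrow V) (h : R b a) :
      Rel (FreeAlgebra.ι k (Sum.inr b) * FreeAlgebra.ι k (Sum.inr a)) 0

/-- The algebra `Λ = k Q / I`, by generators and relations. -/
abbrev Alg := RingQuot (Rel k R)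

/-- The trivial path `e_x` in `Λ`. -/
def idem (x : V) : Alg k R := RingQuot.mkAlgHom k (Rel k R) (FreeAlgebra.ι k (Sum.inl x))

/-- The arrow `a` in `Λ`. -/
def arrow (a : Arrow V) : Alg k R := RingQuot.mkAlgHom k (Rel k R) (FreeAlgebra.ι k (Sum.inr a))

/-- The element of `Λ` given by the product of a list of arrows. -/
def pathElt (p : List (Arrow V)) : Alg k R := (p.map (arrow k R)).prod

/-- `(Q, I)` is gentle, with `I` generated by the length two paths `b a` such that `R b a`, and
`k Q / I` is finite-dimensional. -/
structure IsGentle : Prop where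
  comp : ∀ b a, R b a → b.left = a.right
  starts : ∀ x : V, {a : Arrow V | a.left = x}.encard ≤ 2
  ends : ∀ x : V, {a : Arrow V | a.right = x}.encard ≤ 2
  nonrel_left : ∀ a, {b : Arrow V | b.left = a.right ∧ ¬ R b a}.Subsingleton
  nonrel_right : ∀ a, {c : Arrow V | a.left = c.right ∧ ¬ R a c}.Subsingleton
  rel_left : ∀ a, {b : Arrow V | R b a}.Subsingleton
  rel_right : ∀ a, {c : Arrow V | R a c}.Subsingleton
  finite : Module.Finite k (Alg k R)

end Algebra

/-! ### Paths, homotopy letters, homotopy bands -/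

section Words

variable {V : Type v} [Quiver.{w} V] (R : Arrow V → Arrow V → Prop)

/-- A list of arrows is composable and has no subpath in `I`. -/
def NoRel (p : List (Arrow V)) : Prop := p.IsChain fun b a => b.left = a.right ∧ ¬ R b a

/-- A path has a subpath in `I`. -/
def HasRel (p : List (Arrow V)) : Prop := ∃ b a, R b a ∧ [b, a] <:+: p

/-- A nontrivial path in `(Q, I)`, written from right to left. -/
structure NPath where
  arrows : List (Arrow V)
  ne : arrows ≠ []
  noRel : NoRel R arrows

variable {R}

/-- The leftmost arrow (the last one to be traversed). -/
def NPath.leftmost (p : NPath R) : Arrow V := p.arrows.head p.ne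

/-- The rightmost arrow (the first one to be traversed). -/
def NPath.rightmost (p : NPath R) : Arrow V := p.arrows.getLast p.ne

/-- The end `e(p)`. -/
def NPath.tgt (p : NPath R) : V := p.leftmost.right

/-- The start `s(p)`. -/
def NPath.src (p : NPath R) : V := p.rightmost.left

variable (R) in
/-- A nontrivial homotopy letter: a direct letter `p` or an inverse letter `p⁻¹`, where `p` is a
nontrivial path in `(Q, I)`. -/
inductive Letter
  | dir (p : NPath R) : Letter
  | inv (p : NPath R) : Letter

/-- The left endpoint `e(ℓ)` of a letter. -/
def Letter.left : Letter R → V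
  | .dir p => p.tgt
  | .inv p => p.src

/-- The right endpoint `s(ℓ)` of a letter. -/
def Letter.right : Letter R → V
  | .dir p => p.src
  | .inv p => p.tgt

/-- The formal inverse of a letter. -/
def Letter.bar : Letter R → Letter R
  | .dir p => .inv p
  | .inv p => .dir p

/-- Being direct. -/
def Letter.isDir : Letter R → Bool
  | .dir _ => true
  | .inv _ => false

/-- `1` for direct letters, `-1` for inverse letters: the change of the cohomological degree from
the left to the right endpoint. -/
def Letter.sign : Letter R → ℤ
  | .dir _ => 1
  | .inv _ => -1

/-- The underlying path of a letter. -/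
def Letter.path : Letter R → NPath R
  | .dir p => p
  | .inv p => p

/-- The word `ℓ m` is a walk with `ℓ` and `m` as its homotopy letters: the two letters are
composable, there is no cancellation between them, and they do not merge into one letter. -/
def Adjacent : Letter R → Letter R → Prop
  | .dir p, .dir q => p.src = q.tgt ∧ R p.rightmost q.leftmost
  | .inv p, .inv q => p.tgt = q.src ∧ R q.rightmost p.leftmost
  | .dir p, .inv q => p.src = q.src ∧ p.rightmost ≠ q.rightmost
  | .inv p, .dir q => p.tgt = q.tgt ∧ p.leftmost ≠ q.leftmost

/-- The formal inverse of a word. -/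
def barWord (s : List (Letter R)) : List (Letter R) := (s.map Letter.bar).reverse

/-- A nonempty closed walk, decomposed into its homotopy letters (written from left to right as
in `σ_m ⋯ σ_1`), such that all its cyclic permutations are homotopy strings with the same letters,
and with as many direct as inverse homotopy letters. -/
structure IsBandWord (s : List (Letter R)) : Prop where
  ne : s ≠ []
  adj : ∀ i : Fin s.length, Adjacent (s.get i) (s.get (finRotate _ i))
  balanced : s.countP Letter.isDir = s.countP (fun l => !l.isDir)

/-- A homotopy band: a band word that is not a proper power. -/
structure IsHomotopyBand (s : List (Letter R)) : Prop extends IsBandWord s where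
  primitive : ¬ ∃ (t : List (Letter R)) (m : ℕ), 1 < m ∧ s = (List.replicate m t).flatten

/-- The cohomological degree of the left endpoint of the `i`-th letter, if the left endpoint of
the whole word is in degree `a`. -/
def deg (s : List (Letter R)) (a : ℤ) (i : Fin s.length) : ℤ :=
  a + ((s.take i).map Letter.sign).sum

/-- The position of the endpoint of the `i`-th letter at which the corresponding map of
projectives starts. The position `j` stands for the left endpoint of the `j`-th letter. -/
def tailPos (s : List (Letter R)) (i : Fin s.length) : Fin s.length :=
  if (s.get i).isDir then i else finRotate _ i

/-- The position at which the map of projectives given by the `i`-th letter ends. -/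
def headPos (s : List (Letter R)) (i : Fin s.length) : Fin s.length :=
  if (s.get i).isDir then finRotate _ i else i

lemma sum_sign (s : List (Letter R)) :
    (s.map Letter.sign).sum
      = (s.countP Letter.isDir : ℤ) - (s.countP (fun l => !l.isDir) : ℤ) := by
  induction s with
  | nil => simp
  | cons l s ih =>
    rw [List.map_cons, List.sum_cons, ih, List.countP_cons, List.countP_cons]
    rcases l with p | p
    · have h1 : (Letter.dir p).isDir = true := rfl
      have h2 : (Letter.dir p).sign = 1 := rfl
      rw [h1, h2]; push_cast; simp; ring
    · have h1 : (Letter.inv p).isDir = false := rfl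
      have h2 : (Letter.inv p).sign = -1 := rfl
      rw [h1, h2]; push_cast; simp; ring

lemma finRotate_val {n : ℕ} (i : Fin n) :
    ((finRotate n i : Fin n) : ℕ) = if (i : ℕ) + 1 = n then 0 else (i : ℕ) + 1 := by
  cases n with
  | zero => exact i.elim0
  | succ n =>
    rw [coe_finRotate]
    simp only [Fin.ext_iff, Fin.val_last, add_left_inj]

lemma deg_rotate {s : List (Letter R)} (hs : IsBandWord s) (a : ℤ) (i : Fin s.length) :
    deg s a (finRotate _ i) = deg s a i + (s.get i).sign := by
  have key : ((s.take (i + 1)).map Letter.sign).sum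
      = ((s.take i).map Letter.sign).sum + (s.get i).sign := by
    rw [List.take_add_one]
    simp
  have hsum : (s.map Letter.sign).sum = 0 := by
    rw [sum_sign, hs.balanced, sub_self]
  unfold deg
  rw [add_assoc, ← key]
  congr 1
  rw [finRotate_val]
  split_ifs with h
  · rw [h, List.take_length, hsum]; simp
  · rfl

lemma headPos_deg {s : List (Letter R)} (hs : IsBandWord s) (a : ℤ) (i : Fin s.length) :
    deg s a (headPos s i) = deg s a (tailPos s i) + 1 := by
  have := deg_rotate hs a i
  unfold headPos tailPos
  rcases hi : s.get i with p | p <;> rw [hi] at this <;>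
    simp only [Letter.isDir, Letter.sign, if_true, if_false, Bool.false_eq_true] at this ⊢ <;> omega

end Words

/-! ### Band complexes -/

section Complexes

variable (k : Type u) [Field k] {V : Type v} [Fintype V] [Quiver.{w} V]
  {R : Arrow V → Arrow V → Prop}

lemma idem_mul_arrow (a : Arrow V) : idem k R a.right * arrow k R a = arrow k R a := by
  rw [idem, arrow, ← map_mul]
  exact RingQuot.mkAlgHom_rel k (Rel.tgt a)

lemma arrow_mul_idem (a : Arrow V) : arrow k R a * idem k R a.left = arrow k R a := by
  rw [idem, arrow, ← map_mul]
  exact RingQuot.mkAlgHom_rel k (Rel.src a)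

lemma arrow_mul_arrow {b a : Arrow V} (h : R b a) : arrow k R b * arrow k R a = 0 := by
  rw [arrow, arrow, ← map_mul, RingQuot.mkAlgHom_rel k (Rel.zero b a h), map_zero]

lemma pathElt_mul_idem (p : NPath R) :
    pathElt k R p.arrows * idem k R p.src = pathElt k R p.arrows := by
  unfold pathElt NPath.src NPath.rightmost
  have h : (p.arrows.map (arrow k R)).prod
      = (p.arrows.dropLast.map (arrow k R)).prod * arrow k R (p.arrows.getLast p.ne) := by
    conv_lhs => rw [← List.dropLast_append_getLast p.ne]
    simp
  rw [h, mul_assoc, arrow_mul_idem]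

lemma pathElt_mul_pathElt {p q : NPath R} (h : R p.rightmost q.leftmost) :
    pathElt k R p.arrows * pathElt k R q.arrows = 0 := by
  unfold pathElt
  conv_lhs => rw [← List.dropLast_append_getLast p.ne, ← List.cons_head_tail q.ne]
  have := arrow_mul_arrow k h
  unfold NPath.rightmost NPath.leftmost at this
  simp only [List.map_append, List.map_cons, List.map_nil, List.prod_append, List.prod_cons,
    List.prod_nil, mul_one]
  rw [mul_assoc, ← mul_assoc (arrow k R (p.arrows.getLast p.ne)), this, zero_mul, mul_zero]

variable {k}

/-- The scalar on the `i`-th letter: `c` is placed on the `r`-th letter. -/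
def scal {n : ℕ} (c : kˣ) (r i : Fin n) : kˣ := if i = r then c else 1

/-- The differential of a band complex as a matrix over `Λ`: a direct letter `p` contributes the
map `p` from its left to its right endpoint, an inverse letter `p⁻¹` the map `p` from its right to
its left endpoint, and the `r`-th letter carries the scalar `c`. -/
def bandMatrix (s : List (Letter R)) (c : kˣ) (r : Fin s.length) :
    Matrix (Fin s.length) (Fin s.length) (Alg k R) :=
  ∑ i, Matrix.single (tailPos s i) (headPos s i)
    ((scal c r i : k) • pathElt k R (s.get i).path.arrows)

lemma bandMatrix_mul_self {s : List (Letter R)} (hs : IsBandWord s) (c : kˣ)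
    (r : Fin s.length) : bandMatrix s c r * bandMatrix s c r = 0 := by
  unfold bandMatrix
  rw [Finset.sum_mul]
  refine Finset.sum_eq_zero fun i _ => ?_
  rw [Finset.mul_sum]
  refine Finset.sum_eq_zero fun j _ => ?_
  by_cases h : headPos s i = tailPos s j
  · rw [h, Matrix.single_mul_single_same, smul_mul_smul_comm]
    suffices H : pathElt k R (s.get i).path.arrows * pathElt k R (s.get j).path.arrows = 0 by
      rw [H, smul_zero, Matrix.single_zero]
    unfold headPos tailPos at h
    rcases hi : s.get i with p | p <;> rcases hj : s.get j with q | q <;>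
      simp only [hi, hj, Letter.isDir, if_true, if_false, Bool.false_eq_true] at h
    · have := hs.adj i
      rw [h, hi, hj] at this
      exact pathElt_mul_pathElt k this.2
    · have := (finRotate _).injective h
      subst this
      rw [hi] at hj
      cases hj
    · subst h
      rw [hi] at hj
      cases hj
    · have := hs.adj j
      rw [← h, hi, hj] at this
      exact pathElt_mul_pathElt k this.2
  · rw [Matrix.single_mul_single_of_ne _ _ _ _ h]

/-- The degree `n` part of a band complex: the direct sum of the left modules `P(x) = Λ e_x`, one
for each position `i` of degree `n`, where `x` is the vertex at that position. It is realised as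
the set of all families `f` with `f i ∈ Λ e_x`, supported in the positions of degree `n`. -/
def piece (k : Type u) [Field k] (s : List (Letter R)) (a n : ℤ) :
    Submodule (Alg k R) (Fin s.length → Alg k R) where
  carrier := {f | (∀ i, f i * idem k R (s.get i).left = f i) ∧ ∀ i, deg s a i ≠ n → f i = 0}
  add_mem' := fun {f g} hf hg =>
    ⟨fun i => by simp only [Pi.add_apply, add_mul, hf.1 i, hg.1 i],
      fun i h => by simp only [Pi.add_apply, hf.2 i h, hg.2 i h, add_zero]⟩
  zero_mem' := ⟨fun i => by simp, fun i _ => rfl⟩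
  smul_mem' := fun b f hf =>
    ⟨fun i => by simp only [Pi.smul_apply, smul_eq_mul, mul_assoc, hf.1 i],
      fun i h => by simp only [Pi.smul_apply, hf.2 i h, smul_zero]⟩

lemma path_mul_idem_headPos {s : List (Letter R)} (hs : IsBandWord s) (i : Fin s.length) :
    pathElt k R (s.get i).path.arrows * idem k R (s.get (headPos s i)).left
      = pathElt k R (s.get i).path.arrows := by
  have hadj := hs.adj i
  unfold headPos
  rcases hi : s.get i with p | p
  · have : (s.get (finRotate _ i)).left = p.src := by
      rw [hi] at hadj
      rcases hj : s.get (finRotate _ i) with q | q <;> rw [hj] at hadj <;> exact hadj.1.symm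
    simp only [Letter.isDir, if_true]
    rw [this]
    exact pathElt_mul_idem k p
  · simp only [Letter.isDir, Bool.false_eq_true, if_false, hi]
    exact pathElt_mul_idem k p

lemma vecMul_mem {s : List (Letter R)} (hs : IsBandWord s) (c : kˣ) (r : Fin s.length)
    (a n : ℤ) (f : Fin s.length → Alg k R) (hf : f ∈ piece k s a n) :
    Matrix.vecMul f (bandMatrix s c r) ∈ piece k s a (n + 1) := by
  unfold bandMatrix
  rw [Matrix.vecMul_sum]
  refine Submodule.sum_mem _ fun i _ => ?_
  have hval : ∀ j, Matrix.vecMul f (Matrix.single (tailPos s i) (headPos s i)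
      ((scal c r i : k) • pathElt k R (s.get i).path.arrows)) j
      = if headPos s i = j then
          f (tailPos s i) * ((scal c r i : k) • pathElt k R (s.get i).path.arrows) else 0 := by
    intro j
    simp only [Matrix.vecMul, dotProduct, Matrix.single_apply]
    rw [Finset.sum_eq_single (tailPos s i)]
    · by_cases h : headPos s i = j <;> simp [h]
    · intro b _ hb
      rw [if_neg (fun h => hb h.1.symm), mul_zero]
    · simp
  refine ⟨fun j => ?_, fun j hj => ?_⟩
  · rw [hval]
    split_ifs with h
    · subst h
      rw [mul_assoc, smul_mul_assoc, path_mul_idem_headPos hs]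
    · rw [zero_mul]
  · rw [hval]
    split_ifs with h
    · subst h
      rw [headPos_deg hs] at hj
      rw [hf.2 _ (fun h => hj (by rw [h])), zero_mul]
    · rfl

/-- The differential of a band complex in degree `n`. -/
def bandD {s : List (Letter R)} (hs : IsBandWord s) (c : kˣ) (r : Fin s.length) (a n : ℤ) :
    piece k s a n →ₗ[Alg k R] piece k s a (n + 1) where
  toFun f := ⟨Matrix.vecMul f.1 (bandMatrix s c r), vecMul_mem hs c r a n f.1 f.2⟩
  map_add' f g := Subtype.ext (Matrix.add_vecMul (bandMatrix s c r) f.1 g.1)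
  map_smul' b f := Subtype.ext (Matrix.smul_vecMul b f.1 (bandMatrix s c r))

lemma bandD_comp {s : List (Letter R)} (hs : IsBandWord s) (c : kˣ) (r : Fin s.length)
    (a n : ℤ) : bandD hs c r a (n + 1) ∘ₗ bandD hs c r a n = 0 := by
  refine LinearMap.ext fun f => Subtype.ext ?_
  change Matrix.vecMul (Matrix.vecMul f.1 (bandMatrix s c r)) (bandMatrix s c r) = 0
  rw [Matrix.vecMul_vecMul, bandMatrix_mul_self hs, Matrix.vecMul_zero]

/-- The complex of left `Λ`-modules `B_{s, c}` with the scalar `c` placed on the `r`-th letter of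
`s`, and with the left endpoint of `s` in cohomological degree `a`. -/
def bandComplex {s : List (Letter R)} (hs : IsBandWord s) (c : kˣ) (r : Fin s.length) (a : ℤ) :
    CochainComplex (ModuleCat (Alg k R)) ℤ :=
  CochainComplex.of (fun n => ModuleCat.of (Alg k R) (piece k s a n))
    (fun n => ModuleCat.ofHom (bandD hs c r a n))
    (fun n => by rw [← ModuleCat.ofHom_comp, bandD_comp]; rfl)

/-! ### Double maps -/

/-- The combinatorial conditions on the components `(f_L, f_R)` of a double map, where `σ_C`,
`τ_C` are direct, `σ_L`, `σ_R` are the letters to the left and to the right of `σ_C`, and `τ_L`,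
`τ_R` those of `τ_C`. -/
structure IsDoublePair (σL σR τL τR : Letter R) (σC τC fL fR : NPath R) : Prop where
  comm : fL.arrows ++ τC.arrows = σC.arrows ++ fR.arrows
  noRel : NoRel R (fL.arrows ++ τC.arrows)
  L1 : ∀ p, σL = .dir p → HasRel R (p.arrows ++ fL.arrows)
  L2 : ∀ p, τL = .inv p → HasRel R (fL.arrows ++ p.arrows)
  R1 : ∀ p, σR = .inv p → HasRel R (p.arrows ++ fR.arrows)
  R2 : ∀ p, τR = .dir p → HasRel R (fR.arrows ++ p.arrows)

/-- The chain map `φ` from `B_{s, c}` to `B_{t, d}` has exactly two nonzero components: `y f_L`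
between the left endpoints of the letters `i` of `s` and `j` of `t`, and `z f_R` between the right
endpoints of these letters. -/
def HasComponents {s t : List (Letter R)} {hs : IsBandWord s} {ht : IsBandWord t} {c d : kˣ}
    {r : Fin s.length} {q : Fin t.length} {a b : ℤ}
    (φ : bandComplex hs c r a ⟶ bandComplex ht d q b) (i : Fin s.length) (j : Fin t.length)
    (y z : kˣ) (fL fR : NPath R) : Prop :=
  ∀ (n : ℤ) (f : piece k s a n), (show piece k t b n from (φ.f n).hom f).1 =
    Matrix.vecMul f.1 (Matrix.single i j ((y : k) • pathElt k R fL.arrows) +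
      Matrix.single (finRotate _ i) (finRotate _ j) ((z : k) • pathElt k R fR.arrows))

/-- The position of the letter `l` in the word `x l y`. -/
def midPos (x : List (Letter R)) (l : Letter R) (y : List (Letter R)) :
    Fin (x ++ l :: y).length :=
  ⟨x.length, by simp⟩

/-- The word `c = x f_L (x')⁻¹ (y')⁻¹ f_R⁻¹ y`, where the two bands are `x σ_C y` and
`x' τ_C y'`. -/
def coneWord (x y x' y' : List (Letter R)) (fL fR : NPath R) : List (Letter R) :=
  x ++ .dir fL :: (barWord x' ++ barWord y' ++ .inv fR :: y)

end Complexes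

end

end Gentle

/-! Forgetting scalars, the mapping cone is a diagram of projectives: the cycle of σ, the cycle of
τ, and two arrows `f_L`, `f_R` joining them at the ends of σ_C and τ_C. The word `c` is this diagram
with the edges σ_C and τ_C erased: follow σ from the right end of σ_C round to its left end, cross
`f_L`, follow τ backwards from the left end of τ_C to its right end, and return along the inverse of
`f_R`. So σ_C and τ_C have to be removed by a change of basis, which adds to the coordinate at step
`m` of `c` a contribution from τ multiplied by an element `ε m`.

The equation f_L τ_C = σ_C f_R leaves three cases (`double_cases`). If σ_C = f_L g and τ_C = g f_R,
the single correction `ε 0 = g` suffices. If f_L = σ_C h and f_R = h τ_C, then `h` is a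
null-homotopy, which is excluded. If f_L = σ_C and f_R = τ_C, the correction starts with the
identity and must continue with identities as long as σ, read to the right from σ_C, and the inverse
of τ, read from the left end of τ_C, have the same letters. These periodic sequences differ within
the first S + T letters (`exists_first_ne`), S and T being the lengths of the two bands. By
gentleness the first two distinct letters are comparable (`exists_fits`): either the correction can
be stopped there by a path or by zero (`JoinData.concatData_of_fits`), or identities in the opposite
direction, from σ to τ, form a null-homotopy (`JoinData.nonempty_homotopy_of_fits`), which is
excluded.

The agreement may last longer than a turn around either band. The quantity multiplied by `ε m` is
therefore `overlapSum`, which picks up the coordinates of σ at every turn around τ, so that it still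
commutes with the differentials (`overlapSum_intertwine`). The resulting map is injective
(`concatSeq_injective`), and bijective by finiteness (`exists_mem_of_injective`).

The scalars are gauged away except for one factor per turn. This is λ around σ and the inverse of μ
around τ walked backwards. The sign comes from the minus in front of the differential of σ in the
cone: these signs cancel around the balanced word σ, hence not when σ_C is left out. -/

namespace Gentle

noncomputable section

/-! ### Intertwining two periodic zigzags -/

section Sequences

variable {k Λ : Type*} [Field k] [Ring Λ] [Algebra k Λ]

/-- The sequence with `G m = γ m` for `m < T` and `G (m + T) = ν (G m + φ m)`, if
`γ (m + T) = ν γ m`. -/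
def overlapSum (T : ℕ) (ν : k) (φ γ : ℕ → Λ) (m : ℕ) : Λ :=
  γ m + ∑ l ∈ Finset.range (m / T), ν ^ (l + 1) • φ (m - (l + 1) * T)

lemma overlapSum_of_lt {T : ℕ} (ν : k) (φ γ : ℕ → Λ) {m : ℕ} (h : m < T) :
    overlapSum T ν φ γ m = γ m := by
  simp [overlapSum, Nat.div_eq_of_lt h]

lemma overlapSum_add {T : ℕ} (hT : 0 < T) {ν : k} (φ : ℕ → Λ) {γ : ℕ → Λ}
    (hγ : ∀ m, γ (m + T) = ν • γ m) (m : ℕ) :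
    overlapSum T ν φ γ (m + T) = ν • (overlapSum T ν φ γ m + φ m) := by
  unfold overlapSum
  rw [Nat.add_div_right _ hT, Finset.sum_range_succ', hγ, smul_add, smul_add, Finset.smul_sum,
    add_assoc]
  congr 2
  · refine Finset.sum_congr rfl fun l _ => ?_
    rw [smul_smul, ← pow_succ']
    congr 2
    have : (l + 1 + 1) * T = (l + 1) * T + T := by ring
    omega
  · simp

/-- The differential of the mapping cone of a double map, in normalised coordinates: the families
`φ`, `γ` on the two unrolled bands are mapped to `φ'`, `γ'`. -/
structure ConeSeq (S T : ℕ) (α ν : k) (ds is dt it : ℕ → Λ) (fL fR : Λ)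
    (φ γ φ' γ' : ℕ → Λ) : Prop where
  γ_add : ∀ m, γ (m + T) = ν • γ m
  γ'_add : ∀ m, γ' (m + T) = ν • γ' m
  φ'_zero : φ' 0 = α • (φ (S - 1) * ds (S - 1)) + φ 1 * is 0
  φ'_succ : ∀ m, φ' (m + 1) = φ m * ds m + φ (m + 2) * is (m + 1)
  γ'_zero : γ' 0 = γ 1 * it 0 - α • (φ (S - 1) * fL)
  γ'_succ : ∀ m, m + 2 < T → γ' (m + 1) = γ m * dt m + γ (m + 2) * it (m + 1)
  γ'_last : ∀ m, m + 2 = T →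
    γ' (m + 1) = γ m * dt m + ν • (γ 0 * it (m + 1)) + ν • (φ 0 * fR)

/-- The overlap sums are compatible with the differentials as long as the two bands agree. -/
lemma overlapSum_intertwine {S T : ℕ} (hT : 2 ≤ T) {α ν : k} {ds is dt it : ℕ → Λ}
    {φ γ φ' γ' : ℕ → Λ} (h : ConeSeq S T α ν ds is dt it (ds (S - 1)) (it (T - 1)) φ γ φ' γ')
    (hdt : ∀ m, dt (m + T) = dt m) (hit : ∀ m, it (m + T) = it m) (hdt0 : dt (T - 1) = 0)
    {M : ℕ} (hd : ∀ m < M, ds m = dt m) (hi : ∀ m < M, is m = it m) (m : ℕ) (hm : m ≤ M) :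
    overlapSum T ν φ' γ' (m + 1) = overlapSum T ν φ γ m * dt m
      + overlapSum T ν φ γ (m + 2) * it (m + 1) := by
  have hT0 : 0 < T := by omega
  have add := overlapSum_add hT0 φ h.γ_add
  have add' := overlapSum_add hT0 φ' h.γ'_add
  induction m using Nat.strong_induction_on with
  | _ m ih =>
  rcases lt_trichotomy (m + 2) T with h1 | h1 | h1
  · rw [overlapSum_of_lt _ _ _ (by omega), overlapSum_of_lt _ _ _ (by omega),
      overlapSum_of_lt _ _ _ h1, h.γ'_succ m h1]
  -- The term of `f_R` = τ_C in the last row is exactly the summand `φ 0` that the overlap sum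
  -- acquires at time `T`.
  · have h2 : m + 2 = 0 + T := by omega
    rw [overlapSum_of_lt _ _ _ (by omega), overlapSum_of_lt _ _ _ (by omega), h2, add,
      overlapSum_of_lt _ _ _ hT0, h.γ'_last m h1]
    have : it (T - 1) = it (m + 1) := by congr 1; omega
    rw [this]
    simp only [smul_mul_assoc, add_mul, smul_add]
    abel
  · rcases Nat.eq_or_lt_of_le (show T ≤ m + 1 by omega) with h2 | h2
    -- The contributions of σ_C to `φ' 0` and of `f_L` = σ_C to `γ' 0` cancel. The last letter of a
    -- turn around τ is inverse, so it has no direct part.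
    · have e1 : m + 1 = 0 + T := by omega
      have e2 : m + 2 = 1 + T := by omega
      have e3 : m = T - 1 := by omega
      rw [e1, add', overlapSum_of_lt _ _ _ hT0, e2, add, overlapSum_of_lt _ _ _ (by omega : 1 < T),
        hit, e3, hdt0, mul_zero, h.φ'_zero, h.γ'_zero, hi 0 (by omega)]
      simp only [smul_mul_assoc, add_mul, smul_add, smul_sub]
      abel
    -- Beyond one turn the identity is ν times the sum of its instance at `n` and of a row of σ; the
    -- two have the same coefficients because the letters still agree there.
    · obtain ⟨n, rfl⟩ : ∃ n, m = n + T := ⟨m - T, by omega⟩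
      have e1 : n + T + 2 = n + 2 + T := by omega
      obtain ⟨n, rfl⟩ | rfl : (∃ n', n = n' + 1) ∨ n = 0 := by
        cases n <;> simp
      · have e3 : n + 1 + T + 1 = n + 1 + 1 + T := by omega
        rw [e3, e1, add, add, add', hdt, hit, ih (n + 1) (by omega) (by omega), h.φ'_succ,
          hd _ (by omega), hi _ (by omega)]
        simp only [smul_mul_assoc, add_mul, smul_add]
        abel
      · have e3 : 0 + T + 1 = 0 + 1 + T := by omega
        rw [e3, e1, add, add, add', hdt, hit, ih 0 (by omega) (by omega), h.φ'_succ,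
          hd _ (by omega), hi _ (by omega)]
        simp only [smul_mul_assoc, add_mul, smul_add]
        abel

/-- The normalised coordinates of the isomorphism from the mapping cone to the complex of the
concatenated band. -/
def concatSeq (S T : ℕ) (α ν : k) (ε : ℕ → Λ) (φ γ : ℕ → Λ) (m : ℕ) : Λ :=
  (if m < S then φ m else -(α⁻¹ • γ (m - S))) + overlapSum T ν φ γ m * ε m

/-- The edge conditions `hed` and `hei` let the correction terms pass through the differential. The
cone and the complex of `c` differ only by the edges σ_C and τ_C, and `hL`, `hR` say that `ε 0`
produces exactly these out of `f_L` and `f_R`. -/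
lemma concatSeq_intertwine {S T : ℕ} (hS : 2 ≤ S) (hT : 2 ≤ T) {α ν : k} (hα : α ≠ 0)
    {ds is dt it dc ic : ℕ → Λ} {fL fR : Λ} {φ γ φ' γ' : ℕ → Λ}
    (h : ConeSeq S T α ν ds is dt it fL fR φ γ φ' γ') (ε : ℕ → Λ)
    (his : is (S - 1) = 0)
    (hc1 : ∀ m < S - 1, dc m = ds m ∧ ic m = is m) (hc2 : dc (S - 1) = fL ∧ ic (S - 1) = 0)
    (hc3 : ∀ m < T - 1, dc (S + m) = dt m ∧ ic (S + m) = it m) (hc4 : ic (S + T - 1) = fR)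
    (hL : fL * ε 0 = ds (S - 1)) (hR : ε 0 * fR = it (T - 1))
    (hed : ∀ m < S + T, dt m * ε (m + 1) = ε m * dc m)
    (hei : ∀ m < S + T, it m * ε m = ε (m + 1) * ic m) (hεN : ε (S + T) = 0)
    (hG : ∀ m, ε (m + 1) ≠ 0 → overlapSum T ν φ' γ' (m + 1) = overlapSum T ν φ γ m * dt m
      + overlapSum T ν φ γ (m + 2) * it (m + 1)) :
    concatSeq S T α ν ε φ' γ' 0 = concatSeq S T α ν ε φ γ 1 * ic 0 ∧
    (∀ m, m + 2 < S + T → concatSeq S T α ν ε φ' γ' (m + 1)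
      = concatSeq S T α ν ε φ γ m * dc m + concatSeq S T α ν ε φ γ (m + 2) * ic (m + 1)) ∧
    (∀ m, m + 2 = S + T → concatSeq S T α ν ε φ' γ' (m + 1)
      = concatSeq S T α ν ε φ γ m * dc m
        - (ν * α⁻¹) • (concatSeq S T α ν ε φ γ 0 * ic (m + 1))) := by
  have hT0 : 0 < T := by omega
  have hGε : ∀ m, m + 1 < S + T → overlapSum T ν φ' γ' (m + 1) * ε (m + 1)
      = overlapSum T ν φ γ m * ε m * dc m + overlapSum T ν φ γ (m + 2) * ε (m + 2) * ic (m + 1) := by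
    intro m hm
    rw [mul_assoc _ (ε m), ← hed m (by omega), mul_assoc _ (ε (m + 2)), ← hei (m + 1) hm]
    by_cases h0 : ε (m + 1) = 0
    · simp [h0]
    · rw [hG m h0]; noncomm_ring
  refine ⟨?_, fun m hm => ?_, fun m hm => ?_⟩
  -- Here the edge σ_C disappears: its term in `φ' 0` cancels against the `f_L` term of `γ' 0`
  -- multiplied by `ε 0`.
  · have e : overlapSum T ν φ γ 1 * ε 1 * ic 0 = γ 1 * it 0 * ε 0 := by
      rw [overlapSum_of_lt _ _ _ (by omega), mul_assoc, ← hei 0 (by omega), mul_assoc]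
    unfold concatSeq
    rw [if_pos (by omega), if_pos (by omega), overlapSum_of_lt _ _ _ hT0, h.φ'_zero, h.γ'_zero,
      add_mul, e, (hc1 0 (by omega)).2, ← hL]
    simp only [sub_mul, smul_mul_assoc, mul_assoc]
    abel
  · unfold concatSeq
    rw [hGε m (by omega), add_mul, add_mul]
    suffices H : (if m + 1 < S then φ' (m + 1) else -(α⁻¹ • γ' (m + 1 - S)))
        = (if m < S then φ m else -(α⁻¹ • γ (m - S))) * dc m
        + (if m + 2 < S then φ (m + 2) else -(α⁻¹ • γ (m + 2 - S))) * ic (m + 1) by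
      rw [H]; abel
    rcases lt_trichotomy (m + 1) S with h1 | h1 | h1
    · rw [if_pos h1, if_pos (by omega), h.φ'_succ, (hc1 m (by omega)).1]
      rcases Nat.eq_or_lt_of_le h1 with h2 | h2
      · have e : m + 1 = S - 1 := by omega
        rw [e, hc2.2, his, mul_zero, mul_zero]
      · rw [if_pos (by omega), (hc1 (m + 1) (by omega)).2]
    -- The edge `f_L` has coefficient `-α` in the cone; the factor `-α⁻¹` in `concatSeq` turns it
    -- into one.
    · have e : m = S - 1 := by omega
      have e2 : m + 1 = S + 0 := by omega
      rw [if_neg (by omega), if_pos (by omega), if_neg (by omega)]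
      rw [show m + 1 - S = 0 by omega, show m + 2 - S = 1 by omega, h.γ'_zero,
        e2, (hc3 0 (by omega)).2, e, hc2.1]
      simp only [smul_sub, smul_smul, inv_mul_cancel₀ hα, one_smul, neg_mul, smul_mul_assoc]
      abel
    · obtain ⟨n, rfl⟩ : ∃ n, m = S + n := ⟨m - S, by omega⟩
      rw [if_neg (by omega), if_neg (by omega), if_neg (by omega),
        show S + n + 1 - S = n + 1 by omega, show S + n + 2 - S = n + 2 by omega,
        show S + n - S = n by omega, h.γ'_succ n (by omega), (hc3 n (by omega)).1,
        show S + n + 1 = S + (n + 1) by omega, (hc3 (n + 1) (by omega)).2]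
      simp only [neg_mul, smul_mul_assoc, smul_add]
      abel
  -- Here the edge τ_C disappears: as `ε 0 * fR` is τ_C, the two closing terms of `γ'` combine into
  -- the coordinate at 0 times `fR`.
  · obtain ⟨n, rfl⟩ : ∃ n, m = S + n := ⟨m - S, by omega⟩
    unfold concatSeq
    rw [hGε _ (by omega), show S + n + 2 = S + T by omega, hεN, if_neg (by omega),
      if_neg (by omega), if_pos (by omega), show S + n + 1 - S = n + 1 by omega,
      show S + n - S = n by omega, h.γ'_last n (by omega), (hc3 n (by omega)).1,
      show S + n + 1 = S + T - 1 by omega, hc4, overlapSum_of_lt _ _ _ hT0, add_mul _ _ fR,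
      mul_assoc _ (ε 0), hR, show n + 1 = T - 1 by omega]
    simp only [neg_mul, smul_mul_assoc, smul_add, add_mul, mul_zero, zero_mul, smul_smul,
      mul_comm ν]
    abel

/-- Once the corrections are known to vanish from time `T` on, the coordinates of τ vanish one after
the other from the end, and then those of σ. -/
lemma concatSeq_injective {S T : ℕ} (hS : 0 < S) (hT : 0 < T) {α ν : k} (hα : α ≠ 0) (ε φ γ : ℕ → Λ)
    (hγ : ∀ m, γ (m + T) = ν • γ m) (hε : ∀ m < S, ε (m + T) ≠ 0 → ε m = 1)
    (h : ∀ m < S + T, concatSeq S T α ν ε φ γ m = 0) :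
    (∀ m < S, φ m = 0) ∧ ∀ m < T, γ m = 0 := by
  -- If ε is nonzero at `n + T`, then it is 1 at `n`, so the coordinate at `n` is the overlap sum
  -- plus `φ n`; the recursion multiplies just this vanishing quantity by ν.
  have hzero : ∀ m, T ≤ m → m < S + T → overlapSum T ν φ γ m * ε m = 0 := by
    intro m h1 h2
    obtain ⟨n, rfl⟩ : ∃ n, m = n + T := ⟨m - T, by omega⟩
    by_cases h0 : ε (n + T) = 0
    · rw [h0, mul_zero]
    · have := h n (by omega)
      unfold concatSeq at this
      rw [if_pos (by omega), hε n (by omega) h0, mul_one, add_comm] at this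
      rw [overlapSum_add hT φ hγ, this, smul_zero, zero_mul]
  -- Downward induction on `m`: the correction at `S + m` is either zero by `hzero` or involves only
  -- the later coordinate `γ (S + m)`.
  have hγ0 : ∀ n, ∀ m < T, T ≤ m + n → γ m = 0 := by
    intro n
    induction n with
    | zero => intro m h1 h2; omega
    | succ n ih =>
      intro m h1 h2
      have h3 : overlapSum T ν φ γ (S + m) * ε (S + m) = 0 := by
        rcases lt_or_ge (S + m) T with h4 | h4
        · rw [overlapSum_of_lt _ _ _ h4, ih _ h4 (by omega), zero_mul]
        · exact hzero _ h4 (by omega)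
      have := h (S + m) (by omega)
      unfold concatSeq at this
      rw [h3, if_neg (by omega), add_zero, neg_eq_zero, Nat.add_sub_cancel_left] at this
      exact (smul_eq_zero_iff_right (inv_ne_zero hα)).1 this
  have hγ1 : ∀ m < T, γ m = 0 := fun m hm => hγ0 T m hm (by omega)
  refine ⟨fun m hm => ?_, hγ1⟩
  have h3 : overlapSum T ν φ γ m * ε m = 0 := by
    rcases lt_or_ge m T with h4 | h4
    · rw [overlapSum_of_lt _ _ _ h4, hγ1 _ h4, zero_mul]
    · exact hzero _ h4 (by omega)
  have := h m (by omega)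
  unfold concatSeq at this
  rwa [h3, if_pos hm, add_zero] at this

end Sequences

/-! ### Unrolling a band -/

section Letters

variable {V : Type v} [Quiver.{w} V] {R : Arrow V → Arrow V → Prop}

lemma Letter.left_bar (l : Letter R) : l.bar.left = l.right := by cases l <;> rfl

lemma Letter.sign_bar (l : Letter R) : l.bar.sign = -l.sign := by cases l <;> rfl

lemma Letter.isDir_bar (l : Letter R) : l.bar.isDir = !l.isDir := by cases l <;> rfl

lemma Adjacent.right_eq_left {l m : Letter R} (h : Adjacent l m) : l.right = m.left := by
  cases l <;> cases m <;> exact h.1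

lemma Adjacent.bar {l m : Letter R} (h : Adjacent l m) : Adjacent m.bar l.bar := by
  cases l <;> cases m
  · exact ⟨h.1.symm, h.2⟩
  · exact ⟨h.1.symm, fun e => h.2 e.symm⟩
  · exact ⟨h.1.symm, fun e => h.2 e.symm⟩
  · exact ⟨h.1.symm, h.2⟩

end Letters

section Unrolling

variable (k : Type u) [Field k] {V : Type v} [Fintype V] [Quiver.{w} V]
  {R : Arrow V → Arrow V → Prop}

/-- The path of a direct letter, and zero for an inverse letter. -/
def Letter.dirElt : Letter R → Alg k R
  | .dir p => pathElt k R p.arrows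
  | .inv _ => 0

/-- The path of an inverse letter, and zero for a direct letter. -/
def Letter.invElt : Letter R → Alg k R
  | .dir _ => 0
  | .inv p => pathElt k R p.arrows

lemma dirElt_bar (l : Letter R) : l.bar.dirElt k = l.invElt k := by cases l <;> rfl

lemma invElt_bar (l : Letter R) : l.bar.invElt k = l.dirElt k := by cases l <;> rfl

variable {k}

/-- Splitting a letter into a direct and an inverse part, one of which is zero, replaces the case
distinction by a formula that treats both directions of walking alike. -/
lemma bandMatrix_eq (s : List (Letter R)) (c : kˣ) (r : Fin s.length) :
    bandMatrix s c r
      = ∑ i, (Matrix.single i (finRotate _ i) ((scal c r i : k) • (s.get i).dirElt k)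
        + Matrix.single (finRotate _ i) i ((scal c r i : k) • (s.get i).invElt k)) := by
  unfold bandMatrix
  refine Finset.sum_congr rfl fun i _ => ?_
  unfold tailPos headPos
  rcases s.get i with p | p <;>
    simp [Letter.isDir, Letter.path, Letter.dirElt, Letter.invElt]

lemma vecMul_single_apply {n n' : ℕ} {A : Type*} [Ring A] (f : Fin n → A) (i : Fin n)
    (j l : Fin n') (x : A) :
    Matrix.vecMul f (Matrix.single i j x) l = if j = l then f i * x else 0 := by
  simp only [Matrix.vecMul, dotProduct, Matrix.single_apply]
  rw [Finset.sum_eq_single i]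
  · by_cases h : j = l <;> simp [h]
  · intro b _ hb
    rw [if_neg (fun h => hb h.1.symm), mul_zero]
  · simp

lemma vecMul_bandMatrix_apply (s : List (Letter R)) (c : kˣ) (r : Fin s.length)
    (f : Fin s.length → Alg k R) (j : Fin s.length) :
    Matrix.vecMul f (bandMatrix s c r) j
      = f ((finRotate _).symm j) * ((scal c r ((finRotate _).symm j) : k) •
          (s.get ((finRotate _).symm j)).dirElt k)
        + f (finRotate _ j) * ((scal c r j : k) • (s.get j).invElt k) := by
  rw [bandMatrix_eq, Matrix.vecMul_sum, Finset.sum_apply]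
  simp only [Matrix.vecMul_add, Pi.add_apply, vecMul_single_apply]
  rw [Finset.sum_add_distrib]
  congr 1
  · rw [Finset.sum_eq_single ((finRotate _).symm j)]
    · rw [if_pos (Equiv.apply_symm_apply _ _)]
    · intro i _ hi
      rw [if_neg]
      rintro rfl
      exact hi (Equiv.symm_apply_apply _ _).symm
    · simp
  · rw [Finset.sum_ite_eq' Finset.univ j, if_pos (Finset.mem_univ _)]

lemma single_vecMul_bandMatrix (s : List (Letter R)) (c : kˣ) (r : Fin s.length)
    (j : Fin s.length) (x : Alg k R) :
    Matrix.vecMul (Pi.single j x) (bandMatrix s c r)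
      = Pi.single (finRotate _ j) (x * ((scal c r j : k) • (s.get j).dirElt k))
        + Pi.single ((finRotate _).symm j) (x * ((scal c r ((finRotate _).symm j) : k) •
          (s.get ((finRotate _).symm j)).invElt k)) := by
  ext l
  rw [vecMul_bandMatrix_apply]
  simp only [Pi.add_apply, Pi.single_apply, ite_mul, zero_mul]
  congr 1
  · by_cases h : l = finRotate _ j
    · rw [if_pos h, h, Equiv.symm_apply_apply, if_pos rfl]
    · rw [if_neg h, if_neg]
      rintro rfl
      exact h (Equiv.apply_symm_apply _ _).symm
  · by_cases h : l = (finRotate _).symm j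
    · rw [if_pos h, h, Equiv.apply_symm_apply, if_pos rfl]
    · rw [if_neg h, if_neg]
      rintro rfl
      exact h (Equiv.symm_apply_apply _ _).symm

/-- The sequences of positions, letters and scalars met when walking around a band for ever, in
one of the two directions. -/
structure Unrolling (s : List (Letter R)) (c : kˣ) (r : Fin s.length) (pos : ℕ → Fin s.length)
    (L : ℕ → Letter R) (x : ℕ → kˣ) : Prop where
  pos_add : ∀ m, pos (m + s.length) = pos m
  L_add : ∀ m, L (m + s.length) = L m
  x_add : ∀ m, x (m + s.length) = x m
  bij : ∀ i, ∃! m, m < s.length ∧ pos m = i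
  adj : ∀ m, Adjacent (L m) (L (m + 1))
  left : ∀ m, (s.get (pos m)).left = (L m).left
  deg : ∀ a m, deg s a (pos (m + 1)) = deg s a (pos m) + (L m).sign
  row : ∀ f m, Matrix.vecMul f (bandMatrix s c r) (pos (m + 1))
    = f (pos m) * ((x m : k) • (L m).dirElt k)
      + f (pos (m + 2)) * ((x (m + 1) : k) • (L (m + 1)).invElt k)
  single_row : ∀ z m, Matrix.vecMul (Pi.single (pos (m + 1)) z) (bandMatrix s c r)
    = Pi.single (pos (m + 2)) (z * ((x (m + 1) : k) • (L (m + 1)).dirElt k))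
      + Pi.single (pos m) (z * ((x m : k) • (L m).invElt k))

lemma val_finRotate_pow {n : ℕ} (p : Fin n) (m : ℕ) :
    (((finRotate n) ^ m) p : ℕ) = (p + m) % n := by
  induction m with
  | zero => simp [Nat.mod_eq_of_lt p.2]
  | succ m ih =>
    rw [pow_succ', Equiv.Perm.mul_apply, finRotate_val, ih, ← add_assoc]
    have hn : 0 < n := p.pos
    rw [Nat.add_mod (p + m) 1 n]
    have h1 := Nat.mod_lt (p + m : ℕ) hn
    split_ifs with h
    · rcases Nat.eq_or_lt_of_le (show 1 ≤ n by omega) with h2 | h2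
      · subst h2; simp [Nat.mod_one]
      · rw [Nat.mod_eq_of_lt h2, h, Nat.mod_self]
    · rw [Nat.mod_eq_of_lt (show 1 < n by omega), Nat.mod_eq_of_lt (show (p + m) % n + 1 < n by omega)]

lemma finRotate_pow_length (n : ℕ) : (finRotate n) ^ n = 1 := by
  ext p
  rw [val_finRotate_pow, Nat.add_mod_right, Nat.mod_eq_of_lt p.2, Equiv.Perm.one_apply]

lemma finRotate_pow_bij {n : ℕ} (p i : Fin n) : ∃! m, m < n ∧ ((finRotate n) ^ m) p = i := by
  have hn : 0 < n := p.pos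
  have key : ∀ m, m < n → ((((finRotate n) ^ m) p : ℕ)
      = if (p : ℕ) + m < n then (p : ℕ) + m else p + m - n) := by
    intro m hm
    rw [val_finRotate_pow]
    split_ifs with h
    · exact Nat.mod_eq_of_lt h
    · rw [Nat.mod_eq_sub_mod (by omega), Nat.mod_eq_of_lt (by omega)]
  refine ⟨if (p : ℕ) ≤ i then i - p else i + n - p, ⟨?_, ?_⟩, ?_⟩
  · split_ifs <;> omega
  · rw [Fin.ext_iff, key _ (by split_ifs <;> omega)]
    split_ifs <;> omega
  · rintro m ⟨hm, h⟩
    rw [Fin.ext_iff, key _ hm] at h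
    split_ifs at h ⊢ <;> omega

lemma finRotate_inv_pow_bij {n : ℕ} (p i : Fin n) :
    ∃! m, m < n ∧ ((finRotate n)⁻¹ ^ m) p = i := by
  obtain ⟨m, ⟨hm, h⟩, hu⟩ := finRotate_pow_bij i p
  refine ⟨m, ⟨hm, ?_⟩, ?_⟩
  · rw [inv_pow, Equiv.Perm.inv_eq_iff_eq, h]
  · rintro m' ⟨hm', h'⟩
    refine hu m' ⟨hm', ?_⟩
    rw [inv_pow, Equiv.Perm.inv_eq_iff_eq] at h'
    exact h'.symm

lemma unrolling_forward {s : List (Letter R)} (hs : IsBandWord s) (c : kˣ) (r p : Fin s.length) :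
    Unrolling s c r (fun m => ((finRotate _) ^ m) p) (fun m => s.get (((finRotate _) ^ m) p))
      (fun m => scal c r (((finRotate _) ^ m) p)) := by
  have hsucc : ∀ m, ((finRotate s.length) ^ (m + 1)) p
      = finRotate _ (((finRotate s.length) ^ m) p) := fun m => by
    rw [pow_succ', Equiv.Perm.mul_apply]
  have hadd : ∀ m, ((finRotate s.length) ^ (m + s.length)) p = ((finRotate s.length) ^ m) p :=
    fun m => by rw [pow_add, finRotate_pow_length, mul_one]
  refine ⟨hadd, fun m => by simp only [hadd], fun m => by simp only [hadd],
    fun i => finRotate_pow_bij p i, fun m => ?_, fun m => rfl, fun a m => ?_, fun f m => ?_,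
    fun z m => ?_⟩
  · rw [hsucc]
    exact hs.adj _
  · rw [hsucc, deg_rotate hs]
  · rw [vecMul_bandMatrix_apply, hsucc (m + 1), hsucc m, Equiv.symm_apply_apply]
  · rw [single_vecMul_bandMatrix, hsucc (m + 1), hsucc m, Equiv.symm_apply_apply]

/-- A letter is indexed by its left endpoint. On a backward walk, the letter between the steps `m`
and `m + 1` thus belongs to the position at step `m + 1`, whence the shift in letters and scalars
but not in positions. -/
lemma unrolling_backward {s : List (Letter R)} (hs : IsBandWord s) (c : kˣ) (r p : Fin s.length) :
    Unrolling s c r (fun m => ((finRotate _)⁻¹ ^ m) p)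
      (fun m => (s.get (((finRotate _)⁻¹ ^ (m + 1)) p)).bar)
      (fun m => scal c r (((finRotate _)⁻¹ ^ (m + 1)) p)) := by
  have hsucc : ∀ m, ((finRotate s.length)⁻¹ ^ (m + 1)) p
      = (finRotate _).symm (((finRotate s.length)⁻¹ ^ m) p) := fun m => by
    rw [pow_succ', Equiv.Perm.mul_apply]; rfl
  have hsucc' : ∀ m, ((finRotate s.length)⁻¹ ^ m) p
      = finRotate _ (((finRotate s.length)⁻¹ ^ (m + 1)) p) := fun m => by
    rw [hsucc, Equiv.apply_symm_apply]
  have hadd : ∀ m, ((finRotate s.length)⁻¹ ^ (m + s.length)) p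
      = ((finRotate s.length)⁻¹ ^ m) p :=
    fun m => by rw [pow_add, inv_pow _ s.length, finRotate_pow_length, inv_one, mul_one]
  refine ⟨hadd, fun m => ?_, fun m => ?_,
    fun i => finRotate_inv_pow_bij p i, fun m => ?_, fun m => ?_, fun a m => ?_, fun f m => ?_,
    fun z m => ?_⟩
  · rw [add_right_comm, hadd]
  · rw [add_right_comm, hadd]
  · refine Adjacent.bar ?_
    rw [hsucc' (m + 1)]
    exact hs.adj _
  · rw [Letter.left_bar, hsucc' m]
    exact (hs.adj _).right_eq_left.symm
  · rw [hsucc' m, deg_rotate hs, Letter.sign_bar]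
    ring
  · rw [vecMul_bandMatrix_apply, hsucc (m + 1), dirElt_bar, invElt_bar, ← hsucc' m, add_comm]
  · rw [single_vecMul_bandMatrix, hsucc (m + 1), dirElt_bar, invElt_bar, ← hsucc' m, add_comm]

end Unrolling

/-! ### Concrete models of complexes of modules -/

section Models

variable {A : Type*} [Ring A] {E E' : Type*} [AddCommGroup E] [Module A E] [AddCommGroup E']
  [Module A E']

/-- A model of a complex of modules: its terms are submodules of one module, and its differential
is induced by an endomorphism of this module. -/
structure Model (C : CochainComplex (ModuleCat.{w} A) ℤ) (P : ℤ → Submodule A E)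
    (D : E →ₗ[A] E) where
  equiv : ∀ n, C.X n ≃ₗ[A] P n
  comm : ∀ n x, (equiv (n + 1) (C.d n (n + 1) x) : E) = D (equiv n x)

variable {C C' : CochainComplex (ModuleCat.{w} A) ℤ} {P : ℤ → Submodule A E} {D : E →ₗ[A] E}
  {P' : ℤ → Submodule A E'} {D' : E' →ₗ[A] E'}

/-- Compatibility with the differentials is required only as one identity of linear maps on the
ambient modules, so no degrees enter it. -/
lemma Model.nonempty_iso (M : Model C P D) (M' : Model C' P' D') (u : E →ₗ[A] E')
    (hu : ∀ n, ∀ x ∈ P n, u x ∈ P' n) (inj : ∀ n, ∀ x ∈ P n, u x = 0 → x = 0)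
    (surj : ∀ n, ∀ y ∈ P' n, ∃ x ∈ P n, u x = y) (comm : ∀ x, u (D x) = D' (u x)) :
    Nonempty (C ≅ C') := by
  let g : ∀ n, P n →ₗ[A] P' n := fun n => u.restrict (hu n)
  have hg : ∀ n, Function.Bijective (g n) := fun n => by
    refine ⟨?_, fun y => ?_⟩
    · rw [← LinearMap.ker_eq_bot, LinearMap.ker_eq_bot']
      intro x hx
      exact Subtype.ext (inj n x x.2 (congrArg Subtype.val hx))
    · obtain ⟨x, hx, h⟩ := surj n y y.2
      exact ⟨⟨x, hx⟩, Subtype.ext h⟩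
  let e : ∀ n, C.X n ≃ₗ[A] C'.X n := fun n =>
    (M.equiv n).trans ((LinearEquiv.ofBijective (g n) (hg n)).trans (M'.equiv n).symm)
  refine ⟨HomologicalComplex.Hom.isoOfComponents (fun n => (e n).toModuleIso) ?_⟩
  intro i j hij
  obtain rfl : i + 1 = j := hij
  ext x
  apply (M'.equiv (i + 1)).injective
  apply Subtype.ext
  have h1 : ((M'.equiv (i + 1)) (C'.d i (i + 1) (e i x)) : E') = u (D (M.equiv i x)) := by
    rw [M'.comm, comm]
    congr 1
    simp [e, g]
  have h2 : ((M'.equiv (i + 1)) (e (i + 1) (C.d i (i + 1) x)) : E') = u (D (M.equiv i x)) := by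
    rw [← M.comm]
    simp [e, g]
  exact h1.trans h2.symm

open CochainComplex CochainComplex.HomComplex

/-- The model of the mapping cone. -/
def Model.cone (M : Model C P D) (M' : Model C' P' D') (φ : C ⟶ C') (F : E →ₗ[A] E')
    (hF : ∀ n x, (M'.equiv n (φ.f n x) : E') = F (M.equiv n x)) :
    Model (mappingCone φ) (fun n => (P (n + 1)).prod (P' n))
      (LinearMap.prod (-D ∘ₗ LinearMap.fst A E E')
        (F ∘ₗ LinearMap.fst A E E' + D' ∘ₗ LinearMap.snd A E E')) where
  equiv n :=
    { toFun x := ⟨(M.equiv (n + 1) ((mappingCone.fst φ).1.v n (n + 1) rfl x),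
        M'.equiv n ((mappingCone.snd φ).v n n (add_zero n) x)), ⟨Subtype.property _, Subtype.property _⟩⟩
      invFun z := (mappingCone.inl φ).v (n + 1) n (by omega) ((M.equiv (n + 1)).symm ⟨z.1.1, (Submodule.mem_prod.1 z.2).1⟩)
        + (mappingCone.inr φ).f n ((M'.equiv n).symm ⟨z.1.2, (Submodule.mem_prod.1 z.2).2⟩)
      map_add' x y := by
        apply Subtype.ext
        simp
      map_smul' a x := by
        apply Subtype.ext
        simp
      left_inv x := by
        have := congrArg (fun f => f.hom x) (mappingCone.id_X φ n (n + 1) rfl)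
        simpa using this
      right_inv z := by
        apply Subtype.ext
        have h1 := fun t => congrArg (fun f => f.hom t)
          (mappingCone.inl_v_fst_v φ (n + 1) n rfl)
        have h2 := fun t => congrArg (fun f => f.hom t)
          (mappingCone.inr_f_fst_v φ n (n + 1) rfl)
        have h3 := fun t => congrArg (fun f => f.hom t)
          (mappingCone.inl_v_snd_v φ (n + 1) n (by omega))
        have h4 := fun t => congrArg (fun f => f.hom t)
          (mappingCone.inr_f_snd_v φ n)
        simp only [ModuleCat.hom_comp, LinearMap.comp_apply, ModuleCat.hom_id,
          ModuleCat.hom_zero, LinearMap.id_apply, LinearMap.zero_apply] at h1 h2 h3 h4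
        apply Prod.ext
        · simp only [map_add]
          rw [h1, h2, map_zero, add_zero, LinearEquiv.apply_symm_apply]
        · simp only [map_add]
          rw [h3, h4, map_zero, zero_add, LinearEquiv.apply_symm_apply] }
  comm n x := by
    have h1 := congrArg (fun f => f.hom x)
      (mappingCone.d_fst_v φ n (n + 1) (n + 1 + 1) rfl rfl)
    have h2 := congrArg (fun f => f.hom x) (mappingCone.d_snd_v φ n (n + 1) rfl)
    simp only [ModuleCat.hom_comp, LinearMap.comp_apply, ModuleCat.hom_neg, ModuleCat.hom_add,
      LinearMap.neg_apply, LinearMap.add_apply] at h1 h2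
    apply Prod.ext
    · have := M.comm (n + 1) ((mappingCone.fst φ).1.v n (n + 1) rfl x)
      simp only [LinearEquiv.coe_mk, LinearMap.coe_mk, AddHom.coe_mk]
      rw [h1, map_neg]
      exact congrArg Neg.neg this
    · have h3 := hF (n + 1) ((mappingCone.fst φ).1.v n (n + 1) rfl x)
      have h4 := M'.comm n ((mappingCone.snd φ).v n n (add_zero n) x)
      simp only [LinearEquiv.coe_mk, LinearMap.coe_mk, AddHom.coe_mk]
      rw [h2, map_add]
      exact congrArg₂ (· + ·) h3 h4

lemma Model.nonempty_homotopy (M : Model C P D) (M' : Model C' P' D') (φ : C ⟶ C')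
    (F H : E →ₗ[A] E') (hF : ∀ n x, (M'.equiv n (φ.f n x) : E') = F (M.equiv n x))
    (hH : ∀ n, ∀ x ∈ P (n + 1), H x ∈ P' n) (h : ∀ x, F x = D' (H x) + H (D x)) :
    Nonempty (Homotopy φ 0) := by
  have hH' : ∀ p q : ℤ, p + (-1) = q → ∀ x ∈ P p, H x ∈ P' q := by
    intro p q hpq x hx
    exact hH q x (by rwa [show q + 1 = p by omega])
  let z : Cochain C C' (-1) := Cochain.mk fun p q hpq =>
    ModuleCat.ofHom ((M'.equiv q).symm.toLinearMap ∘ₗ H.restrict (hH' p q hpq)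
      ∘ₗ (M.equiv p).toLinearMap)
  refine ⟨(Cochain.equivHomotopy φ 0).symm ⟨z, ?_⟩⟩
  ext p x
  apply (M'.equiv p).injective
  apply Subtype.ext
  obtain ⟨q, rfl⟩ : ∃ q, p = q + 1 := ⟨p - 1, by omega⟩
  rw [Cochain.ofHom_zero, add_zero, δ_v (-1) 0 (by simp) z (q + 1) (q + 1) (by simp) q (q + 1 + 1)
    (by omega) (by omega), Cochain.ofHom_v]
  have h1 := M'.comm q ((M'.equiv q).symm ⟨H (M.equiv (q + 1) x), hH q _ (Subtype.property _)⟩)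
  have h2 := M.comm (q + 1) x
  rw [LinearEquiv.apply_symm_apply] at h1
  rw [hF, h, ← h1, ← h2]
  simp only [z, Cochain.mk_v, Int.negOnePow_zero, one_smul, ModuleCat.hom_add, LinearMap.add_apply,
    ModuleCat.hom_comp, LinearMap.comp_apply, ModuleCat.hom_ofHom, map_add, Submodule.coe_add]
  congr 1
  rw [LinearEquiv.coe_coe, LinearEquiv.apply_symm_apply]
  rfl

end Models

section Band

variable {k : Type u} [Field k] {V : Type v} [Fintype V] [Quiver.{w} V]
  {R : Arrow V → Arrow V → Prop}

/-- The model of a band complex. -/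
def bandModel {s : List (Letter R)} (hs : IsBandWord s) (c : kˣ) (r : Fin s.length) (a : ℤ) :
    Model (bandComplex hs c r a) (piece k s a) (bandMatrix s c r).vecMulLinear where
  equiv n := LinearEquiv.refl _ (piece k s a n)
  comm n x := by
    have : (bandComplex hs c r a).d n (n + 1) = ModuleCat.ofHom (bandD hs c r a n) :=
      CochainComplex.of_d (fun n => ModuleCat.of (Alg k R) (piece k s a n))
        (fun n => ModuleCat.ofHom (bandD hs c r a n)) n
    rw [this]
    rfl

end Band

/-! ### Normalised coordinates -/

/-- An injective endomorphism of an artinian module is onto, so `v ∘ₗ u` is onto on `P`, and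
injectivity of `v` moves this to `u`. This avoids an explicit inverse of the change of basis. -/
lemma exists_mem_of_injective {A E E' : Type*} [Ring A] [AddCommGroup E] [Module A E]
    [AddCommGroup E'] [Module A E'] [IsArtinian A E] {P : Submodule A E} {P' : Submodule A E'}
    (u : E →ₗ[A] E') (v : E' →ₗ[A] E) (hu : ∀ x ∈ P, u x ∈ P') (hv : ∀ y ∈ P', v y ∈ P)
    (inju : ∀ x ∈ P, u x = 0 → x = 0) (injv : ∀ y ∈ P', v y = 0 → y = 0) (y : E') (hy : y ∈ P') :
    ∃ x ∈ P, u x = y := by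
  let g : P →ₗ[A] P := (v ∘ₗ u).restrict fun x hx => hv _ (hu x hx)
  have hg : Function.Injective g := by
    rw [← LinearMap.ker_eq_bot, LinearMap.ker_eq_bot']
    intro x hx
    exact Subtype.ext (inju x x.2 (injv _ (hu x x.2) (congrArg Subtype.val hx)))
  obtain ⟨x, hx⟩ := IsArtinian.surjective_of_injective_endomorphism g hg ⟨v y, hv y hy⟩
  refine ⟨x, x.2, ?_⟩
  have h1 : v (u x) = v y := congrArg Subtype.val hx
  rw [← sub_eq_zero]
  refine injv _ (P'.sub_mem (hu x x.2) hy) ?_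
  rw [map_sub, h1, sub_self]

section Normal

variable {k : Type u} [Field k] {V : Type v} [Fintype V] [Quiver.{w} V]
  {R : Arrow V → Arrow V → Prop}

/-- The rescaling of the positions of an unrolled band that makes all scalars equal to one, where
the differential carries the additional sign `e`. -/
def gauge (e a : kˣ) (L : ℕ → Letter R) (x : ℕ → kˣ) : ℕ → kˣ
  | 0 => a
  | m + 1 => gauge e a L x m * if (L m).isDir then e * x m else (e * x m)⁻¹

/-- The rescaled coordinates of a family on an unrolled band. -/
def normSeq {n : ℕ} (A : ℕ → kˣ) (pos : ℕ → Fin n) (f : Fin n → Alg k R) (m : ℕ) : Alg k R :=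
  ((A m : k)⁻¹) • f (pos m)

variable {s : List (Letter R)} {c : kˣ} {r : Fin s.length} {pos : ℕ → Fin s.length}
  {L : ℕ → Letter R} {x : ℕ → kˣ}

/-- Letters and scalars are periodic, so a full turn changes every gauge factor by the same ratio.
-/
lemma gauge_add (U : Unrolling s c r pos L x) (e a : kˣ) (m : ℕ) :
    gauge e a L x (m + s.length) * a = gauge e a L x m * gauge e a L x s.length := by
  induction m with
  | zero => rw [zero_add, mul_comm]; rfl
  | succ m ih =>
    rw [add_right_comm, gauge, gauge, U.L_add, U.x_add, mul_right_comm, ih, mul_right_comm]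

lemma normSeq_add (U : Unrolling s c r pos L x) (e a : kˣ) (f : Fin s.length → Alg k R) (m : ℕ) :
    normSeq (gauge e a L x) pos f (m + s.length)
      = ((a : k) * (gauge e a L x s.length : k)⁻¹) • normSeq (gauge e a L x) pos f m := by
  unfold normSeq
  rw [U.pos_add, smul_smul]
  congr 1
  have h := congrArg Units.val (gauge_add U e a m)
  push_cast at h
  have h1 := (gauge e a L x m).ne_zero
  have h2 := (gauge e a L x (m + s.length)).ne_zero
  have h3 := (gauge e a L x s.length).ne_zero
  field_simp
  rw [h, mul_comm]

lemma normSeq_row (U : Unrolling s c r pos L x) (e a : kˣ) (f : Fin s.length → Alg k R) (m : ℕ) :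
    normSeq (gauge e a L x) pos ((e : k) • Matrix.vecMul f (bandMatrix s c r)) (m + 1)
      = normSeq (gauge e a L x) pos f m * (L m).dirElt k
        + normSeq (gauge e a L x) pos f (m + 2) * (L (m + 1)).invElt k := by
  have h0 := (gauge e a L x m).ne_zero
  have h1 := (gauge e a L x (m + 1)).ne_zero
  have h2 := (gauge e a L x (m + 2)).ne_zero
  have he := e.ne_zero
  have hx := (x m).ne_zero
  have hx' := (x (m + 1)).ne_zero
  unfold normSeq
  rw [Pi.smul_apply, U.row, smul_add, smul_add]
  simp only [mul_smul_comm, smul_mul_assoc, smul_smul]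
  congr 1
  · rcases hl : L m with p | p
    · congr 1
      have : gauge e a L x (m + 1) = gauge e a L x m * (e * x m) := by
        rw [gauge, hl]; rfl
      rw [this]
      push_cast
      field_simp
    · simp [Letter.dirElt]
  · rcases hl : L (m + 1) with p | p
    · simp [Letter.invElt]
    · congr 1
      have : gauge e a L x (m + 2) = gauge e a L x (m + 1) * (e * x (m + 1))⁻¹ := by
        rw [gauge, hl]; rfl
      rw [this]
      push_cast
      field_simp

/-- This is the row at time `s.length` carried back by one turn. The turn factor is the only scalar
that the gauge cannot remove, and it sits on the direct part of the last letter. -/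
lemma normSeq_row_zero (U : Unrolling s c r pos L x) (e a : kˣ) (f : Fin s.length → Alg k R) :
    normSeq (gauge e a L x) pos ((e : k) • Matrix.vecMul f (bandMatrix s c r)) 0
      = ((a : k)⁻¹ * (gauge e a L x s.length : k)) •
          (normSeq (gauge e a L x) pos f (s.length - 1) * (L (s.length - 1)).dirElt k)
        + normSeq (gauge e a L x) pos f 1 * (L 0).invElt k := by
  have hn : 0 < s.length := (pos 0).pos
  have ha := a.ne_zero
  have h3 := (gauge e a L x s.length).ne_zero
  have h1 := normSeq_row U e a f (s.length - 1)
  have e1 : s.length - 1 + 1 = 0 + s.length := by omega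
  have e2 : s.length - 1 + 2 = 1 + s.length := by omega
  rw [e1, e2, normSeq_add U, normSeq_add U, U.L_add, smul_mul_assoc] at h1
  have h4 : ∀ z w : Alg k R, ((a : k) * (gauge e a L x s.length : k)⁻¹) • z = w →
      z = ((a : k)⁻¹ * (gauge e a L x s.length : k)) • w := by
    rintro z w rfl
    rw [smul_smul]
    have : (a : k)⁻¹ * (gauge e a L x s.length : k) * ((a : k) * (gauge e a L x s.length : k)⁻¹) = 1 := by
      field_simp
    rw [this, one_smul]
  rw [h4 _ _ h1, smul_add, smul_smul]
  have : (a : k)⁻¹ * (gauge e a L x s.length : k) * ((a : k) * (gauge e a L x s.length : k)⁻¹) = 1 := by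
    field_simp
  rw [this, one_smul]

lemma eq_of_normSeq_eq (U : Unrolling s c r pos L x) (A : ℕ → kˣ) {f g : Fin s.length → Alg k R}
    (h : ∀ m < s.length, normSeq A pos f m = normSeq A pos g m) : f = g := by
  funext i
  obtain ⟨m, ⟨hm, rfl⟩, -⟩ := U.bij i
  have := h m hm
  unfold normSeq at this
  exact (smul_right_inj (inv_ne_zero (A m).ne_zero)).1 this

/-- The first time at which a position is met. -/
def Unrolling.idx (U : Unrolling s c r pos L x) (i : Fin s.length) : ℕ := (U.bij i).choose

lemma Unrolling.idx_lt (U : Unrolling s c r pos L x) (i : Fin s.length) : U.idx i < s.length :=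
  (U.bij i).choose_spec.1.1

lemma Unrolling.pos_idx (U : Unrolling s c r pos L x) (i : Fin s.length) : pos (U.idx i) = i :=
  (U.bij i).choose_spec.1.2

lemma Unrolling.idx_pos (U : Unrolling s c r pos L x) {m : ℕ} (hm : m < s.length) :
    U.idx (pos m) = m :=
  ((U.bij (pos m)).choose_spec.2 m ⟨hm, rfl⟩).symm

end Normal

/-! ### The differential of the cone in normalised coordinates -/

section ConcatMap

variable {k : Type u} [Field k] {V : Type v} [Fintype V] [Quiver.{w} V]
  {R : Arrow V → Arrow V → Prop}

/-- The scaling factor of the coordinates of the second band after one turn. -/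
def turn (y : kˣ) (xs : ℕ → kˣ) (Lt : ℕ → Letter R) (xt : ℕ → kˣ) (S T : ℕ) : k :=
  (y * (xs (S - 1))⁻¹ : kˣ) * (gauge 1 (y * (xs (S - 1))⁻¹) Lt xt T : k)⁻¹

/-- The matrix of a double map. -/
def doubleMatrix {S T : ℕ} (i i' : Fin S) (j j' : Fin T) (y z : kˣ) (fL fR : NPath R) :
    Matrix (Fin S) (Fin T) (Alg k R) :=
  Matrix.single i j ((y : k) • pathElt k R fL.arrows) +
    Matrix.single i' j' ((z : k) • pathElt k R fR.arrows)

/-- Two unrolled bands that are joined by the two components of a double map. -/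
structure DoubleData (s t : List (Letter R)) (lam mu : kˣ) (r : Fin s.length) (q : Fin t.length)
    (ps : ℕ → Fin s.length) (Ls : ℕ → Letter R) (xs : ℕ → kˣ)
    (pt : ℕ → Fin t.length) (Lt : ℕ → Letter R) (xt : ℕ → kˣ)
    (σC τC fL fR : NPath R) (y z : kˣ) : Prop where
  us : Unrolling s lam r ps Ls xs
  ut : Unrolling t mu q pt Lt xt
  hS : 2 ≤ s.length
  hT : 2 ≤ t.length
  Ls_last : Ls (s.length - 1) = .dir σC
  Lt_last : Lt (t.length - 1) = .inv τC
  hyz : y * xt (t.length - 1) = xs (s.length - 1) * z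

section

variable {s t : List (Letter R)} {lam mu : kˣ} {r : Fin s.length} {q : Fin t.length}
    {ps : ℕ → Fin s.length} {Ls : ℕ → Letter R} {xs : ℕ → kˣ}
    {pt : ℕ → Fin t.length} {Lt : ℕ → Letter R} {xt : ℕ → kˣ}
    {σC τC fL fR : NPath R} {y z : kˣ}

/-- The gauge on τ starts with `y * (xs (s.length - 1))⁻¹` so that `f_L` has coefficient `-α`.
Commutativity of the square, `hyz`, then gives `f_R` the coefficient `ν`. The sign `-1` in the gauge
on σ absorbs the minus of the cone differential. -/
lemma DoubleData.coneSeq (d : DoubleData s t lam mu r q ps Ls xs pt Lt xt σC τC fL fR y z)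
    (f : Fin s.length → Alg k R) (g : Fin t.length → Alg k R) :
    ConeSeq s.length t.length (gauge (-1) 1 Ls xs s.length : k)
      (turn y xs Lt xt s.length t.length)
      (fun m => (Ls m).dirElt k) (fun m => (Ls m).invElt k)
      (fun m => (Lt m).dirElt k) (fun m => (Lt m).invElt k)
      (pathElt k R fL.arrows) (pathElt k R fR.arrows)
      (normSeq (gauge (-1) 1 Ls xs) ps f)
      (normSeq (gauge 1 (y * (xs (s.length - 1))⁻¹) Lt xt) pt g)
      (normSeq (gauge (-1) 1 Ls xs) ps (-Matrix.vecMul f (bandMatrix s lam r)))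
      (normSeq (gauge 1 (y * (xs (s.length - 1))⁻¹) Lt xt) pt
        (Matrix.vecMul f (doubleMatrix (ps (s.length - 1)) (ps 0) (pt 0) (pt (t.length - 1)) y z
          fL fR) + Matrix.vecMul g (bandMatrix t mu q))) := by
  have hS := d.hS
  have hT := d.hT
  have hneg : -Matrix.vecMul f (bandMatrix s lam r)
      = (((-1 : kˣ) : k)) • Matrix.vecMul f (bandMatrix s lam r) := by
    rw [Units.val_neg, Units.val_one]
    exact (neg_one_smul k _).symm
  have hone : Matrix.vecMul g (bandMatrix t mu q)
      = (((1 : kˣ) : k)) • Matrix.vecMul g (bandMatrix t mu q) := by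
    rw [Units.val_one, one_smul]
  have hadd : ∀ (A : ℕ → kˣ) (g g' : Fin t.length → Alg k R) (m : ℕ),
      normSeq A pt (g + g') m = normSeq A pt g m + normSeq A pt g' m := fun A g g' m => by
    simp only [normSeq, Pi.add_apply, smul_add]
  have hinj : ∀ m m', m < t.length → m' < t.length → pt m = pt m' → m = m' :=
    fun m m' h1 h2 h => by rw [← d.ut.idx_pos h1, h, d.ut.idx_pos h2]
  have hF : ∀ m < t.length, Matrix.vecMul f (doubleMatrix (ps (s.length - 1)) (ps 0) (pt 0)
      (pt (t.length - 1)) y z fL fR) (pt m)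
      = (if m = 0 then f (ps (s.length - 1)) * ((y : k) • pathElt k R fL.arrows) else 0)
        + (if m = t.length - 1 then f (ps 0) * ((z : k) • pathElt k R fR.arrows) else 0) := by
    intro m hm
    unfold doubleMatrix
    rw [Matrix.vecMul_add, Pi.add_apply, vecMul_single_apply, vecMul_single_apply]
    congr 1
    · refine if_congr ⟨fun h => (hinj _ _ (by omega) hm h).symm, fun h => by rw [h]⟩ rfl rfl
    · refine if_congr ⟨fun h => (hinj _ _ (by omega) hm h).symm, fun h => by rw [h]⟩ rfl rfl
  have hxs := (xs (s.length - 1)).ne_zero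
  have hxt := (xt (t.length - 1)).ne_zero
  have hy := y.ne_zero
  have hz := z.ne_zero
  have hyz := congrArg Units.val d.hyz
  push_cast at hyz
  have hAs := (gauge (-1) 1 Ls xs (s.length - 1)).ne_zero
  have hAt := (gauge 1 (y * (xs (s.length - 1))⁻¹) Lt xt (t.length - 1)).ne_zero
  have hs1 : gauge (-1) 1 Ls xs s.length
      = gauge (-1) 1 Ls xs (s.length - 1) * (-1 * xs (s.length - 1)) := by
    conv_lhs => rw [show s.length = s.length - 1 + 1 by omega, gauge, d.Ls_last]
    rfl
  have ht1 : gauge 1 (y * (xs (s.length - 1))⁻¹) Lt xt t.length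
      = gauge 1 (y * (xs (s.length - 1))⁻¹) Lt xt (t.length - 1) * (1 * xt (t.length - 1))⁻¹ := by
    conv_lhs => rw [show t.length = t.length - 1 + 1 by omega, gauge, d.Lt_last]
    rfl
  refine ⟨normSeq_add d.ut _ _ g, normSeq_add d.ut _ _ _, ?_, fun m => ?_, ?_, fun m hm => ?_,
    fun m hm => ?_⟩
  · rw [hneg, normSeq_row_zero d.us, Units.val_one, inv_one, one_mul]
  · rw [hneg, normSeq_row d.us]
  · rw [hadd, hone, normSeq_row_zero d.ut, d.Lt_last]
    simp only [Letter.dirElt, mul_zero, smul_zero, zero_add]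
    rw [add_comm]
    unfold normSeq
    rw [hF 0 (by omega), if_pos rfl, if_neg (by omega), add_zero, sub_eq_add_neg]
    congr 1
    rw [hs1, gauge]
    push_cast
    simp only [mul_smul_comm, smul_mul_assoc, smul_smul, ← neg_smul]
    congr 1
    field_simp
  · rw [hadd, hone, normSeq_row d.ut]
    unfold normSeq
    rw [hF _ (by omega), if_neg (by omega), if_neg (by omega), add_zero, smul_zero, zero_add]
  · have e1 : m + 1 = t.length - 1 := by omega
    have e2 : m + 2 = 0 + t.length := by omega
    rw [hadd, hone, normSeq_row d.ut, e2, normSeq_add d.ut, smul_mul_assoc, add_comm]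
    congr 1
    rw [e1]
    unfold normSeq turn
    rw [hF _ (by omega), if_neg (by omega), if_pos rfl, zero_add, ht1, gauge]
    push_cast
    simp only [mul_smul_comm, smul_mul_assoc, smul_smul]
    congr 1
    field_simp
    linear_combination (-1 : k) * hyz

end

end ConcatMap

/-! ### The mapping cone of a double map -/

section ConcatMap

variable {k : Type u} [Field k] {V : Type v} [Fintype V] [Quiver.{w} V]
  {R : Arrow V → Arrow V → Prop}

lemma concatSeq_add_seq {Λ : Type*} [Ring Λ] [Algebra k Λ] (S T : ℕ) (α ν : k)
    (ε φ φ' γ γ' : ℕ → Λ) (m : ℕ) :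
    concatSeq S T α ν ε (φ + φ') (γ + γ') m
      = concatSeq S T α ν ε φ γ m + concatSeq S T α ν ε φ' γ' m := by
  unfold concatSeq overlapSum
  simp only [Pi.add_apply, smul_add, Finset.sum_add_distrib, add_mul]
  split_ifs <;> abel

lemma neg_smul_mul_eq {Λ : Type*} [Ring Λ] [Algebra k Λ] (a : k) (x e : Λ) (h : x * e = x) :
    -(a • x) * e = -(a • x) := by
  rw [neg_mul, smul_mul_assoc, h]

lemma concatSeq_mul_seq {Λ : Type*} [Ring Λ] [Algebra k Λ] (S T : ℕ) (α ν : k)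
    (ε φ γ : ℕ → Λ) (a : Λ) (m : ℕ) :
    concatSeq S T α ν ε (fun i => a * φ i) (fun i => a * γ i) m
      = a * concatSeq S T α ν ε φ γ m := by
  unfold concatSeq overlapSum
  simp only [mul_add, ← mul_smul_comm, Finset.mul_sum, add_mul, mul_assoc, Finset.sum_mul]
  split_ifs <;> simp only [mul_neg, mul_smul_comm]

lemma normSeq_add_fun {n : ℕ} (A : ℕ → kˣ) (pos : ℕ → Fin n) (f g : Fin n → Alg k R) :
    normSeq A pos (f + g) = normSeq A pos f + normSeq A pos g := by
  funext m
  simp only [normSeq, Pi.add_apply, smul_add]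

lemma normSeq_mul_fun {n : ℕ} (A : ℕ → kˣ) (pos : ℕ → Fin n) (a : Alg k R) (f : Fin n → Alg k R) :
    normSeq A pos (a • f) = fun m => a * normSeq A pos f m := by
  funext m
  simp only [normSeq, Pi.smul_apply, smul_eq_mul, mul_smul_comm]

section

variable {s t c : List (Letter R)} {lam mu κ : kˣ} {r : Fin s.length} {q : Fin t.length}
    {p : Fin c.length}
    {ps : ℕ → Fin s.length} {Ls : ℕ → Letter R} {xs : ℕ → kˣ}
    {pt : ℕ → Fin t.length} {Lt : ℕ → Letter R} {xt : ℕ → kˣ}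
    {pc : ℕ → Fin c.length} {Lc : ℕ → Letter R} {xc : ℕ → kˣ}
    {σC τC fL fR : NPath R} {y z : kˣ}

/-- The map from the mapping cone to the complex of the concatenated band with the given
normalised coordinates. -/
def concatMap (uc : Unrolling c κ p pc Lc xc) (ps : ℕ → Fin s.length) (pt : ℕ → Fin t.length)
    (As At Ac : ℕ → kˣ) (α ν : k) (ε : ℕ → Alg k R) :
    ((Fin s.length → Alg k R) × (Fin t.length → Alg k R)) →ₗ[Alg k R]
      (Fin c.length → Alg k R) where
  toFun x i := (Ac (uc.idx i) : k) • concatSeq s.length t.length α ν ε (normSeq As ps x.1)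
    (normSeq At pt x.2) (uc.idx i)
  map_add' x x' := by
    funext i
    simp only [Prod.fst_add, Prod.snd_add, normSeq_add_fun, concatSeq_add_seq, smul_add,
      Pi.add_apply]
  map_smul' a x := by
    funext i
    simp only [Prod.smul_fst, Prod.smul_snd, normSeq_mul_fun, concatSeq_mul_seq, mul_smul_comm,
      Pi.smul_apply, smul_eq_mul, RingHom.id_apply]

lemma concatMap_apply (uc : Unrolling c κ p pc Lc xc) (ps : ℕ → Fin s.length)
    (pt : ℕ → Fin t.length) (As At Ac : ℕ → kˣ) (α ν : k) (ε : ℕ → Alg k R)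
    (x : (Fin s.length → Alg k R) × (Fin t.length → Alg k R)) (i : Fin c.length) :
    concatMap uc ps pt As At Ac α ν ε x i
      = (Ac (uc.idx i) : k) • concatSeq s.length t.length α ν ε (normSeq As ps x.1)
        (normSeq At pt x.2) (uc.idx i) := rfl

lemma normSeq_concatMap (uc : Unrolling c κ p pc Lc xc) (ps : ℕ → Fin s.length)
    (pt : ℕ → Fin t.length) (As At Ac : ℕ → kˣ) (α ν : k) (ε : ℕ → Alg k R)
    (x : (Fin s.length → Alg k R) × (Fin t.length → Alg k R)) {m : ℕ} (hm : m < c.length) :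
    normSeq Ac pc (concatMap uc ps pt As At Ac α ν ε x) m
      = concatSeq s.length t.length α ν ε (normSeq As ps x.1) (normSeq At pt x.2) m := by
  conv_lhs => unfold normSeq
  rw [concatMap_apply, uc.idx_pos hm, smul_smul, inv_mul_cancel₀ (Ac m).ne_zero, one_smul]

/-- The band obtained by joining the two bands at a double map. -/
structure JoinData (s t c : List (Letter R)) (lam mu κ : kˣ) (r : Fin s.length)
    (q : Fin t.length) (p : Fin c.length) (ps : ℕ → Fin s.length) (Ls : ℕ → Letter R)
    (xs : ℕ → kˣ) (pt : ℕ → Fin t.length) (Lt : ℕ → Letter R) (xt : ℕ → kˣ)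
    (pc : ℕ → Fin c.length) (Lc : ℕ → Letter R) (xc : ℕ → kˣ)
    (σC τC fL fR : NPath R) (y z : kˣ) (a b a' : ℤ) : Prop
    extends DoubleData s t lam mu r q ps Ls xs pt Lt xt σC τC fL fR y z where
  uc : Unrolling c κ p pc Lc xc
  length : c.length = s.length + t.length
  Lc₁ : ∀ m < s.length - 1, Lc m = Ls m
  Lc₂ : Lc (s.length - 1) = .dir fL
  Lc₃ : ∀ m < t.length - 1, Lc (s.length + m) = Lt m
  Lc₄ : Lc (s.length + t.length - 1) = .inv fR
  mono : gauge 1 1 Lc xc c.length * (y * (xs (s.length - 1))⁻¹)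
    = -(gauge (-1) 1 Ls xs s.length * gauge 1 (y * (xs (s.length - 1))⁻¹) Lt xt t.length)
  tgt : fL.tgt = σC.tgt
  src : fR.src = τC.src
  deg₁ : ∀ m < s.length, deg c a' (pc m) = deg s a (ps m) - 1
  deg₂ : ∀ m < t.length, deg c a' (pc (s.length + m)) = deg t b (pt m)

/-- An overlap of two bands that starts at a double map. -/
structure ConcatData (s t c : List (Letter R)) (lam mu κ : kˣ) (r : Fin s.length)
    (q : Fin t.length) (p : Fin c.length) (ps : ℕ → Fin s.length) (Ls : ℕ → Letter R)
    (xs : ℕ → kˣ) (pt : ℕ → Fin t.length) (Lt : ℕ → Letter R) (xt : ℕ → kˣ)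
    (pc : ℕ → Fin c.length) (Lc : ℕ → Letter R) (xc : ℕ → kˣ)
    (σC τC fL fR : NPath R) (y z : kˣ) (a b a' : ℤ) (M : ℕ) (ε : ℕ → Alg k R) : Prop
    extends JoinData s t c lam mu κ r q p ps Ls xs pt Lt xt pc Lc xc σC τC fL fR y z a b a' where
  ε_one : ∀ m < M, m < c.length → ε m = 1
  ε_zero : ∀ m, M < m → ε m = 0
  ε_length : ε c.length = 0
  ε_left : ∀ m < M, m < c.length → (Lt m).left = (Lc m).left
  ε_top : M < c.length → ε M * idem k R (Lc M).left = ε M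
  ε_deg : ∀ m < c.length, ε m ≠ 0 → deg t b (pt m) = deg c a' (pc m)
  mulL : pathElt k R fL.arrows * ε 0 = pathElt k R σC.arrows
  mulR : ε 0 * pathElt k R fR.arrows = pathElt k R τC.arrows
  dirEdge : ∀ m < c.length, (Lt m).dirElt k * ε (m + 1) = ε m * (Lc m).dirElt k
  invEdge : ∀ m < c.length, (Lt m).invElt k * ε m = ε (m + 1) * (Lc m).invElt k
  overlap : M = 0 ∨ (fL.arrows = σC.arrows ∧ fR.arrows = τC.arrows ∧ ∀ m, m + 1 < M → Ls m = Lt m)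

variable {a b a' : ℤ} {M : ℕ} {ε : ℕ → Alg k R}

lemma JoinData.left₁ (d : JoinData s t c lam mu κ r q p ps Ls xs pt Lt xt pc Lc xc σC τC fL fR
    y z a b a') (m : ℕ) (hm : m < s.length) : (Lc m).left = (Ls m).left := by
  rcases Nat.lt_or_ge m (s.length - 1) with h | h
  · rw [d.Lc₁ m h]
  · obtain rfl : m = s.length - 1 := by omega
    rw [d.Lc₂, d.Ls_last]
    exact d.tgt

lemma JoinData.left₂ (d : JoinData s t c lam mu κ r q p ps Ls xs pt Lt xt pc Lc xc σC τC fL fR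
    y z a b a') (m : ℕ) (hm : m < t.length) : (Lc (s.length + m)).left = (Lt m).left := by
  rcases Nat.lt_or_ge m (t.length - 1) with h | h
  · rw [d.Lc₃ m h]
  · have hT := d.hT
    obtain rfl : m = t.length - 1 := by omega
    rw [← Nat.add_sub_assoc (by omega), d.Lc₄, d.Lt_last]
    exact d.src

lemma ConcatData.ε_eq_one (d : ConcatData s t c lam mu κ r q p ps Ls xs pt Lt xt pc Lc xc σC τC fL
    fR y z a b a' M ε) (m : ℕ) (h : ε (m + t.length) ≠ 0) (hm : m < c.length) :
    m < M ∧ ε m = 1 := by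
  have hT := d.hT
  have : m < M := by
    by_contra h1
    exact h (d.ε_zero _ (by omega))
  exact ⟨this, d.ε_one m this hm⟩

/-- Every turn around τ adds a coordinate of σ. It belongs to the same projective because the
endpoints agree along the overlap, and to the same degree because positions of `c` lie one degree
below those of σ and, where ε is nonzero, in the degree of those of τ. -/
lemma ConcatData.overlapSum_mem (d : ConcatData s t c lam mu κ r q p ps Ls xs pt Lt xt pc Lc xc σC
    τC fL fR y z a b a' M ε) {n : ℤ} {f : Fin s.length → Alg k R} {g : Fin t.length → Alg k R}
    (hf : f ∈ piece k s a (n + 1)) (hg : g ∈ piece k t b n) (A B : ℕ → kˣ) (ν : k)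
    (hν : ∀ m, normSeq B pt g (m + t.length) = ν • normSeq B pt g m)
    (m : ℕ) (hm : m < c.length) (hε : ε m ≠ 0) :
    overlapSum t.length ν (normSeq A ps f) (normSeq B pt g) m * idem k R (Lt m).left
      = overlapSum t.length ν (normSeq A ps f) (normSeq B pt g) m ∧
    (deg t b (pt m) ≠ n → overlapSum t.length ν (normSeq A ps f) (normSeq B pt g) m = 0) := by
  have hT := d.hT
  have hN := d.length
  induction m using Nat.strong_induction_on with
  | _ m ih =>
  rcases lt_or_ge m t.length with h | h
  · rw [overlapSum_of_lt _ _ _ h]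
    unfold normSeq
    refine ⟨?_, fun h => ?_⟩
    · rw [smul_mul_assoc, ← d.ut.left, hg.1]
    · rw [hg.2 _ h, smul_zero]
  · obtain ⟨m, rfl⟩ : ∃ l, m = l + t.length := ⟨m - t.length, by omega⟩
    obtain ⟨h1, h2⟩ := d.ε_eq_one m hε (by omega)
    have h3 : ε m ≠ 0 := by
      intro h0
      have h4 : (1 : Alg k R) = 0 := by rw [← h2, h0]
      exact hε (by rw [← mul_one (ε _), h4, mul_zero])
    obtain ⟨h4, h5⟩ := ih m (by omega) (by omega) h3
    rw [overlapSum_add (by omega) _ hν, d.ut.L_add, d.ut.pos_add]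
    refine ⟨?_, fun h => ?_⟩
    · rw [smul_mul_assoc, add_mul, h4]
      congr 2
      unfold normSeq
      rw [smul_mul_assoc, d.ε_left m h1 (by omega), d.left₁ m (by omega), ← d.us.left, hf.1]
    · rw [h5 h, zero_add]
      unfold normSeq
      rw [hf.2, smul_zero, smul_zero]
      have e1 := d.deg₁ m (by omega)
      have e2 := d.ε_deg m (by omega) h3
      omega

lemma ConcatData.concatMap_mem (d : ConcatData s t c lam mu κ r q p ps Ls xs pt Lt xt pc Lc xc σC
    τC fL fR y z a b a' M ε) {n : ℤ} {f : Fin s.length → Alg k R} {g : Fin t.length → Alg k R}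
    (hf : f ∈ piece k s a (n + 1)) (hg : g ∈ piece k t b n) (A B C : ℕ → kˣ) (α ν : k)
    (hν : ∀ m, normSeq B pt g (m + t.length) = ν • normSeq B pt g m) :
    concatMap d.uc ps pt A B C α ν ε (f, g) ∈ piece k c a' n := by
  have hN := d.length
  have key : ∀ m < c.length,
      concatSeq s.length t.length α ν ε (normSeq A ps f) (normSeq B pt g) m
          * idem k R (Lc m).left
        = concatSeq s.length t.length α ν ε (normSeq A ps f) (normSeq B pt g) m ∧
      (deg c a' (pc m) ≠ n →
        concatSeq s.length t.length α ν ε (normSeq A ps f) (normSeq B pt g) m = 0) := by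
    intro m hm
    have h1 : overlapSum t.length ν (normSeq A ps f) (normSeq B pt g) m * ε m
          * idem k R (Lc m).left
        = overlapSum t.length ν (normSeq A ps f) (normSeq B pt g) m * ε m ∧
      (deg c a' (pc m) ≠ n →
        overlapSum t.length ν (normSeq A ps f) (normSeq B pt g) m * ε m = 0) := by
      by_cases h0 : ε m = 0
      · simp [h0]
      · obtain ⟨h2, h3⟩ := d.overlapSum_mem hf hg A B ν hν m hm h0
        refine ⟨?_, fun h => ?_⟩
        · rcases lt_trichotomy m M with h4 | h4 | h4
          · rw [d.ε_one m h4 hm, mul_one, ← d.ε_left m h4 hm, h2]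
          · subst h4
            rw [mul_assoc, d.ε_top hm]
          · exact absurd (d.ε_zero m h4) h0
        · rw [h3, zero_mul]
          rwa [d.ε_deg m hm h0]
    unfold concatSeq
    rw [add_mul, h1.1]
    split_ifs with hS
    · refine ⟨?_, fun h => ?_⟩
      · congr 1
        unfold normSeq
        rw [smul_mul_assoc, d.left₁ m hS, ← d.us.left, hf.1]
      · rw [h1.2 h, add_zero]
        unfold normSeq
        rw [hf.2, smul_zero]
        have := d.deg₁ m hS
        omega
    · obtain ⟨l, rfl⟩ : ∃ l, m = s.length + l := ⟨m - s.length, by omega⟩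
      rw [Nat.add_sub_cancel_left]
      refine ⟨?_, fun h => ?_⟩
      · congr 1
        unfold normSeq
        refine neg_smul_mul_eq _ _ _ ?_
        rw [smul_mul_assoc, d.left₂ l (by omega), ← d.ut.left, hg.1]
      · rw [h1.2 h, add_zero]
        unfold normSeq
        rw [hg.2, smul_zero, smul_zero, neg_zero]
        rwa [← d.deg₂ l (by omega)]
  refine ⟨fun i => ?_, fun i hi => ?_⟩
  · have h1 := (key _ (d.uc.idx_lt i)).1
    rw [← d.uc.left, d.uc.pos_idx] at h1
    rw [concatMap_apply, smul_mul_assoc, h1]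
  · rw [concatMap_apply, (key _ (d.uc.idx_lt i)).2, smul_zero]
    rwa [d.uc.pos_idx]

end

end ConcatMap

/-! ### The isomorphism from the cone to the complex of the joined band -/

section ConcatIso

lemma smul_eq_neg_smul_mul {k Λ : Type*} [Field k] [Ring Λ] [Algebra k Λ] (a b : k) (h : a = -b)
    (x e : Λ) : a • x * e = -(b • (x * e)) := by
  rw [h, smul_mul_assoc, neg_smul]

variable {k : Type u} [Field k] {V : Type v} [Fintype V] [Quiver.{w} V]
  {R : Arrow V → Arrow V → Prop}
    {s t c : List (Letter R)} {lam mu κ : kˣ} {r : Fin s.length} {q : Fin t.length}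
    {p : Fin c.length}
    {ps : ℕ → Fin s.length} {Ls : ℕ → Letter R} {xs : ℕ → kˣ}
    {pt : ℕ → Fin t.length} {Lt : ℕ → Letter R} {xt : ℕ → kˣ}
    {pc : ℕ → Fin c.length} {Lc : ℕ → Letter R} {xc : ℕ → kˣ}
    {σC τC fL fR : NPath R} {y z : kˣ} {a b a' : ℤ} {M : ℕ} {ε : ℕ → Alg k R}

/-- The map of a matrix to be composed with the differential of the mapping cone. -/
abbrev coneMap (s t : List (Letter R)) (lam mu : kˣ) (r : Fin s.length) (q : Fin t.length)
    (F : Matrix (Fin s.length) (Fin t.length) (Alg k R)) :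
    ((Fin s.length → Alg k R) × (Fin t.length → Alg k R)) →ₗ[Alg k R]
      ((Fin s.length → Alg k R) × (Fin t.length → Alg k R)) :=
  LinearMap.prod (-(bandMatrix s lam r).vecMulLinear ∘ₗ LinearMap.fst _ _ _)
    (F.vecMulLinear ∘ₗ LinearMap.fst _ _ _ +
      (bandMatrix t mu q).vecMulLinear ∘ₗ LinearMap.snd _ _ _)

lemma ConcatData.concatSeq_intertwine (d : ConcatData s t c lam mu κ r q p ps Ls xs pt Lt xt pc Lc
    xc σC τC fL fR y z a b a' M ε) {α ν : k} (hα : α ≠ 0) {φ γ φ' γ' : ℕ → Alg k R}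
    (h : ConeSeq s.length t.length α ν (fun m => (Ls m).dirElt k) (fun m => (Ls m).invElt k)
      (fun m => (Lt m).dirElt k) (fun m => (Lt m).invElt k)
      (pathElt k R fL.arrows) (pathElt k R fR.arrows) φ γ φ' γ') :
    concatSeq s.length t.length α ν ε φ' γ' 0
      = concatSeq s.length t.length α ν ε φ γ 1 * (Lc 0).invElt k ∧
    (∀ m, m + 2 < s.length + t.length → concatSeq s.length t.length α ν ε φ' γ' (m + 1)
      = concatSeq s.length t.length α ν ε φ γ m * (Lc m).dirElt k
        + concatSeq s.length t.length α ν ε φ γ (m + 2) * (Lc (m + 1)).invElt k) ∧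
    (∀ m, m + 2 = s.length + t.length → concatSeq s.length t.length α ν ε φ' γ' (m + 1)
      = concatSeq s.length t.length α ν ε φ γ m * (Lc m).dirElt k
        - (ν * α⁻¹) • (concatSeq s.length t.length α ν ε φ γ 0 * (Lc (m + 1)).invElt k)) := by
  have hS := d.hS
  have hT := d.hT
  have hN := d.length
  have hs1 : (Ls (s.length - 1)).dirElt k = pathElt k R σC.arrows := by rw [d.Ls_last]; rfl
  have ht1 : (Lt (t.length - 1)).invElt k = pathElt k R τC.arrows := by rw [d.Lt_last]; rfl
  have hG : ∀ m, ε (m + 1) ≠ 0 → overlapSum t.length ν φ' γ' (m + 1)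
      = overlapSum t.length ν φ γ m * (Lt m).dirElt k
      + overlapSum t.length ν φ γ (m + 2) * (Lt (m + 1)).invElt k := fun m hm => by
    have h1 : m + 1 ≤ M := by
      by_contra h
      exact hm (d.ε_zero _ (by omega))
    obtain h0 | ⟨hL, hR, hov⟩ := d.overlap
    · omega
    · rw [hL, hR, ← hs1, ← ht1] at h
      -- The last index at which ε may be nonzero is `M`, and the row in question is that of `m +
      -- 1`. Hence `m ≤ M - 1`, and agreement of the letters before `M - 1` is enough.
      exact overlapSum_intertwine hT h (fun m => by simp only [d.ut.L_add])
        (fun m => by simp only [d.ut.L_add]) (by simp only [d.Lt_last]; rfl) (M := M - 1)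
        (fun m hm => by simp only [hov m (by omega)]) (fun m hm => by simp only [hov m (by omega)])
        m (by omega)
  refine Gentle.concatSeq_intertwine hS hT hα h ε (dc := fun m => (Lc m).dirElt k)
    (ic := fun m => (Lc m).invElt k) (by simp only [d.Ls_last]; rfl)
    (fun m hm => by simp only [d.Lc₁ m hm, and_self]) ?_ (fun m hm => by simp only [d.Lc₃ m hm, and_self])
    (by simp only [d.Lc₄]; rfl) ?_ ?_ (by rw [← hN]; exact d.dirEdge) (by rw [← hN]; exact d.invEdge)
    (by rw [← hN]; exact d.ε_length) hG
  · simp only [d.Lc₂]; exact ⟨rfl, rfl⟩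
  · rw [d.mulL]; exact hs1.symm
  · rw [d.mulR]; exact ht1.symm

lemma ConcatData.concatMap_comm (d : ConcatData s t c lam mu κ r q p ps Ls xs pt Lt xt pc Lc xc
    σC τC fL fR y z a b a' M ε)
    (x : (Fin s.length → Alg k R) × (Fin t.length → Alg k R)) :
    concatMap d.uc ps pt (gauge (-1) 1 Ls xs) (gauge 1 (y * (xs (s.length - 1))⁻¹) Lt xt)
        (gauge 1 1 Lc xc) (gauge (-1) 1 Ls xs s.length : k)
        (turn y xs Lt xt s.length t.length) ε
        (coneMap s t lam mu r q (doubleMatrix (ps (s.length - 1)) (ps 0) (pt 0)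
          (pt (t.length - 1)) y z fL fR) x)
      = (bandMatrix c κ p).vecMulLinear (concatMap d.uc ps pt (gauge (-1) 1 Ls xs)
          (gauge 1 (y * (xs (s.length - 1))⁻¹) Lt xt) (gauge 1 1 Lc xc)
          (gauge (-1) 1 Ls xs s.length : k) (turn y xs Lt xt s.length t.length) ε x) := by
  have hS := d.hS
  have hT := d.hT
  have hN := d.length
  have hcs := d.coneSeq x.1 x.2
  obtain ⟨h1, h2, h3⟩ := d.concatSeq_intertwine (gauge (-1) 1 Ls xs s.length).ne_zero hcs
  refine eq_of_normSeq_eq d.uc (gauge 1 1 Lc xc) fun m hm => ?_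
  rw [normSeq_concatMap _ _ _ _ _ _ _ _ _ _ hm]
  have hone : ∀ h : Fin c.length → Alg k R, (bandMatrix c κ p).vecMulLinear h
      = (((1 : kˣ) : k)) • Matrix.vecMul h (bandMatrix c κ p) := fun h => by
    rw [Units.val_one, one_smul]; rfl
  rw [hone]
  change concatSeq s.length t.length _ _ ε (normSeq _ ps (-Matrix.vecMul x.1 (bandMatrix s lam r)))
    (normSeq _ pt (Matrix.vecMul x.1 (doubleMatrix (ps (s.length - 1)) (ps 0) (pt 0)
      (pt (t.length - 1)) y z fL fR) + Matrix.vecMul x.2 (bandMatrix t mu q))) m = _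
  rcases Nat.eq_zero_or_pos m with rfl | hm0
  · rw [h1, normSeq_row_zero d.uc, normSeq_concatMap _ _ _ _ _ _ _ _ _ _ (by omega : 1 < c.length)]
    have : (Lc (c.length - 1)).dirElt k = 0 := by
      rw [hN, d.Lc₄]; rfl
    rw [this, mul_zero, smul_zero, zero_add]
  · obtain ⟨m, rfl⟩ : ∃ l, m = l + 1 := ⟨m - 1, by omega⟩
    rw [normSeq_row d.uc, normSeq_concatMap _ _ _ _ _ _ _ _ _ _ (by omega : m < c.length)]
    rcases Nat.lt_or_ge (m + 2) c.length with h | h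
    · rw [h2 m (by omega), normSeq_concatMap _ _ _ _ _ _ _ _ _ _ h]
    · have e : m + 2 = 0 + c.length := by omega
      rw [h3 m (by omega), e, normSeq_add d.uc,
        normSeq_concatMap _ _ _ _ _ _ _ _ _ _ (by omega : 0 < c.length), sub_eq_add_neg]
      congr 1
      -- In the row that closes up `c`, the field `mono` identifies the turn factor of `c` with `-(ν
      -- * α⁻¹)`.
      refine (smul_eq_neg_smul_mul _ _ ?_ _ _).symm
      have hm := congrArg Units.val d.mono
      push_cast at hm
      have hc0 := (gauge 1 1 Lc xc c.length).ne_zero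
      have hs0 := (gauge (-1) 1 Ls xs s.length).ne_zero
      have ht0 := (gauge 1 (y * (xs (s.length - 1))⁻¹) Lt xt t.length).ne_zero
      have hx := (xs (s.length - 1)).ne_zero
      unfold turn
      push_cast
      field_simp at hm ⊢
      linear_combination hm

theorem ConcatData.nonempty_iso [Module.Finite k (Alg k R)] (d : ConcatData s t c lam mu κ r q p ps
    Ls xs pt Lt xt pc Lc xc σC τC fL fR y z a b a' M ε) (hs : IsBandWord s) (ht : IsBandWord t)
    (hc : IsBandWord c) (φ : bandComplex hs lam r a ⟶ bandComplex ht mu q b)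
    (hφ : ∀ n (f : piece k s a n), (show piece k t b n from (φ.f n).hom f).1 = Matrix.vecMul f.1
      (doubleMatrix (ps (s.length - 1)) (ps 0) (pt 0) (pt (t.length - 1)) y z fL fR)) :
    Nonempty (CochainComplex.mappingCone φ ≅ bandComplex hc κ p a') := by
  have hS := d.hS
  have hT := d.hT
  have hN := d.length
  have hart : IsArtinian (Alg k R) ((Fin s.length → Alg k R) × (Fin t.length → Alg k R)) :=
    isArtinian_of_tower k inferInstance
  let u := concatMap d.uc ps pt (gauge (-1) 1 Ls xs)
    (gauge 1 (y * (xs (s.length - 1))⁻¹) Lt xt) (gauge 1 1 Lc xc)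
    (gauge (-1) 1 Ls xs s.length : k) (turn y xs Lt xt s.length t.length) ε
  -- The plain relabelling of positions, without corrections. It need not be a chain map: it serves
  -- only as an injection in the opposite direction that respects the degrees.
  let v : (Fin c.length → Alg k R) →ₗ[Alg k R]
      ((Fin s.length → Alg k R) × (Fin t.length → Alg k R)) :=
    LinearMap.prod (LinearMap.funLeft _ _ fun i => pc (d.us.idx i))
      (LinearMap.funLeft _ _ fun i => pc (s.length + d.ut.idx i))
  have hu : ∀ n, ∀ x ∈ (piece k s a (n + 1)).prod (piece k t b n), u x ∈ piece k c a' n :=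
    fun n x hx => d.concatMap_mem hx.1 hx.2 _ _ _ _ _ (normSeq_add d.ut 1 _ x.2)
  have hv : ∀ n, ∀ x ∈ piece k c a' n, v x ∈ (piece k s a (n + 1)).prod (piece k t b n) := by
    intro n x hx
    refine ⟨⟨fun i => ?_, fun i hi => ?_⟩, ⟨fun i => ?_, fun i hi => ?_⟩⟩
    · have := hx.1 (pc (d.us.idx i))
      rwa [d.uc.left, d.left₁ _ (d.us.idx_lt i), ← d.us.left, d.us.pos_idx] at this
    · refine hx.2 (pc (d.us.idx i)) ?_
      rw [d.deg₁ _ (d.us.idx_lt i), d.us.pos_idx]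
      omega
    · have := hx.1 (pc (s.length + d.ut.idx i))
      rwa [d.uc.left, d.left₂ _ (d.ut.idx_lt i), ← d.ut.left, d.ut.pos_idx] at this
    · refine hx.2 (pc (s.length + d.ut.idx i)) ?_
      rwa [d.deg₂ _ (d.ut.idx_lt i), d.ut.pos_idx]
  have inju : ∀ x, u x = 0 → x = 0 := by
    intro x hx
    have hα := (gauge (-1) 1 Ls xs s.length).ne_zero
    have h0 : ∀ m < s.length + t.length, concatSeq s.length t.length
        (gauge (-1) 1 Ls xs s.length : k) (turn y xs Lt xt s.length t.length) ε
        (normSeq (gauge (-1) 1 Ls xs) ps x.1)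
        (normSeq (gauge 1 (y * (xs (s.length - 1))⁻¹) Lt xt) pt x.2) m = 0 := by
      intro m hm
      rw [← normSeq_concatMap d.uc ps pt _ _ (gauge 1 1 Lc xc) _ _ _ _ (by omega)]
      change normSeq _ _ (u x) m = 0
      rw [hx]
      simp [normSeq]
    obtain ⟨h1, h2⟩ := concatSeq_injective (by omega) (by omega) hα ε _ _
      (normSeq_add d.ut 1 _ x.2)
      (fun m hm h => (d.ε_eq_one m h (by omega)).2) h0
    refine Prod.ext ?_ ?_
    · exact eq_of_normSeq_eq d.us (gauge (-1) 1 Ls xs) fun m hm => by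
        rw [h1 m hm]; simp [normSeq]
    · exact eq_of_normSeq_eq d.ut (gauge 1 (y * (xs (s.length - 1))⁻¹) Lt xt) fun m hm => by
        rw [h2 m hm]; simp [normSeq]
  have injv : ∀ x, v x = 0 → x = 0 := by
    intro x hx
    have h1 : ∀ i, x (pc (d.us.idx i)) = 0 := fun i => congrFun (congrArg Prod.fst hx) i
    have h2 : ∀ i, x (pc (s.length + d.ut.idx i)) = 0 := fun i => congrFun (congrArg Prod.snd hx) i
    funext i
    obtain ⟨m, ⟨hm, rfl⟩, -⟩ := d.uc.bij i
    rcases Nat.lt_or_ge m s.length with h | h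
    · have := h1 (ps m)
      rwa [d.us.idx_pos h] at this
    · have := h2 (pt (m - s.length))
      rwa [d.ut.idx_pos (by omega), show s.length + (m - s.length) = m by omega] at this
  exact ((bandModel hs lam r a).cone (bandModel ht mu q b) φ
    (doubleMatrix (ps (s.length - 1)) (ps 0) (pt 0) (pt (t.length - 1)) y z fL fR).vecMulLinear
      (fun n x => hφ n x)).nonempty_iso (bandModel hc κ p a') u hu (fun _ x _ => inju x)
      (fun n => exists_mem_of_injective u v (hu n) (hv n) (fun x _ => inju x) (fun x _ => injv x))
      d.concatMap_comm

end ConcatIso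

/-! ### Null-homotopic double maps -/

section NullHomotopy

variable {k : Type u} [Field k] {V : Type v} [Fintype V] [Quiver.{w} V]
  {R : Arrow V → Arrow V → Prop}
    {s t : List (Letter R)} {lam mu : kˣ} {r : Fin s.length} {q : Fin t.length}
    {ps : ℕ → Fin s.length} {Ls : ℕ → Letter R} {xs : ℕ → kˣ}
    {pt : ℕ → Fin t.length} {Lt : ℕ → Letter R} {xt : ℕ → kˣ}
    {σC τC fL fR : NPath R} {y z : kˣ}

lemma gauge_dir (e a : kˣ) (L : ℕ → Letter R) (x : ℕ → kˣ) (m : ℕ) (w : Alg k R) :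
    (gauge e a L x m : k) • w * ((e * x m : kˣ) : k) • (L m).dirElt k
      = (gauge e a L x (m + 1) : k) • (w * (L m).dirElt k) := by
  rw [gauge]
  rcases L m with p | p
  · rw [smul_mul_smul_comm]; rfl
  · simp [Letter.dirElt]

lemma gauge_inv (e a : kˣ) (L : ℕ → Letter R) (x : ℕ → kˣ) (m : ℕ) (w : Alg k R) :
    (gauge e a L x (m + 1) : k) • w * ((e * x m : kˣ) : k) • (L m).invElt k
      = (gauge e a L x m : k) • (w * (L m).invElt k) := by
  rw [gauge]
  rcases L m with p | p
  · simp [Letter.invElt]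
  · rw [smul_mul_smul_comm]
    congr 1
    have he := e.ne_zero
    have hx := (x m).ne_zero
    simp only [Letter.isDir]
    push_cast
    field_simp

lemma smul_eq_neg_smul_smul {k Λ : Type*} [Field k] [Ring Λ] [Algebra k Λ] (a b c : k)
    (h : a = -(b * c)) (x e : Λ) : x * a • e = -(b • (c • x * e)) := by
  rw [h, smul_mul_assoc, smul_smul, mul_smul_comm, neg_smul]

lemma vecMul_single {n n' : ℕ} {A : Type*} [Ring A] (f : Fin n → A) (i : Fin n)
    (j : Fin n') (x : A) : Matrix.vecMul f (Matrix.single i j x) = Pi.single j (f i * x) := by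
  funext l
  rw [vecMul_single_apply, Pi.single_apply]
  exact if_congr eq_comm rfl rfl

/-- The homotopy with given coordinates, of which the first `K` are used. -/
def overlapHomotopy (ps : ℕ → Fin s.length) (pt : ℕ → Fin t.length) (A B : ℕ → kˣ)
    (θ : ℕ → Alg k R) (K : ℕ) :
    (Fin s.length → Alg k R) →ₗ[Alg k R] (Fin t.length → Alg k R) where
  toFun f := ∑ m ∈ Finset.range K, Pi.single (pt m) ((B m : k) • (normSeq A ps f m * θ m))
  map_add' f g := by
    simp only [normSeq_add_fun, Pi.add_apply, add_mul, smul_add, Pi.single_add,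
      Finset.sum_add_distrib]
  map_smul' a f := by
    simp only [normSeq_mul_fun, mul_assoc, ← mul_smul_comm, RingHom.id_apply, Finset.smul_sum]
    refine Finset.sum_congr rfl fun m _ => ?_
    rw [← smul_eq_mul, Pi.single_smul]

lemma overlapHomotopy_apply (ps : ℕ → Fin s.length) (pt : ℕ → Fin t.length) (A B : ℕ → kˣ)
    (θ : ℕ → Alg k R) (K : ℕ) (f : Fin s.length → Alg k R) :
    overlapHomotopy ps pt A B θ K f
      = ∑ m ∈ Finset.range K, Pi.single (pt m) ((B m : k) • (normSeq A ps f m * θ m)) := rfl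

/-- Along the overlap the terms of D'H and HD cancel in pairs by the edge conditions, the sign being
built into the gauge on σ. At the upper end nothing is left because `θ (K + 1)` vanishes. At time 0
the letters σ_C and τ_C before the overlap leave `f_L` and `f_R`. -/
lemma DoubleData.overlapHomotopy_comm
    (d : DoubleData s t lam mu r q ps Ls xs pt Lt xt σC τC fL fR y z) {θ : ℕ → Alg k R} {K : ℕ}
    (mulL : pathElt k R σC.arrows * θ 0 = pathElt k R fL.arrows)
    (mulR : θ 0 * pathElt k R τC.arrows = pathElt k R fR.arrows)
    (dirEdge : ∀ m, (Ls m).dirElt k * θ (m + 1) = θ m * (Lt m).dirElt k)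
    (invEdge : ∀ m, (Ls m).invElt k * θ m = θ (m + 1) * (Lt m).invElt k)
    (hθ : θ (K + 1) = 0) (f : Fin s.length → Alg k R) :
    Matrix.vecMul f (doubleMatrix (ps (s.length - 1)) (ps 0) (pt 0) (pt (t.length - 1)) y z fL fR)
      = Matrix.vecMul (overlapHomotopy ps pt (gauge (-1) 1 Ls xs)
          (gauge 1 (y * (xs (s.length - 1))⁻¹) Lt xt) θ (K + 1) f) (bandMatrix t mu q)
        + overlapHomotopy ps pt (gauge (-1) 1 Ls xs)
          (gauge 1 (y * (xs (s.length - 1))⁻¹) Lt xt) θ (K + 1)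
          (Matrix.vecMul f (bandMatrix s lam r)) := by
  have hS := d.hS
  have hT := d.hT
  -- Only the rows of σ are used, so the coordinates on τ may be taken to be zero.
  have hcs := d.coneSeq f 0
  set A := gauge (-1) 1 Ls xs with hA
  set B := gauge 1 (y * (xs (s.length - 1))⁻¹) Lt xt with hB
  set φ := normSeq A ps f with hφ
  have hdir : ∀ m w, (B m : k) • w * (xt m : k) • (Lt m).dirElt k
      = (B (m + 1) : k) • (w * (Lt m).dirElt k) := fun m w => by
    have := gauge_dir 1 (y * (xs (s.length - 1))⁻¹) Lt xt m w
    rwa [one_mul] at this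
  have hinv : ∀ m w, (B (m + 1) : k) • w * (xt m : k) • (Lt m).invElt k
      = (B m : k) • (w * (Lt m).invElt k) := fun m w => by
    have := gauge_inv 1 (y * (xs (s.length - 1))⁻¹) Lt xt m w
    rwa [one_mul] at this
  have hrow0 : ∀ w : Alg k R, Matrix.vecMul (Pi.single (pt 0) w) (bandMatrix t mu q)
      = Pi.single (pt 1) (w * ((xt 0 : k) • (Lt 0).dirElt k))
        + Pi.single (pt (t.length - 1)) (w * ((xt (t.length - 1) : k) • pathElt k R τC.arrows)) := by
    intro w
    have := d.ut.single_row w (t.length - 1)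
    have e0 := d.ut.pos_add 0
    have e1 := d.ut.pos_add 1
    have e2 := d.ut.L_add 0
    have e3 := d.ut.x_add 0
    rw [zero_add] at e0 e2 e3
    rw [show t.length - 1 + 1 = t.length by omega,
      show t.length - 1 + 2 = 1 + t.length by omega, e0, e1, e2, e3, d.Lt_last] at this
    exact this
  have h1 : Matrix.vecMul (overlapHomotopy ps pt A B θ (K + 1) f) (bandMatrix t mu q)
      = ∑ m ∈ Finset.range (K + 1), Pi.single (pt (m + 1))
          ((B (m + 1) : k) • (φ m * (θ m * (Lt m).dirElt k)))
        + ∑ m ∈ Finset.range K, Pi.single (pt m)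
          ((B m : k) • (φ (m + 1) * (θ (m + 1) * (Lt m).invElt k)))
        + Pi.single (pt (t.length - 1))
          (((B 0 : k) * (xt (t.length - 1) : k)) • (φ 0 * pathElt k R fR.arrows)) := by
    rw [overlapHomotopy_apply, Matrix.sum_vecMul, Finset.sum_range_succ']
    rw [Finset.sum_congr rfl fun m _ => d.ut.single_row _ m, Finset.sum_add_distrib, hrow0]
    rw [Finset.sum_range_succ' (fun m => Pi.single (pt (m + 1)) _) K]
    simp only [hdir, hinv, smul_mul_smul_comm, mul_assoc, mulR]
    abel
  have h2 : overlapHomotopy ps pt A B θ (K + 1) (-Matrix.vecMul f (bandMatrix s lam r))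
      = ∑ m ∈ Finset.range K, Pi.single (pt (m + 1))
          ((B (m + 1) : k) • (φ m * ((Ls m).dirElt k * θ (m + 1))))
        + ∑ m ∈ Finset.range (K + 1), Pi.single (pt m)
          ((B m : k) • (φ (m + 1) * ((Ls m).invElt k * θ m)))
        + Pi.single (pt 0)
          (((B 0 : k) * (A s.length : k)) • (φ (s.length - 1) * pathElt k R fL.arrows)) := by
    rw [overlapHomotopy_apply, Finset.sum_range_succ', hcs.φ'_zero,
      Finset.sum_range_succ' (fun m => Pi.single (pt m) _) K]
    simp only [hcs.φ'_succ, d.Ls_last, Letter.dirElt]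
    simp only [add_mul, smul_add, Pi.single_add, Finset.sum_add_distrib, smul_mul_assoc, mul_assoc,
      mulL, smul_smul]
    abel
  have h3 : overlapHomotopy ps pt A B θ (K + 1) (Matrix.vecMul f (bandMatrix s lam r))
      = -overlapHomotopy ps pt A B θ (K + 1) (-Matrix.vecMul f (bandMatrix s lam r)) := by
    rw [map_neg, neg_neg]
  rw [h3, h1, h2]
  have e1 : ∀ m, θ m * (Lt m).dirElt k = (Ls m).dirElt k * θ (m + 1) := fun m => (dirEdge m).symm
  rw [Finset.sum_range_succ (fun m => Pi.single (pt (m + 1)) _) K,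
    Finset.sum_range_succ (fun m => Pi.single (pt m) _) K]
  simp only [e1, invEdge, hθ, mul_zero, zero_mul, smul_zero, Pi.single_zero, add_zero]
  unfold doubleMatrix
  rw [Matrix.vecMul_add, vecMul_single, vecMul_single]
  have hy : f (ps (s.length - 1)) * (y : k) • pathElt k R fL.arrows
      = -(((B 0 : k) * (A s.length : k)) • (φ (s.length - 1) * pathElt k R fL.arrows)) := by
    rw [hφ, normSeq]
    have hs1 : A s.length = A (s.length - 1) * (-1 * xs (s.length - 1)) := by
      conv_lhs => rw [hA, show s.length = s.length - 1 + 1 by omega, gauge, d.Ls_last]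
      rfl
    have hAs := (A (s.length - 1)).ne_zero
    have hxs := (xs (s.length - 1)).ne_zero
    rw [hs1, show B 0 = y * (xs (s.length - 1))⁻¹ from rfl]
    refine smul_eq_neg_smul_smul (k := k) (Λ := Alg k R) _ _ _ ?_ _ _
    push_cast
    field_simp
  have hz : f (ps 0) * (z : k) • pathElt k R fR.arrows
      = ((B 0 : k) * (xt (t.length - 1) : k)) • (φ 0 * pathElt k R fR.arrows) := by
    rw [hφ, normSeq, show B 0 = y * (xs (s.length - 1))⁻¹ from rfl, show A 0 = 1 from rfl]
    have hxs := (xs (s.length - 1)).ne_zero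
    have hyz := congrArg Units.val d.hyz
    push_cast at hyz ⊢
    rw [inv_one, one_smul, mul_smul_comm]
    congr 1
    field_simp
    linear_combination -hyz
  rw [hy, hz, Pi.single_neg]
  abel

theorem DoubleData.nonempty_homotopy
    (d : DoubleData s t lam mu r q ps Ls xs pt Lt xt σC τC fL fR y z) {θ : ℕ → Alg k R} {K : ℕ}
    (mulL : pathElt k R σC.arrows * θ 0 = pathElt k R fL.arrows)
    (mulR : θ 0 * pathElt k R τC.arrows = pathElt k R fR.arrows)
    (dirEdge : ∀ m, (Ls m).dirElt k * θ (m + 1) = θ m * (Lt m).dirElt k)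
    (invEdge : ∀ m, (Ls m).invElt k * θ m = θ (m + 1) * (Lt m).invElt k)
    (hθ : θ (K + 1) = 0) {a b : ℤ}
    (hdeg : ∀ m, θ m ≠ 0 → deg s a (ps m) = deg t b (pt m) + 1)
    (hleft : ∀ m, ∀ x, x * idem k R (Ls m).left = x → x * θ m * idem k R (Lt m).left = x * θ m)
    (hs : IsBandWord s) (ht : IsBandWord t) (φ : bandComplex hs lam r a ⟶ bandComplex ht mu q b)
    (hφ : ∀ n (f : piece k s a n), (show piece k t b n from (φ.f n).hom f).1 = Matrix.vecMul f.1
      (doubleMatrix (ps (s.length - 1)) (ps 0) (pt 0) (pt (t.length - 1)) y z fL fR)) :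
    Nonempty (Homotopy φ 0) := by
  refine (bandModel hs lam r a).nonempty_homotopy (bandModel ht mu q b) φ
    (doubleMatrix (ps (s.length - 1)) (ps 0) (pt 0) (pt (t.length - 1)) y z fL fR).vecMulLinear
    (overlapHomotopy ps pt (gauge (-1) 1 Ls xs)
      (gauge 1 (y * (xs (s.length - 1))⁻¹) Lt xt) θ (K + 1)) (fun n x => hφ n x) ?_
    (d.overlapHomotopy_comm mulL mulR dirEdge invEdge hθ)
  intro n f hf
  rw [overlapHomotopy_apply]
  refine Submodule.sum_mem _ fun m _ => ⟨fun i => ?_, fun i hi => ?_⟩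
  · rw [Pi.single_apply]
    split_ifs with h
    · subst h
      rw [smul_mul_assoc, d.ut.left, hleft m]
      unfold normSeq
      rw [smul_mul_assoc, ← d.us.left, hf.1]
    · rw [zero_mul]
  · rw [Pi.single_apply]
    split_ifs with h
    · subst h
      by_cases h0 : θ m = 0
      · rw [h0, mul_zero, smul_zero]
      · unfold normSeq
        rw [hf.2, smul_zero, zero_mul, smul_zero]
        have := hdeg m h0
        omega
    · rfl

end NullHomotopy

/-! ### Paths and letters over a gentle algebra -/

section Paths

variable {V : Type v} [Quiver.{w} V] {R : Arrow V → Arrow V → Prop}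

lemma NPath.ext_arrows {p q : NPath R} (h : p.arrows = q.arrows) : p = q := by
  cases p; cases q; cases h; rfl

lemma NPath.leftmost_of_append {p q h : NPath R} (e : p.arrows = q.arrows ++ h.arrows) :
    p.leftmost = q.leftmost := by
  unfold NPath.leftmost
  simp only [e]
  exact List.head_append_of_ne_nil q.ne

lemma NPath.rightmost_of_append {p q h : NPath R} (e : p.arrows = q.arrows ++ h.arrows) :
    p.rightmost = h.rightmost := by
  unfold NPath.rightmost
  simp only [e]
  exact List.getLast_append_of_ne_nil _ h.ne

lemma noRel_junction {p q : NPath R} (h : NoRel R (p.arrows ++ q.arrows)) :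
    p.src = q.tgt ∧ ¬ R p.rightmost q.leftmost := by
  unfold NoRel at h
  rw [List.isChain_append] at h
  exact h.2.2 p.rightmost (List.getLast_mem_getLast? p.ne) q.leftmost (List.head_mem_head? q.ne)

lemma exists_append_of_isChain {α : Type*} {r : α → α → Prop}
    (hr : ∀ a b c, r a b → r a c → b = c) (a : α) (l l' : List α) (h : (a :: l).IsChain r)
    (h' : (a :: l').IsChain r) : (∃ m, l' = l ++ m) ∨ ∃ m, l = l' ++ m := by
  induction l generalizing a l' with
  | nil => exact Or.inl ⟨l', rfl⟩
  | cons b l ih =>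
    cases l' with
    | nil => exact Or.inr ⟨b :: l, rfl⟩
    | cons b' l' =>
      rw [List.isChain_cons_cons] at h h'
      obtain rfl := hr _ _ _ h.1 h'.1
      rcases ih b l' h.2 h'.2 with ⟨m, rfl⟩ | ⟨m, rfl⟩
      · exact Or.inl ⟨m, rfl⟩
      · exact Or.inr ⟨m, rfl⟩

/-- The relative position of the two factorisations of the path `f_L τ_C = σ_C f_R`. -/
lemma double_cases {σC τC fL fR : NPath R} (h : fL.arrows ++ τC.arrows = σC.arrows ++ fR.arrows) :
    (fL = σC ∧ fR = τC) ∨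
    (∃ g : NPath R, σC.arrows = fL.arrows ++ g.arrows ∧ τC.arrows = g.arrows ++ fR.arrows) ∨
    (∃ g : NPath R, fL.arrows = σC.arrows ++ g.arrows ∧ fR.arrows = g.arrows ++ τC.arrows) := by
  rcases List.append_eq_append_iff.1 h with ⟨m, h1, h2⟩ | ⟨m, h1, h2⟩
  · rcases eq_or_ne m [] with rfl | hm
    · exact Or.inl ⟨NPath.ext_arrows (by simpa using h1.symm), NPath.ext_arrows (by simpa using h2.symm)⟩
    · have := σC.noRel
      rw [h1, NoRel, List.isChain_append] at this
      exact Or.inr (Or.inl ⟨⟨m, hm, this.2.1⟩, h1, h2⟩)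
  · rcases eq_or_ne m [] with rfl | hm
    · exact Or.inl ⟨NPath.ext_arrows (by simpa using h1), NPath.ext_arrows (by simpa using h2)⟩
    · have := fL.noRel
      rw [h1, NoRel, List.isChain_append] at this
      exact Or.inr (Or.inr ⟨⟨m, hm, this.2.1⟩, h1, h2⟩)

end Paths

/-! ### Comparison of letters over a gentle algebra -/

section GentlePaths

variable {k : Type u} [Field k] {V : Type v} [Fintype V] [Quiver.{w} V]
  {R : Arrow V → Arrow V → Prop}

/-- A path without relations extends to the right by at most one arrow, so two such paths with a
common leftmost arrow are nested. -/
lemma IsGentle.exists_append_of_leftmost (hR : IsGentle k R) {p q : NPath R}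
    (h : p.leftmost = q.leftmost) :
    p = q ∨ (∃ g : NPath R, p.arrows = q.arrows ++ g.arrows)
      ∨ ∃ g : NPath R, q.arrows = p.arrows ++ g.arrows := by
  obtain ⟨_ | ⟨a, l⟩, hp, hp'⟩ := p
  · exact absurd rfl hp
  obtain ⟨_ | ⟨b, l'⟩, hq, hq'⟩ := q
  · exact absurd rfl hq
  obtain rfl : a = b := h
  rcases exists_append_of_isChain (fun a b c h1 h2 => hR.nonrel_right a ⟨h1.1, h1.2⟩ ⟨h2.1, h2.2⟩)
    a l l' hp' hq' with ⟨m, rfl⟩ | ⟨m, rfl⟩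
  · rcases eq_or_ne m [] with rfl | hm
    · exact Or.inl (NPath.ext_arrows (by simp))
    · exact Or.inr (Or.inr ⟨⟨m, hm, (List.isChain_append.1 (show List.IsChain _ ((a :: l) ++ m) from hq')).2.1⟩, rfl⟩)
  · rcases eq_or_ne m [] with rfl | hm
    · exact Or.inl (NPath.ext_arrows (by simp))
    · exact Or.inr (Or.inl ⟨⟨m, hm, (List.isChain_append.1 (show List.IsChain _ ((a :: l') ++ m) from hp')).2.1⟩, rfl⟩)

lemma IsGentle.exists_append_of_rightmost (hR : IsGentle k R) {p q : NPath R}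
    (h : p.rightmost = q.rightmost) :
    p = q ∨ (∃ g : NPath R, p.arrows = g.arrows ++ q.arrows)
      ∨ ∃ g : NPath R, q.arrows = g.arrows ++ p.arrows := by
  have key : (∃ m, q.arrows = m ++ p.arrows) ∨ ∃ m, p.arrows = m ++ q.arrows := by
    have hp := p.noRel
    have hq := q.noRel
    unfold NPath.rightmost at h
    rw [← List.dropLast_append_getLast p.ne, NoRel, ← List.isChain_reverse] at hp
    rw [← List.dropLast_append_getLast q.ne, ← h, NoRel, ← List.isChain_reverse] at hq
    rw [List.reverse_append, List.reverse_singleton, List.singleton_append] at hp hq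
    rcases exists_append_of_isChain (fun a b c h1 h2 => hR.nonrel_left a ⟨h1.1, h1.2⟩ ⟨h2.1, h2.2⟩)
      _ _ _ hp hq with ⟨m, hm⟩ | ⟨m, hm⟩
    · refine Or.inl ⟨m.reverse, ?_⟩
      rw [← List.dropLast_append_getLast p.ne, ← List.dropLast_append_getLast q.ne, ← h,
        ← List.append_assoc]
      congr 1
      have := congrArg List.reverse hm
      simpa using this
    · refine Or.inr ⟨m.reverse, ?_⟩
      rw [← List.dropLast_append_getLast p.ne, ← List.dropLast_append_getLast q.ne, ← h,
        ← List.append_assoc]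
      congr 1
      have := congrArg List.reverse hm
      simpa using this
  rcases key with ⟨m, hm⟩ | ⟨m, hm⟩
  · rcases eq_or_ne m [] with rfl | h0
    · exact Or.inl (NPath.ext_arrows hm.symm)
    · have := q.noRel
      rw [hm, NoRel, List.isChain_append] at this
      exact Or.inr (Or.inr ⟨⟨m, h0, this.1⟩, hm⟩)
  · rcases eq_or_ne m [] with rfl | h0
    · exact Or.inl (NPath.ext_arrows hm)
    · have := p.noRel
      rw [hm, NoRel, List.isChain_append] at this
      exact Or.inr (Or.inl ⟨⟨m, h0, this.1⟩, hm⟩)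

lemma IsGentle.rel_of_ne_left (hR : IsGentle k R) {a b c : Arrow V} (h1 : b.left = a.right)
    (h2 : ¬ R b a) (h3 : c.left = a.right) (h4 : b ≠ c) : R c a := by
  by_contra h
  exact h4 (hR.nonrel_left a ⟨h1, h2⟩ ⟨h3, h⟩)

lemma IsGentle.rel_of_ne_right (hR : IsGentle k R) {a b c : Arrow V} (h1 : a.left = b.right)
    (h2 : ¬ R a b) (h3 : a.left = c.right) (h4 : b ≠ c) : R a c := by
  by_contra h
  exact h4 (hR.nonrel_right a ⟨h1, h2⟩ ⟨h3, h⟩)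

lemma eq_of_encard_le_two {α : Type*} {X : Set α} (h : X.encard ≤ 2) {a b c : α} (ha : a ∈ X)
    (hb : b ∈ X) (hc : c ∈ X) (hab : a ≠ b) (hac : a ≠ c) : b = c := by
  by_contra hbc
  have h1 : ({a, b, c} : Set α).encard = 3 := Set.encard_eq_three.2 ⟨a, b, c, hab, hac, hbc, rfl⟩
  have h2 : ({a, b, c} : Set α).encard ≤ X.encard := by
    apply Set.encard_le_encard
    rintro x (rfl | rfl | rfl) <;> assumption
  rw [h1] at h2
  exact absurd (h2.trans h) (by norm_num)

lemma pathElt_append (p q : List (Arrow V)) :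
    pathElt k R (p ++ q) = pathElt k R p * pathElt k R q := by
  unfold pathElt
  rw [List.map_append, List.prod_append]

/-- Two letters with the same left endpoint that start in the same way: they are both direct and
start with the same arrow, or both inverse and start with the same inverse arrow, or of different
direction. -/
def SameStart : Letter R → Letter R → Prop
  | .dir p, .dir q => p.leftmost = q.leftmost
  | .inv p, .inv q => p.rightmost = q.rightmost
  | _, _ => True

/-- If the direction is kept after `l`, the next arrow is determined by a relation. If it changes,
the next arrow is the other one of at most two arrows at the vertex. -/
lemma IsGentle.sameStart_of_adjacent (hR : IsGentle k R) {l a b : Letter R} (ha : Adjacent l a)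
    (hb : Adjacent l b) : SameStart a b := by
  rcases a with p | p <;> rcases b with q | q <;> try trivial
  · rcases l with g | g
    · exact hR.rel_right _ ha.2 hb.2
    · exact eq_of_encard_le_two (hR.ends g.tgt) (a := g.leftmost) rfl ha.1.symm hb.1.symm ha.2 hb.2
  · rcases l with g | g
    · exact eq_of_encard_le_two (hR.starts g.src) (a := g.rightmost) rfl ha.1.symm hb.1.symm ha.2
        hb.2
    · exact hR.rel_left _ ha.2 hb.2

/-- A direct letter after τ_C⁻¹ starts with an arrow other than that of τ_C. As σ_C τ_C has no
relation, this other arrow has a relation with σ_C, as does a direct letter after σ_C. Inverse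
letters are dual. -/
lemma IsGentle.sameStart_of_noRel (hR : IsGentle k R) {σC τC : NPath R}
    (h : NoRel R (σC.arrows ++ τC.arrows)) {a b : Letter R} (ha : Adjacent (.dir σC) a)
    (hb : Adjacent (.inv τC) b) : SameStart a b := by
  obtain ⟨h1, h2⟩ := noRel_junction h
  rcases a with p | p <;> rcases b with q | q <;> try trivial
  · exact hR.rel_right _ ha.2 (hR.rel_of_ne_right h1 h2 (h1.trans hb.1) hb.2)
  · exact hR.rel_left _ (hR.rel_of_ne_left h1 h2 (ha.1.symm.trans h1) ha.2) hb.2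

/-- The element `x` continues an overlap across the letters `a` and `b`, and ends it. -/
structure Fits (a b : Letter R) (x : Alg k R) : Prop where
  dirEdge : b.dirElt k * x = a.dirElt k
  invEdge : b.invElt k = x * a.invElt k
  idem : x * idem k R a.right = x
  sign : x ≠ 0 → a.sign = b.sign
  nextInv : ∀ b', Adjacent b b' → b'.invElt k * x = 0
  nextDir : ∀ a', Adjacent a a' → x * a'.dirElt k = 0

/-- The correction is the end piece `g` by which `p` exceeds `q`. It is killed on the left by an
inverse letter after `q`, since only one arrow composes with `g` without a relation and `q` uses it,
and on the right by the relation between `p` and the next direct letter. -/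
lemma IsGentle.fits_dir (hR : IsGentle k R) {p q g : NPath R}
    (h : p.arrows = q.arrows ++ g.arrows) :
    Fits (.dir p) (.dir q) (pathElt k R g.arrows) := by
  have hj := noRel_junction (by rw [← h]; exact p.noRel : NoRel R (q.arrows ++ g.arrows))
  have hr := NPath.rightmost_of_append h
  refine ⟨?_, ?_, ?_, fun _ => rfl, ?_, ?_⟩
  · exact (pathElt_append _ _).symm.trans (by rw [← h]; rfl)
  · simp [Letter.invElt]
  · have : (Letter.dir p).right = g.src := by
      change p.rightmost.left = g.rightmost.left
      rw [hr]
    rw [this, pathElt_mul_idem]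
  · rintro (l | l) hb
    · simp [Letter.invElt]
    · exact pathElt_mul_pathElt k (hR.rel_of_ne_left hj.1 hj.2 (hb.1.symm.trans hj.1) hb.2)
  · rintro (l | l) ha
    · exact pathElt_mul_pathElt k (by rw [← hr]; exact ha.2)
    · simp [Letter.dirElt]

lemma IsGentle.fits_inv (hR : IsGentle k R) {p q g : NPath R}
    (h : q.arrows = g.arrows ++ p.arrows) :
    Fits (.inv p) (.inv q) (pathElt k R g.arrows) := by
  have hj := noRel_junction (by rw [← h]; exact q.noRel : NoRel R (g.arrows ++ p.arrows))
  have hr := NPath.leftmost_of_append h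
  refine ⟨?_, ?_, ?_, fun _ => rfl, ?_, ?_⟩
  · simp [Letter.dirElt]
  · exact (pathElt_append _ _).symm.trans (by rw [← h]; rfl) |>.symm
  · have : (Letter.inv p).right = g.src := hj.1.symm
    rw [this, pathElt_mul_idem]
  · rintro (l | l) hb
    · simp [Letter.invElt]
    · exact pathElt_mul_pathElt k (by rw [← hr]; exact hb.2)
  · rintro (l | l) ha
    · exact pathElt_mul_pathElt k (hR.rel_of_ne_right hj.1 hj.2 (hj.1.trans ha.1) ha.2)
    · simp [Letter.dirElt]

/-- An inverse letter against a direct one: the conditions at this edge already hold with zero, so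
the overlap stops without a correction. -/
lemma fits_zero (p q : NPath R) : Fits (k := k) (.inv p) (.dir q) 0 := by
  refine ⟨?_, ?_, ?_, fun h => absurd rfl h, ?_, ?_⟩ <;> simp [Letter.dirElt, Letter.invElt]

/-- The crucial dichotomy: for the first distinct letters of σ and τ, one order yields the change of
basis and the other a null-homotopy. -/
lemma IsGentle.exists_fits (hR : IsGentle k R) {a b : Letter R} (hab : a ≠ b)
    (h : SameStart a b) : (∃ x : Alg k R, Fits a b x) ∨ ∃ x : Alg k R, Fits b a x := by
  rcases a with p | p <;> rcases b with q | q
  · rcases hR.exists_append_of_leftmost h with rfl | ⟨g, hg⟩ | ⟨g, hg⟩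
    · exact absurd rfl hab
    · exact Or.inl ⟨_, hR.fits_dir hg⟩
    · exact Or.inr ⟨_, hR.fits_dir hg⟩
  · exact Or.inr ⟨0, fits_zero _ _⟩
  · exact Or.inl ⟨0, fits_zero _ _⟩
  · rcases hR.exists_append_of_rightmost h with rfl | ⟨g, hg⟩ | ⟨g, hg⟩
    · exact absurd rfl hab
    · exact Or.inr ⟨_, hR.fits_inv hg⟩
    · exact Or.inl ⟨_, hR.fits_inv hg⟩

/-- Two periodic sequences with different last terms of the periods differ early. -/
lemma exists_first_ne {α : Type*} {S T : ℕ} (hS : 0 < S) (hT : 0 < T) {s t : ℕ → α}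
    (hs : ∀ m, s (m + S) = s m) (ht : ∀ m, t (m + T) = t m) (h : s (S - 1) ≠ t (T - 1)) :
    ∃ M < S + T, s M ≠ t M ∧ ∀ m < M, s m = t m := by
  classical
  have hex : ∃ M, M < S + T ∧ s M ≠ t M := by
    by_contra hcon
    push Not at hcon
    have h1 : ∀ m, s (m + T) = s m := by
      intro m
      induction m using Nat.strong_induction_on with
      | _ m ih =>
      rcases Nat.lt_or_ge m S with h2 | h2
      · rw [hcon _ (by omega), ht, hcon _ (by omega)]
      · obtain ⟨n, rfl⟩ : ∃ n, m = n + S := ⟨m - S, by omega⟩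
        rw [add_right_comm, hs, hs, ih n (by omega)]
    have h2 : ∀ n m, s (m + n * S) = s m := by
      intro n
      induction n with
      | zero => simp
      | succ n ih => intro m; rw [add_mul, one_mul, ← add_assoc, hs, ih]
    have h3 : ∀ n m, s (m + n * T) = s m := by
      intro n
      induction n with
      | zero => simp
      | succ n ih => intro m; rw [add_mul, one_mul, ← add_assoc, h1, ih]
    apply h
    -- Agreement on `S + T` terms makes `s` periodic with both periods, and `S * T - 1` can be
    -- reached from `S - 1` in steps of `S` and from `T - 1` in steps of `T`.
    rw [← hcon (T - 1) (by omega), ← h2 (T - 1), ← h3 (S - 1) (T - 1)]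
    congr 1
    obtain ⟨S, rfl⟩ : ∃ n, S = n + 1 := ⟨S - 1, by omega⟩
    obtain ⟨T, rfl⟩ : ∃ n, T = n + 1 := ⟨T - 1, by omega⟩
    simp only [Nat.add_sub_cancel]
    ring
  obtain ⟨h1, h2⟩ := Nat.find_spec hex
  refine ⟨Nat.find hex, h1, h2, fun m hm => ?_⟩
  by_contra h3
  exact Nat.find_min hex hm ⟨by omega, h3⟩

end GentlePaths

/-! ### The concatenated word -/

section Words

variable {V : Type v} [Quiver.{w} V] {R : Arrow V → Arrow V → Prop}

/-- The letters of a cyclic word, starting to the right of the letter `l`. -/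
lemma get_forward {s x y : List (Letter R)} {l : Letter R} (h : s = x ++ l :: y)
    (p : Fin s.length) (hp : (p : ℕ) = x.length) (m : ℕ) (hm : m < s.length) :
    s.get (((finRotate _) ^ m) (finRotate _ p)) = ((y ++ x) ++ [l])[m]'(by
      rw [h] at hm; simp at hm ⊢; omega) := by
  have h1 : s.rotate (x.length + 1) = (y ++ x) ++ [l] := by
    have : s = (x ++ [l]) ++ y := by rw [h]; simp
    rw [this, show x.length + 1 = (x ++ [l]).length by simp, List.rotate_append_length_eq,
      List.append_assoc]
  have h2 : ∀ (w : List (Letter R)) (hw : s.rotate (x.length + 1) = w) (hm' : m < w.length),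
      w[m] = s.get (((finRotate _) ^ m) (finRotate _ p)) := by
    rintro w rfl hm'
    rw [List.getElem_rotate, List.get_eq_getElem]
    congr 1
    rw [← Equiv.Perm.mul_apply, ← pow_succ, val_finRotate_pow, hp]
    congr 1
    omega
  exact (h2 _ h1 _).symm

/-- The inverse letters of a cyclic word, starting to the left of the letter `l`. -/
lemma get_backward {s x y : List (Letter R)} {l : Letter R} (h : s = x ++ l :: y)
    (p : Fin s.length) (hp : (p : ℕ) = x.length) (m : ℕ) (hm : m < s.length) :
    (s.get (((finRotate _)⁻¹ ^ (m + 1)) p)).bar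
      = ((barWord x ++ barWord y) ++ [l.bar])[m]'(by
      rw [h] at hm; simp [barWord] at hm ⊢; omega) := by
  have hlen : s.length = x.length + y.length + 1 := by rw [h]; simp; omega
  -- A backward walk is the complementary forward walk, here started one position to the right of
  -- `p`. The last step, which returns to `l`, is treated separately.
  have hper : ∀ m, m + 1 < s.length → ((finRotate s.length)⁻¹ ^ (m + 1)) p
      = ((finRotate _) ^ (s.length - 2 - m)) (finRotate _ p) := by
    intro m hm
    rw [inv_pow, Equiv.Perm.inv_eq_iff_eq, ← Equiv.Perm.mul_apply, ← Equiv.Perm.mul_apply,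
      mul_assoc, ← pow_succ, ← pow_add, show m + 1 + (s.length - 2 - m + 1) = s.length by omega,
      finRotate_pow_length, Equiv.Perm.one_apply]
  have hbar : barWord x ++ barWord y = ((y ++ x).map Letter.bar).reverse := by
    simp [barWord]
  simp only [hbar]
  rcases Nat.lt_or_ge (m + 1) s.length with h1 | h1
  · rw [hper m h1, get_forward h p hp _ (by omega)]
    rw [List.getElem_append_left (by simp; omega),
      List.getElem_append_left (as := ((y ++ x).map Letter.bar).reverse) (by simp; omega),
      List.getElem_reverse, List.getElem_map]
    congr 2
    simp
    omega
  · have h2 : m + 1 = s.length := by omega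
    rw [h2, inv_pow, finRotate_pow_length, inv_one, Equiv.Perm.one_apply,
      List.getElem_append_right (by simp; omega)]
    simp only [List.getElem_singleton]
    congr 1
    subst h
    rw [List.get_eq_getElem, List.getElem_append_right (by omega)]
    simp [hp]

lemma Adjacent.congr_dir {l : Letter R} {p q : NPath R} (h : Adjacent l (.dir p))
    (e : p.leftmost = q.leftmost) : Adjacent l (.dir q) := by
  rcases l with g | g
  · exact ⟨by rw [h.1, NPath.tgt, e]; rfl, by rw [← e]; exact h.2⟩
  · exact ⟨by rw [h.1, NPath.tgt, e]; rfl, by rw [← e]; exact h.2⟩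

lemma Adjacent.congr_inv {l : Letter R} {p q : NPath R} (h : Adjacent l (.inv p))
    (e : p.rightmost = q.rightmost) : Adjacent l (.inv q) := by
  rcases l with g | g
  · exact ⟨by rw [h.1, NPath.src, e]; rfl, by rw [← e]; exact h.2⟩
  · exact ⟨by rw [h.1, NPath.src, e]; rfl, by rw [← e]; exact h.2⟩

lemma countP_barWord (s : List (Letter R)) :
    (barWord s).countP Letter.isDir = s.countP (fun l => !l.isDir) ∧
    (barWord s).countP (fun l => !l.isDir) = s.countP Letter.isDir := by
  unfold barWord
  rw [List.countP_reverse, List.countP_map, List.countP_reverse, List.countP_map]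
  constructor <;> congr 1 <;> funext l <;> cases l <;> rfl

lemma deg_of_val_eq_zero (s : List (Letter R)) (a : ℤ) (i : Fin s.length) (h : (i : ℕ) = 0) :
    deg s a i = a := by
  simp [deg, h]

end Words

/-! ### New junctions, and the scalar acquired in one turn -/

section GentleWords

variable {k : Type u} [Field k] {V : Type v} [Quiver.{w} V]
  {R : Arrow V → Arrow V → Prop}

/-- Since `p q` has no relation, a letter that may follow `q⁻¹` may also follow `p`. With `p = f_L`
and `q = τ_C` this is the junction of `c` after `f_L`. -/
lemma IsGentle.adjacent_dir [Fintype V] (hR : IsGentle k R) {p q : NPath R}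
    (h : NoRel R (p.arrows ++ q.arrows)) {l : Letter R} (hl : Adjacent (.inv q) l) :
    Adjacent (.dir p) l := by
  obtain ⟨h1, h2⟩ := noRel_junction h
  rcases l with g | g
  · exact ⟨h1.trans hl.1, hR.rel_of_ne_right h1 h2 (h1.trans hl.1) hl.2⟩
  · exact ⟨h1.trans hl.1, fun e => h2 (by rw [e]; exact hl.2)⟩

lemma IsGentle.adjacent_inv [Fintype V] (hR : IsGentle k R) {p q : NPath R}
    (h : NoRel R (p.arrows ++ q.arrows)) {l : Letter R} (hl : Adjacent (.dir p) l) :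
    Adjacent (.inv q) l := by
  obtain ⟨h1, h2⟩ := noRel_junction h
  rcases l with g | g
  · exact ⟨h1.symm.trans hl.1, fun e => h2 (by rw [e]; exact hl.2)⟩
  · exact ⟨h1.symm.trans hl.1, hR.rel_of_ne_left h1 h2 (hl.1.symm.trans h1) hl.2⟩

lemma gauge_eq_prod (e a : kˣ) (L : ℕ → Letter R) (x : ℕ → kˣ) (n : ℕ) :
    gauge e a L x n
      = a * ∏ m ∈ Finset.range n, if (L m).isDir then e * x m else (e * x m)⁻¹ := by
  induction n with
  | zero => simp [gauge]
  | succ n ih => rw [gauge, ih, Finset.prod_range_succ, mul_assoc]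

lemma Unrolling.prod_pos [Fintype V] {s : List (Letter R)} {c : kˣ} {r : Fin s.length}
    {pos : ℕ → Fin s.length} {L : ℕ → Letter R} {x : ℕ → kˣ} (U : Unrolling s c r pos L x)
    {G : Type*} [CommMonoid G] (F : Fin s.length → G) :
    ∏ m ∈ Finset.range s.length, F (pos m) = ∏ i, F i := by
  refine Finset.prod_bij (fun m _ => pos m) (fun _ _ => Finset.mem_univ _) ?_ ?_
    (fun _ _ => rfl)
  · intro m hm m' hm' h
    rw [Finset.mem_range] at hm hm'
    rw [← U.idx_pos hm, h, U.idx_pos hm']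
  · intro i _
    exact ⟨U.idx i, Finset.mem_range.2 (U.idx_lt i), U.pos_idx i⟩

/-- The signs `e` cancel because the word is balanced, and `c` enters with exponent one because it
is placed on a direct letter. Its place is otherwise irrelevant. -/
lemma prod_scal {s : List (Letter R)} (hs : IsBandWord s) (c e : kˣ) (r : Fin s.length)
    (hr : (s.get r).isDir = true) :
    ∏ i, (if (s.get i).isDir then e * scal c r i else (e * scal c r i)⁻¹) = c := by
  have h1 : ∀ i, (if (s.get i).isDir then e * scal c r i else (e * scal c r i)⁻¹)
      = (if (s.get i).isDir then e else e⁻¹) * if i = r then c else 1 := by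
    intro i
    by_cases h : i = r
    · subst h
      simp only [hr, scal, if_true]
    · simp only [scal, h, if_false, mul_one]
  rw [Finset.prod_congr rfl fun i _ => h1 i, Finset.prod_mul_distrib, Finset.prod_ite_eq',
    if_pos (Finset.mem_univ _)]
  have h2 : ∀ w : List (Letter R), ∏ i : Fin w.length, (if (w.get i).isDir then e else e⁻¹)
      = e ^ w.countP Letter.isDir * (e⁻¹) ^ w.countP (fun l => !l.isDir) := by
    intro w
    induction w with
    | nil => simp
    | cons l w ih =>
      have : ∏ i : Fin (l :: w).length, (if ((l :: w).get i).isDir then e else e⁻¹)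
          = (if l.isDir then e else e⁻¹) * ∏ i : Fin w.length, (if (w.get i).isDir then e else e⁻¹) :=
        Fin.prod_univ_succ _
      rw [this, ih, List.countP_cons, List.countP_cons]
      cases l.isDir
      · simp only [Bool.not_false, if_true, Bool.false_eq_true, if_false, add_zero, pow_succ]
        rw [mul_left_comm, mul_comm (e⁻¹ ^ _)]
      · simp only [Bool.not_true, if_true, Bool.false_eq_true, if_false, add_zero, pow_succ]
        rw [← mul_assoc, mul_comm e]
  rw [h2, ← hs.balanced, inv_pow, mul_inv_cancel, one_mul]

lemma gauge_forward [Fintype V] {s : List (Letter R)} (hs : IsBandWord s) (c e a : kˣ) (r p : Fin s.length)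
    (hr : (s.get r).isDir = true) :
    gauge e a (fun m => s.get (((finRotate _) ^ m) p)) (fun m => scal c r (((finRotate _) ^ m) p))
      s.length = a * c := by
  rw [gauge_eq_prod, (unrolling_forward hs c r p).prod_pos
    (fun i => if (s.get i).isDir then e * scal c r i else (e * scal c r i)⁻¹), prod_scal hs c e r hr]

lemma gauge_backward [Fintype V] {s : List (Letter R)} (hs : IsBandWord s) (c e a : kˣ) (r p : Fin s.length)
    (hr : (s.get r).isDir = true) :
    gauge e a (fun m => (s.get (((finRotate _)⁻¹ ^ (m + 1)) p)).bar)
      (fun m => scal c r (((finRotate _)⁻¹ ^ (m + 1)) p)) s.length = a * c⁻¹ := by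
  have U := unrolling_backward hs c r p
  let F : Fin s.length → kˣ := fun i =>
    (if (s.get i).isDir then e * scal c r i else (e * scal c r i)⁻¹)⁻¹
  -- Letters are shifted by one against positions; over a full period the product does not change.
  have h1 : ∏ m ∈ Finset.range s.length, F (((finRotate _)⁻¹ ^ (m + 1)) p)
      = ∏ m ∈ Finset.range s.length, F (((finRotate _)⁻¹ ^ m) p) := by
    have h2 := Finset.prod_range_succ' (fun m => F (((finRotate _)⁻¹ ^ m) p)) s.length
    rw [Finset.prod_range_succ] at h2
    have h3 := U.pos_add 0
    rw [zero_add] at h3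
    rw [h3] at h2
    exact (mul_right_cancel h2).symm
  have h4 : ∀ i, (if ((s.get i).bar).isDir then e * scal c r i else (e * scal c r i)⁻¹) = F i := by
    intro i
    simp only [F, Letter.isDir_bar]
    cases (s.get i).isDir <;> simp
  rw [gauge_eq_prod]
  simp only [h4]
  rw [h1, U.prod_pos F, Finset.prod_inv_distrib, prod_scal hs c e r hr]

end GentleWords

/-! ### Overlaps at a double map -/

section Overlaps

variable {k : Type u} [Field k] {V : Type v} [Fintype V] [Quiver.{w} V]
  {R : Arrow V → Arrow V → Prop}
    {s t c : List (Letter R)} {lam mu κ : kˣ} {r : Fin s.length} {q : Fin t.length}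
    {p : Fin c.length}
    {ps : ℕ → Fin s.length} {Ls : ℕ → Letter R} {xs : ℕ → kˣ}
    {pt : ℕ → Fin t.length} {Lt : ℕ → Letter R} {xt : ℕ → kˣ}
    {pc : ℕ → Fin c.length} {Lc : ℕ → Letter R} {xc : ℕ → kˣ}
    {σC τC fL fR : NPath R} {y z : kˣ} {a b a' : ℤ}

lemma Unrolling.adj_zero {L : ℕ → Letter R} {x : ℕ → kˣ} {pos : ℕ → Fin s.length}
    (U : Unrolling s κ r pos L x) {l : Letter R} (h : L (s.length - 1) = l) :
    Adjacent l (L 0) := by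
  have h1 := U.adj (s.length - 1)
  have hp := (pos 0).pos
  rw [Nat.sub_add_cancel hp, h] at h1
  have h2 := U.L_add 0
  rw [zero_add] at h2
  rwa [h2] at h1

lemma Unrolling.left_succ {L : ℕ → Letter R} {x : ℕ → kˣ} {pos : ℕ → Fin s.length}
    (U : Unrolling s κ r pos L x) (m : ℕ) : (L (m + 1)).left = (L m).right :=
  (U.adj m).right_eq_left.symm

/-- Crossing σ_C in σ and `f_L` in `c` both raise the degree by one, and `c` runs one degree below
σ. Comparing degrees across these letters gives the claim. -/
lemma JoinData.deg_zero
    (d : JoinData s t c lam mu κ r q p ps Ls xs pt Lt xt pc Lc xc σC τC fL fR y z a b a') :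
    deg t b (pt 0) = deg c a' (pc 0) := by
  have hS := d.hS
  have hT := d.hT
  have h1 := d.deg₂ 0 (by omega)
  have h2 := d.deg₁ 0 (by omega)
  have h3 := d.deg₁ (s.length - 1) (by omega)
  have h4 := d.us.deg a (s.length - 1)
  have h5 := d.uc.deg a' (s.length - 1)
  have h6 := d.us.pos_add 0
  rw [zero_add] at h6
  rw [Nat.sub_add_cancel (by omega), d.Ls_last, h6] at h4
  rw [Nat.sub_add_cancel (by omega), d.Lc₂] at h5
  rw [add_zero] at h1
  have h7 : ∀ g : NPath R, (Letter.dir g).sign = 1 := fun _ => rfl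
  rw [h7] at h4 h5
  omega

/-- The two components of the double map overlap in a path. -/
lemma JoinData.concatData_of_append
    (d : JoinData s t c lam mu κ r q p ps Ls xs pt Lt xt pc Lc xc σC τC fL fR y z a b a')
    {g : NPath R} (hσ : σC.arrows = fL.arrows ++ g.arrows)
    (hτ : τC.arrows = g.arrows ++ fR.arrows) :
    ConcatData s t c lam mu κ r q p ps Ls xs pt Lt xt pc Lc xc σC τC fL fR y z a b a' 0
      (fun m => if m = 0 then pathElt k R g.arrows else 0) := by
  have hS := d.hS
  have hT := d.hT
  have hN := d.length
  have hr := NPath.rightmost_of_append hσ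
  have hl := NPath.leftmost_of_append hτ
  have hs0 := d.us.adj_zero d.Ls_last
  have ht0 := d.ut.adj_zero d.Lt_last
  have hLc : Lc 0 = Ls 0 := d.Lc₁ 0 (by omega)
  exact {
    toJoinData := d
    ε_one := fun m h => absurd h (Nat.not_lt_zero m)
    ε_zero := fun m h => if_neg (by omega)
    ε_length := if_neg (by omega)
    ε_left := fun m h => absurd h (Nat.not_lt_zero m)
    ε_top := fun _ => by
      have : (Lc 0).left = g.src := by
        rw [hLc, ← hs0.right_eq_left]
        exact congrArg Quiver.Total.left hr
      rw [if_pos rfl, this, pathElt_mul_idem]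
    ε_deg := fun m _ h => by
      by_cases hm : m = 0
      · rw [hm]
        exact d.deg_zero
      · exact absurd (if_neg hm) h
    mulL := by rw [if_pos rfl, ← pathElt_append, hσ]
    mulR := by rw [if_pos rfl, ← pathElt_append, hτ]
    dirEdge := fun m _ => by
      rw [if_neg (Nat.succ_ne_zero m), mul_zero]
      split_ifs with hm
      · rw [hm, hLc]
        rcases h : Ls 0 with l | l
        · rw [h] at hs0
          exact (pathElt_mul_pathElt k (hr ▸ hs0.2)).symm
        · exact (mul_zero _).symm
      · exact (zero_mul _).symm
    invEdge := fun m _ => by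
      rw [if_neg (Nat.succ_ne_zero m), zero_mul]
      split_ifs with hm
      · rw [hm]
        rcases h : Lt 0 with l | l
        · exact zero_mul _
        · rw [h] at ht0
          exact pathElt_mul_pathElt k (hl ▸ ht0.2)
      · exact mul_zero _
    overlap := Or.inl rfl }

/-- The components of the double map factor through a map of degree `-1`. -/
lemma JoinData.nonempty_homotopy_of_append (hR : IsGentle k R)
    (d : JoinData s t c lam mu κ r q p ps Ls xs pt Lt xt pc Lc xc σC τC fL fR y z a b a')
    {h : NPath R} (hL : fL.arrows = σC.arrows ++ h.arrows)
    (hRt : fR.arrows = h.arrows ++ τC.arrows)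
    (hs : IsBandWord s) (ht : IsBandWord t) (φ : bandComplex hs lam r a ⟶ bandComplex ht mu q b)
    (hφ : ∀ n (f : piece k s a n), (show piece k t b n from (φ.f n).hom f).1 = Matrix.vecMul f.1
      (doubleMatrix (ps (s.length - 1)) (ps 0) (pt 0) (pt (t.length - 1)) y z fL fR)) :
    Nonempty (Homotopy φ 0) := by
  have hS := d.hS
  have hdeg := d.deg₁ 0 (by omega)
  have hs0 := d.us.adj_zero d.Ls_last
  have ht0 := d.ut.adj_zero d.Lt_last
  obtain ⟨j1, j2⟩ := noRel_junction (by rw [← hL]; exact fL.noRel)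
  obtain ⟨j3, j4⟩ := noRel_junction (by rw [← hRt]; exact fR.noRel)
  refine d.nonempty_homotopy (θ := fun m => if m = 0 then pathElt k R h.arrows else 0) (K := 0)
    ?_ ?_ ?_ ?_ rfl ?_ ?_ hs ht φ hφ
  · rw [if_pos rfl, ← pathElt_append, hL]
  · rw [if_pos rfl, ← pathElt_append, hRt]
  · intro m
    rw [if_neg (Nat.succ_ne_zero m), mul_zero]
    split_ifs with hm
    · rw [hm]
      rcases e : Lt 0 with l | l
      · rw [e] at ht0
        exact (pathElt_mul_pathElt k (hR.rel_of_ne_right j3 j4 (j3.trans ht0.1) ht0.2)).symm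
      · exact (mul_zero _).symm
    · exact (zero_mul _).symm
  · intro m
    rw [if_neg (Nat.succ_ne_zero m), zero_mul]
    split_ifs with hm
    · rw [hm]
      rcases e : Ls 0 with l | l
      · exact zero_mul _
      · rw [e] at hs0
        exact pathElt_mul_pathElt k (hR.rel_of_ne_left j1 j2 (hs0.1.symm.trans j1) hs0.2)
    · exact mul_zero _
  · intro m hm
    by_cases h0 : m = 0
    · rw [h0, d.deg_zero, hdeg]
      ring
    · exact absurd (if_neg h0) hm
  · intro m x _
    split_ifs with h0
    · have : (Lt m).left = h.src := by
        rw [h0, ← ht0.right_eq_left]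
        exact j3.symm
      rw [this, mul_assoc, pathElt_mul_idem]
    · rw [mul_zero, zero_mul]

section Common

variable {M : ℕ}

lemma JoinData.sameStart (hR : IsGentle k R)
    (d : JoinData s t c lam mu κ r q p ps Ls xs pt Lt xt pc Lc xc σC τC fL fR y z a b a')
    (h : NoRel R (σC.arrows ++ τC.arrows)) (hM : ∀ m < M, Ls m = Lt m) :
    SameStart (Ls M) (Lt M) := by
  cases M with
  | zero => exact hR.sameStart_of_noRel h (d.us.adj_zero d.Ls_last) (d.ut.adj_zero d.Lt_last)
  | succ M =>
    refine hR.sameStart_of_adjacent (d.us.adj M) ?_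
    rw [hM M (Nat.lt_succ_self M)]
    exact d.ut.adj M

lemma JoinData.left_eq
    (d : JoinData s t c lam mu κ r q p ps Ls xs pt Lt xt pc Lc xc σC τC fL fR y z a b a')
    (h : NoRel R (σC.arrows ++ τC.arrows)) (hM : ∀ m < M, Ls m = Lt m) (m : ℕ) (hm : m ≤ M) :
    (Lt m).left = (Ls m).left := by
  cases m with
  | zero =>
    rw [← (d.us.adj_zero d.Ls_last).right_eq_left, ← (d.ut.adj_zero d.Lt_last).right_eq_left]
    exact (noRel_junction h).1.symm
  | succ m => rw [d.us.left_succ, d.ut.left_succ, hM m hm]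

lemma JoinData.deg_eq
    (d : JoinData s t c lam mu κ r q p ps Ls xs pt Lt xt pc Lc xc σC τC fL fR y z a b a')
    (hM : ∀ m < M, Ls m = Lt m) (m : ℕ) (hm : m ≤ M) :
    deg s a (ps m) = deg t b (pt m) + 1 := by
  have hS := d.hS
  induction m with
  | zero =>
    rw [d.deg_zero, d.deg₁ 0 (by omega)]
    ring
  | succ m ih => rw [d.us.deg, d.ut.deg, ih (by omega), hM m hm, add_right_comm]

/-- During the overlap `c` continues like σ even after one turn: the letters that it then takes from
τ are those of σ by agreement. -/
lemma JoinData.letter_eq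
    (d : JoinData s t c lam mu κ r q p ps Ls xs pt Lt xt pc Lc xc σC τC fL fR y z a b a')
    (hL : fL = σC) (hRt : fR = τC) (hM : ∀ m < M, Ls m = Lt m) (m : ℕ) (hm : m ≤ M)
    (hmc : m < c.length) : Lc m = Ls m := by
  have hS := d.hS
  have hT := d.hT
  have hN := d.length
  rcases Nat.lt_trichotomy m (s.length - 1) with h | h | h
  · exact d.Lc₁ m h
  · rw [h, d.Lc₂, d.Ls_last, hL]
  · obtain ⟨n, rfl⟩ : ∃ n, m = s.length + n := ⟨m - s.length, by omega⟩
    rw [add_comm s.length n, d.us.L_add, hM n (by omega), add_comm n]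
    rcases Nat.lt_or_ge n (t.length - 1) with h' | h'
    · exact d.Lc₃ n h'
    · obtain rfl : n = t.length - 1 := by omega
      rw [← Nat.add_sub_assoc (by omega), d.Lc₄, d.Lt_last, hRt]

lemma JoinData.deg_eq'
    (d : JoinData s t c lam mu κ r q p ps Ls xs pt Lt xt pc Lc xc σC τC fL fR y z a b a')
    (hL : fL = σC) (hRt : fR = τC) (hM : ∀ m < M, Ls m = Lt m) (m : ℕ) (hm : m ≤ M + 1)
    (hmc : m < c.length) : deg s a (ps m) = deg c a' (pc m) + 1 := by
  have hS := d.hS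
  induction m with
  | zero =>
    rw [d.deg₁ 0 (by omega)]
    ring
  | succ m ih =>
    rw [d.us.deg, d.uc.deg, ih (by omega) (by omega),
      d.letter_eq hL hRt hM m (by omega) (by omega), add_right_comm]

/-- Identities up to the first difference `M`, then the stopping element at `M + 1`. By `letter_eq`
the comparison of τ with σ is also one of τ with `c`. -/
lemma JoinData.concatData_of_fits
    (d : JoinData s t c lam mu κ r q p ps Ls xs pt Lt xt pc Lc xc σC τC fL fR y z a b a')
    (h : NoRel R (σC.arrows ++ τC.arrows))
    (hL : fL = σC) (hRt : fR = τC) (hM : ∀ m < M, Ls m = Lt m) (hMN : M < s.length + t.length)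
    {x : Alg k R} (hx : Fits (Ls M) (Lt M) x) :
    ConcatData s t c lam mu κ r q p ps Ls xs pt Lt xt pc Lc xc σC τC fL fR y z a b a' (M + 1)
      (fun m => if m ≤ M then 1 else if m = M + 1 then x else 0) := by
  have hS := d.hS
  have hT := d.hT
  have hN := d.length
  have hLc := d.letter_eq hL hRt hM
  have e1 : ∀ {m}, m ≤ M → (if m ≤ M then 1 else if m = M + 1 then x else 0) = 1 :=
    fun h => if_pos h
  have e2 : (if M + 1 ≤ M then 1 else if M + 1 = M + 1 then x else 0) = x := by
    rw [if_neg (by omega), if_pos rfl]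
  have e3 : ∀ {m}, M + 1 < m → (if m ≤ M then 1 else if m = M + 1 then x else 0) = 0 :=
    fun h => by rw [if_neg (by omega), if_neg (by omega)]
  have hdeg : ∀ m ≤ M, m < c.length → deg t b (pt m) = deg c a' (pc m) := by
    intro m hm hmc
    have h1 := d.deg_eq hM m hm
    have h2 := d.deg_eq' hL hRt hM m (by omega) hmc
    omega
  exact {
    toJoinData := d
    ε_one := fun m h _ => e1 (by omega)
    ε_zero := fun m h => e3 h
    ε_length := by
      rcases Nat.lt_or_ge (M + 1) c.length with h1 | h1
      · exact e3 h1
      -- Extreme case: the letters first differ at the very end of `c`. By periodicity they are then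
      -- τ_C⁻¹ and σ_C, of different direction, so the stopping element is zero.
      · have h2 : c.length = M + 1 := by omega
        have h3 : M = s.length - 1 + t.length := by omega
        have h4 : M = t.length - 1 + s.length := by omega
        rw [h2, e2]
        by_contra h5
        have h6 := hx.sign h5
        have h7 : Ls M = .inv τC := by
          rw [h4, d.us.L_add, hM _ (by omega), d.Lt_last]
        have h8 : Lt M = .dir σC := by
          rw [h3, d.ut.L_add, ← hM _ (by omega), d.Ls_last]
        rw [h7, h8] at h6
        exact absurd h6 (by simp [Letter.sign])
    ε_left := fun m hm hmc => by
      rw [hLc m (by omega) hmc]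
      exact d.left_eq h hM m (by omega)
    ε_top := fun hmc => by
      rw [e2, d.uc.left_succ, hLc M le_rfl (by omega)]
      exact hx.idem
    ε_deg := fun m hmc hne => by
      rcases Nat.lt_trichotomy m (M + 1) with hm | rfl | hm
      · exact hdeg m (by omega) hmc
      · rw [e2] at hne
        rw [d.ut.deg, d.uc.deg, hdeg M le_rfl (by omega), hLc M le_rfl (by omega), hx.sign hne]
      · exact absurd (e3 hm) hne
    mulL := by rw [e1 (Nat.zero_le M), mul_one, hL]
    mulR := by rw [e1 (Nat.zero_le M), one_mul, hRt]
    dirEdge := fun m hmc => by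
      rcases Nat.lt_trichotomy m M with hm | rfl | hm
      · rw [e1 (show m + 1 ≤ M by omega), e1 hm.le, hLc m hm.le hmc, hM m hm, mul_one, one_mul]
      · rw [e1 le_rfl, e2, hLc m le_rfl hmc, one_mul]
        exact hx.dirEdge
      · rw [e3 (show M + 1 < m + 1 by omega), mul_zero]
        rcases Nat.lt_or_ge (M + 1) m with hm' | hm'
        · rw [e3 hm', zero_mul]
        · obtain rfl : m = M + 1 := by omega
          rw [e2]
          refine (hx.nextDir _ ?_).symm
          rw [← hLc M le_rfl (by omega)]
          exact d.uc.adj M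
    invEdge := fun m hmc => by
      rcases Nat.lt_trichotomy m M with hm | rfl | hm
      · rw [e1 (show m + 1 ≤ M by omega), e1 hm.le, hLc m hm.le hmc, hM m hm, mul_one, one_mul]
      · rw [e1 le_rfl, e2, hLc m le_rfl hmc, mul_one]
        exact hx.invEdge
      · rw [e3 (show M + 1 < m + 1 by omega), zero_mul]
        rcases Nat.lt_or_ge (M + 1) m with hm' | hm'
        · rw [e3 hm', mul_zero]
        · obtain rfl : m = M + 1 := by omega
          rw [e2]
          exact hx.nextInv _ (d.ut.adj M)
    overlap := Or.inr ⟨by rw [hL], by rw [hRt], fun m hm => hM m (by omega)⟩ }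

/-- The same sequence of identities and stopping element, now from σ to τ and of degree -1. If the
overlap visits a position several times, the contributions add up. -/
lemma JoinData.nonempty_homotopy_of_fits
    (d : JoinData s t c lam mu κ r q p ps Ls xs pt Lt xt pc Lc xc σC τC fL fR y z a b a')
    (h : NoRel R (σC.arrows ++ τC.arrows))
    (hL : fL = σC) (hRt : fR = τC) (hM : ∀ m < M, Ls m = Lt m)
    {x : Alg k R} (hx : Fits (Lt M) (Ls M) x)
    (hs : IsBandWord s) (ht : IsBandWord t) (φ : bandComplex hs lam r a ⟶ bandComplex ht mu q b)
    (hφ : ∀ n (f : piece k s a n), (show piece k t b n from (φ.f n).hom f).1 = Matrix.vecMul f.1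
      (doubleMatrix (ps (s.length - 1)) (ps 0) (pt 0) (pt (t.length - 1)) y z fL fR)) :
    Nonempty (Homotopy φ 0) := by
  have e1 : ∀ {m}, m ≤ M → (if m ≤ M then 1 else if m = M + 1 then x else 0) = 1 :=
    fun h => if_pos h
  have e2 : (if M + 1 ≤ M then 1 else if M + 1 = M + 1 then x else 0) = x := by
    rw [if_neg (by omega), if_pos rfl]
  have e3 : ∀ {m}, M + 1 < m → (if m ≤ M then 1 else if m = M + 1 then x else 0) = 0 :=
    fun h => by rw [if_neg (by omega), if_neg (by omega)]
  refine d.nonempty_homotopy (θ := fun m => if m ≤ M then 1 else if m = M + 1 then x else 0)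
    (K := M + 1) ?_ ?_ ?_ ?_ (e3 (by omega)) ?_ ?_ hs ht φ hφ
  · rw [e1 (Nat.zero_le M), mul_one, hL]
  · rw [e1 (Nat.zero_le M), one_mul, hRt]
  · intro m
    rcases Nat.lt_trichotomy m M with hm | rfl | hm
    · rw [e1 (show m + 1 ≤ M by omega), e1 hm.le, hM m hm, mul_one, one_mul]
    · rw [e1 le_rfl, e2, one_mul]
      exact hx.dirEdge
    · rw [e3 (show M + 1 < m + 1 by omega), mul_zero]
      rcases Nat.lt_or_ge (M + 1) m with hm' | hm'
      · rw [e3 hm', zero_mul]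
      · obtain rfl : m = M + 1 := by omega
        rw [e2]
        exact (hx.nextDir _ (d.ut.adj M)).symm
  · intro m
    rcases Nat.lt_trichotomy m M with hm | rfl | hm
    · rw [e1 (show m + 1 ≤ M by omega), e1 hm.le, hM m hm, mul_one, one_mul]
    · rw [e1 le_rfl, e2, mul_one]
      exact hx.invEdge
    · rw [e3 (show M + 1 < m + 1 by omega), zero_mul]
      rcases Nat.lt_or_ge (M + 1) m with hm' | hm'
      · rw [e3 hm', mul_zero]
      · obtain rfl : m = M + 1 := by omega
        rw [e2]
        exact hx.nextInv _ (d.us.adj M)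
  · intro m hne
    rcases Nat.lt_trichotomy m (M + 1) with hm | rfl | hm
    · exact d.deg_eq hM m (by omega)
    · rw [e2] at hne
      rw [d.us.deg, d.ut.deg, d.deg_eq hM M le_rfl, hx.sign hne, add_right_comm]
    · exact absurd (e3 hm) hne
  · intro m w hw
    rcases Nat.lt_trichotomy m (M + 1) with hm | rfl | hm
    · rw [e1 (by omega), mul_one, d.left_eq h hM m (by omega), hw]
    · rw [e2, mul_assoc, d.ut.left_succ, hx.idem]
    · rw [e3 hm, mul_zero, zero_mul]

end Common

theorem JoinData.nonempty_iso (hR : IsGentle k R)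
    (d : JoinData s t c lam mu κ r q p ps Ls xs pt Lt xt pc Lc xc σC τC fL fR y z a b a')
    (comm : fL.arrows ++ τC.arrows = σC.arrows ++ fR.arrows)
    (noRel : NoRel R (fL.arrows ++ τC.arrows))
    (hs : IsBandWord s) (ht : IsBandWord t) (hc : IsBandWord c)
    (φ : bandComplex hs lam r a ⟶ bandComplex ht mu q b)
    (hφ : ∀ n (f : piece k s a n), (show piece k t b n from (φ.f n).hom f).1 = Matrix.vecMul f.1
      (doubleMatrix (ps (s.length - 1)) (ps 0) (pt 0) (pt (t.length - 1)) y z fL fR))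
    (hne : ¬ Nonempty (Homotopy φ 0)) :
    Nonempty (CochainComplex.mappingCone φ ≅ bandComplex hc κ p a') := by
  have hfin := hR.finite
  have hS := d.hS
  have hT := d.hT
  rcases double_cases comm with ⟨hL, hRt⟩ | ⟨g, hσ, hτ⟩ | ⟨g, hL, hRt⟩
  · rw [hL] at noRel
    have hlast : Ls (s.length - 1) ≠ Lt (t.length - 1) := by
      rw [d.Ls_last, d.Lt_last]
      nofun
    obtain ⟨M, hMN, hM, hlt⟩ := exists_first_ne (by omega) (by omega) d.us.L_add d.ut.L_add hlast
    rcases hR.exists_fits hM (d.sameStart hR noRel hlt) with ⟨x, hx⟩ | ⟨x, hx⟩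
    · exact (d.concatData_of_fits noRel hL hRt hlt hMN hx).nonempty_iso hs ht hc φ hφ
    · exact absurd (d.nonempty_homotopy_of_fits noRel hL hRt hlt hx hs ht φ hφ) hne
  · exact (d.concatData_of_append hσ hτ).nonempty_iso hs ht hc φ hφ
  · exact absurd (d.nonempty_homotopy_of_append hR hL hRt hs ht φ hφ) hne

end Overlaps

/-! ### The band word of the mapping cone -/

section ConeWords

variable {V : Type v} [Quiver.{w} V] {R : Arrow V → Arrow V → Prop}

lemma NPath.leftmost_eq_of_append_eq {p p' q q' : NPath R}
    (h : p.arrows ++ p'.arrows = q.arrows ++ q'.arrows) : p.leftmost = q.leftmost := by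
  have h1 : (p.arrows ++ p'.arrows).head (by simp [p.ne]) = p.leftmost :=
    List.head_append_of_ne_nil p.ne
  have h2 : (q.arrows ++ q'.arrows).head (by simp [q.ne]) = q.leftmost :=
    List.head_append_of_ne_nil q.ne
  rw [← h1, ← h2]
  simp only [h]

lemma NPath.rightmost_eq_of_append_eq {p p' q q' : NPath R}
    (h : p.arrows ++ p'.arrows = q.arrows ++ q'.arrows) : p'.rightmost = q'.rightmost := by
  have h1 : (p.arrows ++ p'.arrows).getLast (by simp [p.ne]) = p'.rightmost :=
    List.getLast_append_of_ne_nil _ p'.ne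
  have h2 : (q.arrows ++ q'.arrows).getLast (by simp [q.ne]) = q'.rightmost :=
    List.getLast_append_of_ne_nil _ q'.ne
  rw [← h1, ← h2]
  simp only [h]

lemma coneWord_eq (x y x' y' : List (Letter R)) (fL fR : NPath R) :
    coneWord x y x' y' fL fR
      = (x ++ .dir fL :: (barWord x' ++ barWord y')) ++ .inv fR :: y := by
  simp [coneWord]

lemma length_coneWord (x y x' y' : List (Letter R)) (fL fR σC τC : NPath R) :
    (coneWord x y x' y' fL fR).length
      = (x ++ .dir σC :: y).length + (x' ++ .dir τC :: y').length := by
  simp [coneWord, barWord]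
  omega

lemma balanced_coneWord {x y x' y' : List (Letter R)} (fL fR : NPath R) {σC τC : NPath R}
    (hσ : IsBandWord (x ++ .dir σC :: y)) (hτ : IsBandWord (x' ++ .dir τC :: y')) :
    (coneWord x y x' y' fL fR).countP Letter.isDir
      = (coneWord x y x' y' fL fR).countP (fun l => !l.isDir) := by
  have h1 := hσ.balanced
  have h2 := hτ.balanced
  unfold coneWord
  simp only [List.countP_append, List.countP_cons, countP_barWord] at h1 h2 ⊢
  simp only [Letter.isDir, if_true, Bool.not_true, Bool.not_false, Bool.false_eq_true,
    if_false] at h1 h2 ⊢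
  omega

/-- The letters of the word of the mapping cone, starting to the right of the letter that is
labelled by the right component of the double map. -/
structure ConeLetters (S T : ℕ) (Ls Lt Lc : ℕ → Letter R) (fL fR : NPath R) : Prop where
  Lc₁ : ∀ m < S - 1, Lc m = Ls m
  Lc₂ : Lc (S - 1) = .dir fL
  Lc₃ : ∀ m < T - 1, Lc (S + m) = Lt m
  Lc₄ : Lc (S + T - 1) = .inv fR

lemma coneLetters_of_getElem {S T : ℕ} (hS : 1 ≤ S) (hT : 1 ≤ T) {Ls Lt Lc : ℕ → Letter R}
    {fL fR : NPath R} {u v w : List (Letter R)} {l l' : Letter R}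
    (hu : u.length + 1 = S) (hv : v.length + 1 = T)
    (hs : ∀ m (hm : m < (u ++ [l]).length), Ls m = (u ++ [l])[m])
    (ht : ∀ m (hm : m < (v ++ [l']).length), Lt m = (v ++ [l'])[m])
    (hw : w = u ++ .dir fL :: v ++ [.inv fR])
    (hc : ∀ m (hm : m < w.length), Lc m = w[m]) :
    ConeLetters S T Ls Lt Lc fL fR := by
  subst hw
  refine ⟨fun m hm => ?_, ?_, fun m hm => ?_, ?_⟩
  · rw [hc m (by simp; omega), hs m (by simp; omega), List.getElem_append_left (by simp; omega),
      List.getElem_append_left (by omega), List.getElem_append_left (by omega)]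
  · have e : S - 1 = u.length := by omega
    rw [e, hc _ (by simp)]
    simp
  · rw [hc _ (by simp; omega), ht m (by simp; omega), List.getElem_append_left (by simp; omega),
      List.getElem_append_right (by omega), List.getElem_append_left (by omega)]
    have : S + m - u.length = m + 1 := by omega
    simp only [this, List.getElem_cons_succ]
  · rw [hc _ (by simp; omega), List.getElem_append_right (by simp; omega)]
    simp

/-- Only four junctions are new. `f_L` has the leftmost arrow of σ_C and `f_R` the rightmost arrow
of τ_C, which settles those to their left; the other two follow from the absence of relations in f_L
τ_C and σ_C f_R. -/
lemma ConeLetters.adjacent {k : Type u} [Field k] [Fintype V] (hR : IsGentle k R) {S T : ℕ}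
    (hS : 2 ≤ S) (hT : 2 ≤ T)
    {Ls Lt Lc : ℕ → Letter R} {σC τC fL fR : NPath R} (h : ConeLetters S T Ls Lt Lc fL fR)
    (hs : ∀ m, Adjacent (Ls m) (Ls (m + 1))) (ht : ∀ m, Adjacent (Lt m) (Lt (m + 1)))
    (Ls_last : Ls (S - 1) = .dir σC) (Lt_last : Lt (T - 1) = .inv τC)
    (hs0 : Adjacent (.dir σC) (Ls 0)) (ht0 : Adjacent (.inv τC) (Lt 0))
    (hc : Lc (S + T) = Lc 0)
    (comm : fL.arrows ++ τC.arrows = σC.arrows ++ fR.arrows)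
    (noRel : NoRel R (fL.arrows ++ τC.arrows)) (m : ℕ) (hm : m < S + T) :
    Adjacent (Lc m) (Lc (m + 1)) := by
  have hl := NPath.leftmost_eq_of_append_eq comm
  have hr := NPath.rightmost_eq_of_append_eq comm
  rcases Nat.lt_trichotomy m (S - 1) with h1 | h1 | h1
  · rw [h.Lc₁ m h1]
    rcases Nat.lt_or_ge (m + 1) (S - 1) with h2 | h2
    · rw [h.Lc₁ _ h2]
      exact hs m
    · have h3 : m + 1 = S - 1 := by omega
      have h4 := hs m
      rw [h3, Ls_last] at h4
      rw [h3, h.Lc₂]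
      exact h4.congr_dir hl.symm
  · have h2 := h.Lc₃ 0 (by omega)
    rw [h1, h.Lc₂, show S - 1 + 1 = S + 0 by omega, h2]
    exact hR.adjacent_dir noRel ht0
  · obtain ⟨n, rfl⟩ : ∃ n, m = S + n := ⟨m - S, by omega⟩
    rcases Nat.lt_or_ge n (T - 1) with h2 | h2
    · rw [h.Lc₃ n h2]
      rcases Nat.lt_or_ge (n + 1) (T - 1) with h3 | h3
      · rw [add_assoc, h.Lc₃ _ h3]
        exact ht n
      · have h4 : n + 1 = T - 1 := by omega
        have h5 := ht n
        rw [h4, Lt_last] at h5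
        rw [show S + n + 1 = S + T - 1 by omega, h.Lc₄]
        exact h5.congr_inv hr
    · rw [show S + n + 1 = S + T by omega, show S + n = S + T - 1 by omega, hc, h.Lc₄,
        h.Lc₁ 0 (by omega)]
      exact hR.adjacent_inv (comm ▸ noRel) hs0

lemma coneLetters_coneWord {x y x' y' : List (Letter R)} (σC τC fL fR : NPath R)
    (p : Fin (coneWord x y x' y' fL fR).length)
    (hp : (p : ℕ) = x.length + x'.length + y'.length + 1) :
    ConeLetters (x ++ .dir σC :: y).length (x' ++ .dir τC :: y').length
      (fun m => (x ++ .dir σC :: y).get (((finRotate _) ^ m)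
        (finRotate _ (midPos x (.dir σC) y))))
      (fun m => ((x' ++ .dir τC :: y').get (((finRotate _)⁻¹ ^ (m + 1))
        (midPos x' (.dir τC) y'))).bar)
      (fun m => (coneWord x y x' y' fL fR).get (((finRotate _) ^ m) (finRotate _ p))) fL fR := by
  refine coneLetters_of_getElem (u := y ++ x) (v := barWord x' ++ barWord y') (l := .dir σC)
    (l' := .inv τC)
    (w := (y ++ (x ++ .dir fL :: (barWord x' ++ barWord y'))) ++ [.inv fR]) (by simp; omega)
    (by simp; omega) (by simp; omega) (by simp [barWord]; omega) ?_ ?_ (by simp) ?_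
  · intro m hm
    exact get_forward rfl _ rfl m (by simp at hm ⊢; omega)
  · intro m hm
    exact get_backward rfl _ rfl m (by simp [barWord] at hm ⊢; omega)
  · intro m hm
    refine get_forward (coneWord_eq x y x' y' fL fR) p ?_ m ?_
    · simp [hp, barWord]
      omega
    · simp [coneWord, barWord] at hm ⊢
      omega

lemma two_le_length {x y : List (Letter R)} {l σ : Letter R}
    (h : (y ++ x).getLast? = some σ) : 2 ≤ (x ++ l :: y).length := by
  have : 0 < (y ++ x).length := by
    rw [List.length_pos_iff]
    rintro e
    rw [e] at h
    simp at h
  simp at this ⊢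
  omega

end ConeWords

/-! ### Joining the two bands -/

section Join

variable {k : Type u} [Field k] {V : Type v} [Fintype V] [Quiver.{w} V]
  {R : Arrow V → Arrow V → Prop}

lemma finRotate_pow_pred {n : ℕ} (p : Fin n) : ((finRotate n) ^ (n - 1)) (finRotate n p) = p := by
  have hn := p.pos
  rw [← Equiv.Perm.mul_apply, ← pow_succ, Nat.sub_add_cancel hn, finRotate_pow_length,
    Equiv.Perm.one_apply]

lemma finRotate_inv_pow_pred {n : ℕ} (p : Fin n) :
    ((finRotate n)⁻¹ ^ (n - 1)) p = finRotate n p := by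
  rw [inv_pow, Equiv.Perm.inv_eq_iff_eq, finRotate_pow_pred]

lemma finRotate_inv_pow_length {n : ℕ} (p : Fin n) :
    ((finRotate n)⁻¹ ^ (n - 1 + 1)) p = p := by
  rw [Nat.sub_add_cancel p.pos, inv_pow, finRotate_pow_length, inv_one, Equiv.Perm.one_apply]

lemma isBandWord_coneWord (hR : IsGentle k R) {x y x' y' : List (Letter R)}
    {σC τC fL fR : NPath R} (hσ : IsBandWord (x ++ .dir σC :: y))
    (hτ : IsBandWord (x' ++ .dir τC :: y'))
    (hS : 2 ≤ (x ++ .dir σC :: y).length) (hT : 2 ≤ (x' ++ .dir τC :: y').length)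
    (comm : fL.arrows ++ τC.arrows = σC.arrows ++ fR.arrows)
    (noRel : NoRel R (fL.arrows ++ τC.arrows)) : IsBandWord (coneWord x y x' y' fL fR) := by
  refine ⟨by simp [coneWord], fun i => ?_, balanced_coneWord fL fR hσ hτ⟩
  have hN := length_coneWord x y x' y' fL fR σC τC
  -- The position of the letter `f_R⁻¹`, after which the walk around `c` starts.
  let p : Fin (coneWord x y x' y' fL fR).length :=
    ⟨x.length + x'.length + y'.length + 1, by rw [hN]; simp; omega⟩
  -- Scalars play no role for adjacency; 1 is an arbitrary choice.
  have U := unrolling_forward hσ (1 : kˣ) (midPos x (.dir σC) y)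
    (finRotate _ (midPos x (.dir σC) y))
  have U' := unrolling_backward hτ (1 : kˣ) (midPos x' (.dir τC) y') (midPos x' (.dir τC) y')
  have hs : (x ++ .dir σC :: y).get (((finRotate _) ^ ((x ++ .dir σC :: y).length - 1))
      (finRotate _ (midPos x (.dir σC) y))) = .dir σC := by
    rw [finRotate_pow_pred]
    simp [midPos]
  have ht : ((x' ++ .dir τC :: y').get (((finRotate _)⁻¹ ^ ((x' ++ .dir τC :: y').length - 1 + 1))
      (midPos x' (.dir τC) y'))).bar = .inv τC := by
    rw [finRotate_inv_pow_length]
    simp [midPos, Letter.bar]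
  obtain ⟨m, ⟨hm, rfl⟩, -⟩ := finRotate_pow_bij (finRotate _ p) i
  have key := (coneLetters_coneWord σC τC fL fR p rfl).adjacent hR hS hT U.adj U'.adj hs ht
    (U.adj_zero hs) (U'.adj_zero ht)
    (by rw [← hN, finRotate_pow_length, pow_zero]) comm noRel m (by rwa [← hN])
  rwa [pow_succ', Equiv.Perm.mul_apply] at key

lemma joinData_coneWord {x y x' y' : List (Letter R)}
    {σC τC fL fR : NPath R} (hσ : IsBandWord (x ++ .dir σC :: y))
    (hτ : IsBandWord (x' ++ .dir τC :: y'))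
    (hS : 2 ≤ (x ++ .dir σC :: y).length) (hT : 2 ≤ (x' ++ .dir τC :: y').length)
    (comm : fL.arrows ++ τC.arrows = σC.arrows ++ fR.arrows)
    (hc : IsBandWord (coneWord x y x' y' fL fR))
    {lam mu : kˣ} {r : Fin (x ++ .dir σC :: y).length}
    (hr : ((x ++ .dir σC :: y).get r).isDir = true)
    {q : Fin (x' ++ .dir τC :: y').length} (hq : ((x' ++ .dir τC :: y').get q).isDir = true)
    {t : Fin (coneWord x y x' y' fL fR).length}
    (ht : ((coneWord x y x' y' fL fR).get t).isDir = true) {a b : ℤ}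
    (hdeg : deg (x ++ .dir σC :: y) a (midPos x (.dir σC) y)
      = deg (x' ++ .dir τC :: y') b (midPos x' (.dir τC) y'))
    {y₁ z : kˣ}
    (hyz : y₁ * scal mu q (midPos x' (.dir τC) y') = scal lam r (midPos x (.dir σC) y) * z)
    (p : Fin (coneWord x y x' y' fL fR).length)
    (hp : (p : ℕ) = x.length + x'.length + y'.length + 1) :
    JoinData (x ++ .dir σC :: y) (x' ++ .dir τC :: y') (coneWord x y x' y' fL fR) lam mu
      (-(lam * mu⁻¹)) r q t
      (fun m => ((finRotate _) ^ m) (finRotate _ (midPos x (.dir σC) y)))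
      (fun m => (x ++ .dir σC :: y).get (((finRotate _) ^ m)
        (finRotate _ (midPos x (.dir σC) y))))
      (fun m => scal lam r (((finRotate _) ^ m) (finRotate _ (midPos x (.dir σC) y))))
      (fun m => ((finRotate _)⁻¹ ^ m) (midPos x' (.dir τC) y'))
      (fun m => ((x' ++ .dir τC :: y').get (((finRotate _)⁻¹ ^ (m + 1))
        (midPos x' (.dir τC) y'))).bar)
      (fun m => scal mu q (((finRotate _)⁻¹ ^ (m + 1)) (midPos x' (.dir τC) y')))
      (fun m => ((finRotate _) ^ m) (finRotate _ p))
      (fun m => (coneWord x y x' y' fL fR).get (((finRotate _) ^ m) (finRotate _ p)))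
      (fun m => scal (-(lam * mu⁻¹)) t (((finRotate _) ^ m) (finRotate _ p)))
      σC τC fL fR y₁ z a b (a - 1) := by
  have hN := length_coneWord x y x' y' fL fR σC τC
  have us := unrolling_forward hσ lam r (finRotate _ (midPos x (.dir σC) y))
  have ut := unrolling_backward hτ mu q (midPos x' (.dir τC) y')
  have uc := unrolling_forward hc (-(lam * mu⁻¹)) t (finRotate _ p)
  have hL := coneLetters_coneWord σC τC fL fR p hp
  have gs := gauge_forward hσ lam (-1) 1 r (finRotate _ (midPos x (.dir σC) y)) hr
  have gt := gauge_backward hτ mu 1 (y₁ * (scal lam r (midPos x (.dir σC) y))⁻¹) q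
    (midPos x' (.dir τC) y') hq
  have gc := gauge_forward hc (-(lam * mu⁻¹)) 1 1 t (finRotate _ p) ht
  have hls : (x ++ .dir σC :: y).length = x.length + y.length + 1 := by simp; omega
  have hlt : (x' ++ .dir τC :: y').length = x'.length + y'.length + 1 := by simp; omega
  have deg_sub : ∀ m ≤ (x ++ .dir σC :: y).length - 1,
      deg (coneWord x y x' y' fL fR) (a - 1) (((finRotate _) ^ m) (finRotate _ p))
        - deg (x ++ .dir σC :: y) a (((finRotate _) ^ m) (finRotate _ (midPos x (.dir σC) y)))
      = deg (coneWord x y x' y' fL fR) (a - 1) (((finRotate _) ^ 0) (finRotate _ p))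
        - deg (x ++ .dir σC :: y) a (((finRotate _) ^ 0) (finRotate _ (midPos x (.dir σC) y))) := by
    intro m hm
    induction m with
    | zero => rfl
    | succ m ih =>
      rw [uc.deg, us.deg, hL.Lc₁ m (by omega), ← ih (by omega)]
      ring
  have deg₁ : ∀ m < (x ++ .dir σC :: y).length,
      deg (coneWord x y x' y' fL fR) (a - 1) (((finRotate _) ^ m) (finRotate _ p))
        = deg (x ++ .dir σC :: y) a (((finRotate _) ^ m) (finRotate _ (midPos x (.dir σC) y)))
          - 1 := by
    intro m hm
    have h1 := deg_sub m (by omega)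
    -- After `y.length` steps both walks are at index 0, the left endpoint of the word, where the
    -- degrees are prescribed.
    have h2 := deg_sub y.length (by omega)
    rw [deg_of_val_eq_zero _ (a - 1), deg_of_val_eq_zero _ a] at h2
    · omega
    · rw [← Equiv.Perm.mul_apply, ← pow_succ, val_finRotate_pow,
        show ((midPos x (.dir σC) y : Fin (x ++ .dir σC :: y).length) : ℕ) = x.length from rfl,
        show x.length + (y.length + 1) = (x ++ .dir σC :: y).length by omega, Nat.mod_self]
    · rw [← Equiv.Perm.mul_apply, ← pow_succ, val_finRotate_pow, hp,
        show x.length + x'.length + y'.length + 1 + (y.length + 1)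
          = (coneWord x y x' y' fL fR).length by omega, Nat.mod_self]
  have deg₂ : ∀ m < (x' ++ .dir τC :: y').length,
      deg (coneWord x y x' y' fL fR) (a - 1)
          (((finRotate _) ^ ((x ++ .dir σC :: y).length + m)) (finRotate _ p))
        = deg (x' ++ .dir τC :: y') b (((finRotate _)⁻¹ ^ m) (midPos x' (.dir τC) y')) := by
    intro m hm
    induction m with
    | zero =>
      -- Across `f_L` the degree rises by one, which undoes the shift; by `hdeg` the left ends of
      -- σ_C and τ_C have equal degrees.
      have h1 := deg₁ ((x ++ .dir σC :: y).length - 1) (by omega)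
      have h2 := uc.deg (a - 1) ((x ++ .dir σC :: y).length - 1)
      rw [Nat.sub_add_cancel (by omega), h1, hL.Lc₂, finRotate_pow_pred, hdeg] at h2
      rw [add_zero, h2, pow_zero, Equiv.Perm.one_apply]
      simp [Letter.sign]
    | succ m ih => rw [← add_assoc, uc.deg, ut.deg, ih (by omega), hL.Lc₃ m (by omega)]
  exact {
    us := us
    ut := ut
    hS := hS
    hT := hT
    Ls_last := by
      rw [finRotate_pow_pred]
      simp [midPos]
    Lt_last := by
      rw [finRotate_inv_pow_length]
      simp [midPos, Letter.bar]
    hyz := by rw [finRotate_inv_pow_length, finRotate_pow_pred, hyz]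
    uc := uc
    length := hN
    Lc₁ := hL.Lc₁
    Lc₂ := hL.Lc₂
    Lc₃ := hL.Lc₃
    Lc₄ := hL.Lc₄
    mono := by
      rw [finRotate_pow_pred, gs, gt, gc, one_mul, one_mul, neg_mul, mul_assoc, mul_comm mu⁻¹]
    tgt := congrArg Quiver.Total.right (NPath.leftmost_eq_of_append_eq comm)
    src := congrArg Quiver.Total.left (NPath.rightmost_eq_of_append_eq comm).symm
    deg₁ := deg₁
    deg₂ := deg₂ }

end Join

end

end Gentle

/-! ### The proposition -/

theorem mainTheorem7 {k : Type u} [Field k] [IsAlgClosed k] {V : Type v} [Fintype V]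
    [Quiver.{w} V] [Finite (Gentle.Arrow V)]
    (R : Gentle.Arrow V → Gentle.Arrow V → Prop) (hR : Gentle.IsGentle k R)
    -- the bands `σ = (β σ_L) σ_C (σ_R α)` and `τ = (δ τ_L) τ_C (τ_R γ)`, with
    -- `βL = β σ_L`, `αR = σ_R α`, `δL = δ τ_L`, `γR = τ_R γ`
    (βL αR δL γR : List (Gentle.Letter R)) (σC τC : Gentle.NPath R)
    (hσ : Gentle.IsHomotopyBand (βL ++ .dir σC :: αR))
    (hτ : Gentle.IsHomotopyBand (δL ++ .dir τC :: γR))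
    -- the neighbours of `σ_C` and `τ_C`, read cyclically
    (σL σR τL τR : Gentle.Letter R)
    (hσL : (αR ++ βL).getLast? = some σL) (hσR : (αR ++ βL).head? = some σR)
    (hτL : (γR ++ δL).getLast? = some τL) (hτR : (γR ++ δL).head? = some τR)
    -- the scalars, placed on arbitrary direct letters, and the degrees of the left endpoints
    (lam mu : kˣ)
    (r : Fin (βL ++ .dir σC :: αR).length)
    (hr : ((βL ++ .dir σC :: αR).get r).isDir = true)
    (q : Fin (δL ++ .dir τC :: γR).length)
    (hq : ((δL ++ .dir τC :: γR).get q).isDir = true)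
    (a b : ℤ)
    (hdeg : Gentle.deg (βL ++ .dir σC :: αR) a (Gentle.midPos βL (.dir σC) αR)
      = Gentle.deg (δL ++ .dir τC :: γR) b (Gentle.midPos δL (.dir τC) γR))
    -- the double map
    (fL fR : Gentle.NPath R)
    (hf : Gentle.IsDoublePair σL σR τL τR σC τC fL fR)
    (y z : kˣ)
    (hyz : y * Gentle.scal mu q (Gentle.midPos δL (.dir τC) γR)
      = Gentle.scal lam r (Gentle.midPos βL (.dir σC) αR) * z)
    (φ : Gentle.bandComplex hσ.toIsBandWord lam r a ⟶
      Gentle.bandComplex hτ.toIsBandWord mu q b)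
    (hφ : Gentle.HasComponents φ (Gentle.midPos βL (.dir σC) αR)
      (Gentle.midPos δL (.dir τC) γR) y z fL fR)
    -- it is nonzero in the homotopy category
    (hne : ¬ Nonempty (Homotopy φ 0)) :
    -- the word `c = β σ_L f_L τ_L⁻¹ δ⁻¹ γ⁻¹ τ_R⁻¹ f_R⁻¹ σ_R α`, the scalar being placed on any of
    -- its direct letters
    ∃ hc : Gentle.IsBandWord (Gentle.coneWord βL αR δL γR fL fR),
      ∀ t : Fin (Gentle.coneWord βL αR δL γR fL fR).length,
        ((Gentle.coneWord βL αR δL γR fL fR).get t).isDir = true →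
        Nonempty (CochainComplex.mappingCone φ ≅
          Gentle.bandComplex hc (-(lam * mu⁻¹)) t (a - 1)) := by
  have hS := Gentle.two_le_length (l := .dir σC) hσL
  have hT := Gentle.two_le_length (l := .dir τC) hτL
  have hc := Gentle.isBandWord_coneWord hR hσ.toIsBandWord hτ.toIsBandWord hS hT hf.comm hf.noRel
  refine ⟨hc, fun t ht => ?_⟩
  have hN := Gentle.length_coneWord βL αR δL γR fL fR σC τC
  have d := Gentle.joinData_coneWord hσ.toIsBandWord hτ.toIsBandWord hS hT hf.comm hc hr hq ht
    hdeg hyz ⟨βL.length + δL.length + γR.length + 1, by rw [hN]; simp; omega⟩ rfl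
  refine d.nonempty_iso hR hf.comm hf.noRel hσ.toIsBandWord hτ.toIsBandWord hc φ ?_ hne
  intro n f
  -- The walk on σ starts at the right end of σ_C and ends its period at the left end; on τ it is
  -- the other way round.
  rw [Gentle.finRotate_pow_pred, Gentle.finRotate_inv_pow_pred, pow_zero, pow_zero,
    Equiv.Perm.one_apply, Equiv.Perm.one_apply]
  exact hφ n f
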